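/- Let $n\ge 1$ and let $\alpha,\beta>0$ and $g,g_0,g_1,g_0',g_1'\ge 0$ be real. Put $\gamma=i\beta/2$, $\mu=i\beta g$, $\mu_\delta=i\beta g_\delta$, $\mu_\delta'=i\beta g_\delta'$ ($\delta=0,1$), and $$v_a(z)=\frac{\sin\alpha(\mu+z)}{\sin\alpha z},\qquad v_b(z)=\frac{\sin\alpha(\mu_0+z)}{\sin\alpha z}\,\frac{\cos\alpha(\mu_1+z)}{\cos\alpha z}\,\frac{\sin\alpha(\mu_0'+\gamma+z)}{\sin\alpha(\gamma+z)}\,\frac{\cos\alpha(\mu_1'+\gamma+z)}{\cos\alpha(\gamma+z)}.$$ For disjoint $J,K\subset\{1,\dots,n\}$ and signs $\varepsilon_j\in\{+1,-1\}$, $j\in J$, let $$V_{\varepsilon J;K}(x)=\prod_{j\in J}v_b(\varepsilon_jx_j)\prod_{\substack{j,j'\in J\\ j<j'}}v_a(\varepsilon_jx_j+\varepsilon_{j'}x_{j'})\,v_a(\varepsilon_jx_j+\varepsilon_{j'}x_{j'}+2\gamma)\prod_{\substack{j\in J\\ k\in K}}v_a(\varepsilon_jx_j+x_k)\,v_a(\varepsilon_jx_j-x_k).$$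 For $\kappa\in\mathbb Z^n$ let $(T_\kappa f)(x)=f(x+i\beta\kappa)$, let $J^c=\{1,\dots,n\}\setminus J$ and $\varepsilon_{J}=\sum_{j\in J}\varepsilon_je_j$ with $e_1,\dots,e_n$ the standard basis vectors. For $r=1,\dots,n$ define the difference operator $$\hat D_r=\sum_{\substack{J\subset\{1,\dots,n\},\,|J|=r\\ \varepsilon_j=\pm1,\,j\in J}}\ \sum_{\substack{\emptyset=J_0\subsetneq J_1\subsetneq\cdots\subsetneq J_s=J\\ 1\le s\le r}}(-1)^{s-1}\prod_{1\le s'\le s}V_{\varepsilon(J_{s'}\setminus J_{s'-1});J_{s'}^c}\,\bigl(T_{\varepsilon_{J_1}}-1\bigr).$$ Then $\hat D_1,\dots,\hat D_n$ mutually commute: for all $r,s\in\{1,\dots,n\}$, when the commutator $\hat D_r\hat D_s-\hat D_s\hat D_r$ is written as a finite sum $\sum_{\kappa\in\mathbb Z^n}c_\kappa(x)\,T_\kappa$, every coefficient $c_\kappa$ vanishes identically. That is, $c_\kappa(x)=0$ at every $x\in\mathbb C^n$ such that none of the denominators in the functions $V_{\varepsilon J;K}$ vanishes at any of the points $x+i\beta\nu$,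 $\nu\in\{-1,0,1\}^n$; in particular $(\hat D_r\hat D_sf)(x)=(\hat D_s\hat D_rf)(x)$ at all such $x$ for every function $f:\mathbb C^n\to\mathbb C$. -/

import Mathlib

open scoped BigOperators

noncomputable section

namespace Koornwinder

/-- The scale parameters `α, β` and the coupling constants `g, g_δ, g'_δ` (`δ = 0, 1`). -/
structure Params where
  α : ℝ
  β : ℝ
  g : ℝ
  g₀ : ℝ
  g₁ : ℝ
  g₀' : ℝ
  g₁' : ℝ

namespace Params

/-- The standing restrictions: `α, β > 0` and all coupling constants non-negative. -/
structure Admissible (p : Params) : Prop where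
  α_pos : 0 < p.α
  β_pos : 0 < p.β
  g_nonneg : 0 ≤ p.g
  g₀_nonneg : 0 ≤ p.g₀
  g₁_nonneg : 0 ≤ p.g₁
  g₀'_nonneg : 0 ≤ p.g₀'
  g₁'_nonneg : 0 ≤ p.g₁'

variable (p : Params)

/-- `γ = iβ/2`. -/
def γ : ℂ := Complex.I * p.β / 2

/-- `μ = iβg`. -/
def μ : ℂ := Complex.I * p.β * p.g

/-- `μ_0 = iβg_0`. -/
def μ₀ : ℂ := Complex.I * p.β * p.g₀

/-- `μ_1 = iβg_1`. -/
def μ₁ : ℂ := Complex.I * p.β * p.g₁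

/-- `μ'_0 = iβg'_0`. -/
def μ₀' : ℂ := Complex.I * p.β * p.g₀'

/-- `μ'_1 = iβg'_1`. -/
def μ₁' : ℂ := Complex.I * p.β * p.g₁'

/-- `v_a(z) = sin α(μ+z) / sin αz`. -/
def va (z : ℂ) : ℂ :=
  Complex.sin (p.α * (p.μ + z)) / Complex.sin (p.α * z)

/-- `v_b(z)`, a product of four trigonometric quotients. -/
def vb (z : ℂ) : ℂ :=
  Complex.sin (p.α * (p.μ₀ + z)) / Complex.sin (p.α * z) *
  (Complex.cos (p.α * (p.μ₁ + z)) / Complex.cos (p.α * z)) *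
  (Complex.sin (p.α * (p.μ₀' + p.γ + z)) / Complex.sin (p.α * (p.γ + z))) *
  (Complex.cos (p.α * (p.μ₁' + p.γ + z)) / Complex.cos (p.α * (p.γ + z)))

/-- The building block `V_{εJ;K}`; only the values of `ε` on `J` are used. -/
def V {n : ℕ} (ε : Fin n → ℤ) (J K : Finset (Fin n)) (x : Fin n → ℂ) : ℂ :=
  (∏ j ∈ J, p.vb (ε j * x j)) *
  (∏ j ∈ J, ∏ j' ∈ J with j < j',
    p.va (ε j * x j + ε j' * x j') * p.va (ε j * x j + ε j' * x j' + 2 * p.γ)) *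
  ∏ j ∈ J, ∏ k ∈ K, p.va (ε j * x j + x k) * p.va (ε j * x j - x k)

end Params

/-- The point `x + iβκ`, to which the translator `exp(-β ∑ κ_j θ_j)` moves `x`. -/
def shift {n : ℕ} (β : ℝ) (κ : Fin n → ℤ) (x : Fin n → ℂ) : Fin n → ℂ :=
  fun j => x j + Complex.I * β * κ j

/-- A difference operator `∑_κ c_κ(x) exp(-β ∑ κ_j θ_j)`, given by its finitely many
coefficient functions `c_κ`, `κ ∈ ℤⁿ`. -/
abbrev DiffOp (n : ℕ) : Type := (Fin n → ℤ) →₀ ((Fin n → ℂ) → ℂ)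

namespace DiffOp

variable {n : ℕ}

/-- The action on functions: `(A f)(x) = ∑_κ a_κ(x) f(x + iβκ)`. -/
def act (β : ℝ) (A : DiffOp n) (f : (Fin n → ℂ) → ℂ) : (Fin n → ℂ) → ℂ :=
  fun x => A.sum fun κ a => a x * f (shift β κ x)

/-- The composite operator `A B`: its coefficient at `ν` is
`x ↦ ∑_{κ + l = ν} a_κ(x) b_l(x + iβκ)`. -/
def comp (β : ℝ) (A B : DiffOp n) : DiffOp n :=
  A.sum fun κ a => B.sum fun l b =>
    Finsupp.single (κ + l) fun x => a x * b (shift β κ x)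

/-- The commutator `[A, B] = A B - B A`. -/
def commutator (β : ℝ) (A B : DiffOp n) : DiffOp n :=
  comp β A B - comp β B A

theorem shift_shift (β : ℝ) (κ l : Fin n → ℤ) (x : Fin n → ℂ) :
    shift β l (shift β κ x) = shift β (κ + l) x := by
  funext j
  simp only [shift, Pi.add_apply, Int.cast_add]
  ring

/-- `comp` is the composition of operators. -/
theorem act_comp (β : ℝ) (A B : DiffOp n) (f : (Fin n → ℂ) → ℂ) :
    act β (comp β A B) f = act β A (act β B f) := by
  classical
  funext x
  have h0 : ∀ κ : Fin n → ℤ, (0 : (Fin n → ℂ) → ℂ) x * f (shift β κ x) = 0 := by simp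
  have ha : ∀ (κ : Fin n → ℤ) (a b : (Fin n → ℂ) → ℂ),
      (a + b) x * f (shift β κ x) = a x * f (shift β κ x) + b x * f (shift β κ x) := by
    intro κ a b
    simp [add_mul]
  simp only [act, comp]
  rw [Finsupp.sum_sum_index h0 ha]
  refine Finsupp.sum_congr fun κ _ => ?_
  rw [Finsupp.sum_sum_index h0 ha, Finsupp.mul_sum]
  refine Finsupp.sum_congr fun l _ => ?_
  rw [Finsupp.sum_single_index (h0 _), shift_shift]
  ring

end DiffOp

namespace Params

variable (p : Params) {n : ℕ}

/-- The sign configurations `ε_j = ±1`, `j ∈ J` (extended by `0` outside `J`, so that every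
configuration on `J` is counted once). -/
def signs (J : Finset (Fin n)) : Finset (Fin n → ℤ) :=
  Fintype.piFinset fun j => if j ∈ J then {1, -1} else {0}

/-- The chains `∅ = J_0 ⊊ J_1 ⊊ ⋯ ⊊ J_s = J`. -/
def chains (s : ℕ) (J : Finset (Fin n)) : Finset (Fin (s + 1) → Finset (Fin n)) :=
  {c | c 0 = ∅ ∧ StrictMono c ∧ c (Fin.last s) = J}

/-- The vector `∑_{j ∈ J} ε_j e_j` of the translator `exp(-β θ_{εJ})`. -/
def signVec (ε : Fin n → ℤ) (J : Finset (Fin n)) : Fin n → ℤ :=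
  fun j => if j ∈ J then ε j else 0

/-- The product `∏_{1 ≤ s' ≤ s} V_{ε(J_{s'} ∖ J_{s'-1}); J_{s'}ᶜ}` of a chain. -/
def chainCoeff {s : ℕ} (ε : Fin n → ℤ) (c : Fin (s + 1) → Finset (Fin n))
    (x : Fin n → ℂ) : ℂ :=
  ∏ i : Fin s, p.V ε (c i.succ \ c i.castSucc) (c i.succ)ᶜ x

/-- The difference operator `D̂_r` in `n` variables. The length of a chain is written
`s = t + 1` with `0 ≤ t < r`, so that the sign `(-1)^(s-1)` is `(-1)^t`. -/
def D (n r : ℕ) : DiffOp n :=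
  ∑ J : Finset (Fin n) with J.card = r, ∑ ε ∈ signs J,
    ∑ t ∈ Finset.range r, ∑ c ∈ chains (t + 1) J,
      (Finsupp.single (signVec ε (c 1)) (fun x => (-1) ^ t * p.chainCoeff ε c x) -
        Finsupp.single 0 (fun x => (-1) ^ t * p.chainCoeff ε c x))

/-- No denominator of the coefficients of `D̂_1, …, D̂_n` vanishes at `x`. -/
structure RegularAt (x : Fin n → ℂ) : Prop where
  sin_ne : ∀ j, Complex.sin (p.α * x j) ≠ 0
  cos_ne : ∀ j, Complex.cos (p.α * x j) ≠ 0
  sin_γ_ne : ∀ j, ∀ ε ∈ ({1, -1} : Finset ℤ), Complex.sin (p.α * (p.γ + ε * x j)) ≠ 0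
  cos_γ_ne : ∀ j, ∀ ε ∈ ({1, -1} : Finset ℤ), Complex.cos (p.α * (p.γ + ε * x j)) ≠ 0
  sin_pair_ne : ∀ j k, j ≠ k → ∀ ε ∈ ({1, -1} : Finset ℤ), ∀ ε' ∈ ({1, -1} : Finset ℤ),
    Complex.sin (p.α * (ε * x j + ε' * x k)) ≠ 0
  sin_pair_γ_ne : ∀ j k, j ≠ k → ∀ ε ∈ ({1, -1} : Finset ℤ), ∀ ε' ∈ ({1, -1} : Finset ℤ),
    Complex.sin (p.α * (ε * x j + ε' * x k + 2 * p.γ)) ≠ 0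

/-- All coefficients that enter a product of two of the operators at `x` are regular: those at
`x` itself and at its translates `x + iβκ` with `κ ∈ {-1, 0, 1}ⁿ`. -/
def CommutatorRegularAt (x : Fin n → ℂ) : Prop :=
  ∀ κ : Fin n → ℤ, (∀ j, |κ j| ≤ 1) → p.RegularAt (shift p.β κ x)

end Params

end Koornwinder

end

/-! The operators are recognised as commuting because they are triangular and symmetric on a space
of polynomials that separates translates. Everything is done in the exponentials `E z = exp(2iαz)`
at generic points, where no denominator vanishes even after translation by multiples of `γ`.

The sum over chains can be carried out. The alternating sum over signs `σ` of `∏ σ_j ∏ v_a(σ_j y_j +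
σ_k y_k)` vanishes (`alternating_sum_eq_zero`): it is a Laurent polynomial that is bounded in all
regular directions, hence constant, and it is odd. With this identity the chains telescope
(`chainSum_eq`), and the operator of order `r` becomes a single sum over `J` and two families of
signs `ε`, `σ` (`act_D`). The index `j` is translated by `iβε_j` where `σ_j = 1` and stays where
`σ_j = -1`.

In this form the operators preserve the Laurent polynomials invariant under signed permutations
(`closedOp_isLaurent`). The poles on the mirrors are simple, so invariance removes them; the other
poles of `v_b` are removed because the sum over `σ` is divisible by the matching sines. Along rays
in regular directions all coefficients tend to constants. Constant coefficient operators commute, so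
a commutator strictly lowers the degree (`bracket_lowers`).

If `g` is a positive integer and the other couplings are natural numbers, there is a Laurent
polynomial weight with respect to which each term of an operator is adjoint to another term
(`block_adjoint`). The operators are then symmetric, and a commutator `C` is antisymmetric, for the
bilinear constant term pairing with that weight. Complex conjugation commutes with the operators and
the weight is a square modulus, so the pairing of `C f` with its own conjugate is positive definite
and `C² f = 0` forces `C f = 0`. Since `C f` has lower degree than `f`, induction on the degree
gives `C f = 0` for every invariant `f` (`NatCouplings.bracket_eq_zero`).

Invariant polynomials separate the translates of a generic point, so every coefficient of `C`
vanishes there, and by continuity at every regular point. With `x`, `α`, `β` fixed, a coefficient of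
`C` is a Laurent polynomial in the exponential of each coupling constant. Vanishing at the positive
integers therefore implies vanishing for all real couplings (`induction_couplings`). -/

noncomputable section

namespace Koornwinder

namespace Params

variable (p : Params) {n : ℕ}

/-! ### Exponentials and generic points -/

/-- The exponential `exp(2iαz)`. -/
def E (z : ℂ) : ℂ := Complex.exp (2 * Complex.I * p.α * z)

theorem E_add (z w : ℂ) : p.E (z + w) = p.E z * p.E w := by
  simp only [E, ← Complex.exp_add]; congr 1; ring

theorem E_ne_zero (z : ℂ) : p.E z ≠ 0 := Complex.exp_ne_zero _

theorem E_zero : p.E 0 = 1 := by simp [E]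

theorem E_neg (z : ℂ) : p.E (-z) = (p.E z)⁻¹ := by
  simp only [E, ← Complex.exp_neg]; congr 1; ring

theorem E_sub (z w : ℂ) : p.E (z - w) = p.E z / p.E w := by
  rw [sub_eq_add_neg, E_add, E_neg, div_eq_mul_inv]

theorem E_sum {ι : Type*} (s : Finset ι) (f : ι → ℂ) :
    p.E (∑ i ∈ s, f i) = ∏ i ∈ s, p.E (f i) := by
  simp only [E, Finset.mul_sum, Complex.exp_sum]

theorem continuous_E : Continuous p.E := by unfold E; fun_prop

theorem sin_eq_E (z : ℂ) : Complex.sin (p.α * z) =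
    Complex.exp (-(Complex.I * p.α * z)) / (2 * Complex.I) * (p.E z - 1) := by
  have h : p.E z = Complex.exp (Complex.I * p.α * z) * Complex.exp (Complex.I * p.α * z) := by
    simp only [E, ← Complex.exp_add]; congr 1; ring
  rw [Complex.sin, h, Complex.exp_neg]
  have h1 : (p.α : ℂ) * z * Complex.I = Complex.I * p.α * z := by ring
  have h2 : -((p.α : ℂ) * z) * Complex.I = -(Complex.I * p.α * z) := by ring
  rw [h1, h2, Complex.exp_neg]
  have := Complex.exp_ne_zero (Complex.I * p.α * z)
  have hI := Complex.I_ne_zero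
  field_simp
  rw [Complex.I_sq]; ring

theorem cos_eq_E (z : ℂ) : Complex.cos (p.α * z) =
    Complex.exp (-(Complex.I * p.α * z)) / 2 * (p.E z + 1) := by
  have h : p.E z = Complex.exp (Complex.I * p.α * z) * Complex.exp (Complex.I * p.α * z) := by
    simp only [E, ← Complex.exp_add]; congr 1; ring
  rw [Complex.cos, h, Complex.exp_neg]
  have h1 : (p.α : ℂ) * z * Complex.I = Complex.I * p.α * z := by ring
  have h2 : -((p.α : ℂ) * z) * Complex.I = -(Complex.I * p.α * z) := by ring
  rw [h1, h2, Complex.exp_neg]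
  have := Complex.exp_ne_zero (Complex.I * p.α * z)
  field_simp

/-- The exponential prefactors of numerator and denominator differ only by the factor belonging to
`μ`, so the quotient is a constant times a rational expression in exponentials. -/
theorem sin_ratio (μ z : ℂ) : Complex.sin (p.α * (μ + z)) / Complex.sin (p.α * z) =
    Complex.exp (-(Complex.I * p.α * μ)) * ((p.E (μ + z) - 1) / (p.E z - 1)) := by
  rw [sin_eq_E, sin_eq_E]
  have h : Complex.exp (-(Complex.I * p.α * (μ + z))) =
      Complex.exp (-(Complex.I * p.α * μ)) * Complex.exp (-(Complex.I * p.α * z)) := by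
    rw [← Complex.exp_add]; congr 1; ring
  rw [h]
  have := Complex.exp_ne_zero (-(Complex.I * p.α * z))
  have hI := Complex.I_ne_zero
  rw [mul_div_mul_comm, mul_div_assoc _ (Complex.exp _) (2 * Complex.I), mul_div_assoc, div_self,
    mul_one]
  simp [this, hI]

theorem cos_ratio (μ z : ℂ) : Complex.cos (p.α * (μ + z)) / Complex.cos (p.α * z) =
    Complex.exp (-(Complex.I * p.α * μ)) * ((p.E (μ + z) + 1) / (p.E z + 1)) := by
  rw [cos_eq_E, cos_eq_E]
  have h : Complex.exp (-(Complex.I * p.α * (μ + z))) =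
      Complex.exp (-(Complex.I * p.α * μ)) * Complex.exp (-(Complex.I * p.α * z)) := by
    rw [← Complex.exp_add]; congr 1; ring
  rw [h]
  have := Complex.exp_ne_zero (-(Complex.I * p.α * z))
  rw [mul_div_mul_comm, mul_div_assoc _ (Complex.exp _) 2, mul_div_assoc, div_self, mul_one]
  simp [this]

/-- The phase `exp(-iαμ)`. -/
def phase (μ : ℂ) : ℂ := Complex.exp (-(Complex.I * p.α * μ))

theorem va_eq (z : ℂ) : p.va z = p.phase p.μ * ((p.E (p.μ + z) - 1) / (p.E z - 1)) := by
  rw [va, sin_ratio, phase]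

theorem vb_eq (z : ℂ) : p.vb z =
    p.phase p.μ₀ * p.phase p.μ₁ * p.phase p.μ₀' * p.phase p.μ₁' *
      ((p.E (p.μ₀ + z) - 1) / (p.E z - 1) * ((p.E (p.μ₁ + z) + 1) / (p.E z + 1)) *
      ((p.E (p.μ₀' + (p.γ + z)) - 1) / (p.E (p.γ + z) - 1)) *
      ((p.E (p.μ₁' + (p.γ + z)) + 1) / (p.E (p.γ + z) + 1))) := by
  rw [vb, sin_ratio, cos_ratio, add_assoc p.μ₀', add_assoc p.μ₁', sin_ratio, cos_ratio]
  simp only [phase]; ring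

/-- Points at which no denominator of a coefficient vanishes, even after arbitrary translations of
the coordinates by multiples of `γ`. -/
structure Generic (x : Fin n → ℂ) : Prop where
  sq_ne : ∀ j, ∀ m : ℤ, p.E (x j + m * p.γ) ^ 2 ≠ 1
  add_ne : ∀ j k, j ≠ k → ∀ m : ℤ, p.E (x j + x k + m * p.γ) ≠ 1
  sub_ne : ∀ j k, j ≠ k → ∀ m : ℤ, p.E (x j - x k + m * p.γ) ≠ 1

variable {p}

theorem Generic.signed_ne {x : Fin n → ℂ} (hx : p.Generic x) {j : Fin n} (m : ℤ) {ε : ℤ}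
    (hε : ε = 1 ∨ ε = -1) : p.E (ε * x j + m * p.γ) ^ 2 ≠ 1 := by
  rcases hε with rfl | rfl
  · simpa using hx.sq_ne j m
  · have h := hx.sq_ne j (-m)
    contrapose h
    have e : x j + ((-m : ℤ) : ℂ) * p.γ = -(((-1 : ℤ) : ℂ) * x j + m * p.γ) := by push_cast; ring
    rw [e, E_neg, inv_pow, h, inv_one]

theorem Generic.pair_ne {x : Fin n → ℂ} (hx : p.Generic x) {j k : Fin n} (hjk : j ≠ k) (m : ℤ)
    {ε ε' : ℤ} (hε : ε = 1 ∨ ε = -1) (hε' : ε' = 1 ∨ ε' = -1) :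
    p.E (ε * x j + ε' * x k + m * p.γ) ≠ 1 := by
  have key : ∀ z w : ℂ, p.E z ≠ 1 → w = -z → p.E w ≠ 1 := by
    rintro z w h rfl
    rwa [E_neg, Ne, inv_eq_one]
  rcases hε with rfl | rfl <;> rcases hε' with rfl | rfl
  · simpa using hx.add_ne j k hjk m
  · simpa [sub_eq_add_neg] using hx.sub_ne j k hjk m
  · exact key _ _ (hx.sub_ne j k hjk (-m)) (by push_cast; ring)
  · exact key _ _ (hx.add_ne j k hjk (-m)) (by push_cast; ring)

/-- Signed coordinate permutations and translations by multiples of `γ` preserve genericity. -/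
theorem Generic.affine {x : Fin n → ℂ} (hx : p.Generic x) (π : Equiv.Perm (Fin n))
    (ε m : Fin n → ℤ) (hε : ∀ j, ε j = 1 ∨ ε j = -1) :
    p.Generic (fun j => ε j * x (π j) + m j * p.γ) where
  sq_ne j l := by
    have := hx.signed_ne (j := π j) (m j + l) (hε j)
    convert this using 3; push_cast; ring
  add_ne j k hjk l := by
    have := hx.pair_ne (π.injective.ne hjk) (m j + m k + l) (hε j) (hε k)
    convert this using 2; push_cast; ring
  sub_ne j k hjk l := by
    have hk : -ε k = 1 ∨ -ε k = -1 := by rcases hε k with h | h <;> simp [h]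
    have := hx.pair_ne (π.injective.ne hjk) (m j - m k + l) (hε j) hk
    convert this using 2; push_cast; ring

theorem E_eq_one_iff (h : 0 < p.α) (z : ℂ) : p.E z = 1 ↔ ∃ m : ℤ, z = m * Real.pi / p.α := by
  have hα : (p.α : ℂ) ≠ 0 := by exact_mod_cast h.ne'
  rw [E, Complex.exp_eq_one_iff]
  refine exists_congr fun m => ?_
  rw [eq_div_iff hα]
  constructor
  · intro h
    have hI := Complex.I_ne_zero
    have : (2 * Complex.I) * (z * p.α) = (2 * Complex.I) * (m * Real.pi) := by
      linear_combination h
    exact mul_left_cancel₀ (by simp) this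
  · intro h; linear_combination (2 * Complex.I) * h

/-- The solutions of `E z = 1` form a discrete sequence indexed by `ℤ`, and on a line with nonzero
velocity the parameter is determined by the integer. -/
theorem countable_line (h : 0 < p.α) (c : ℂ) {a : ℝ} (ha : a ≠ 0) :
    {s : ℝ | p.E (c + s * a) = 1}.Countable := by
  refine (Set.countable_range fun m : ℤ => ((m * Real.pi / p.α - c) / a : ℂ).re).mono ?_
  intro s hs
  obtain ⟨m, hm⟩ := (E_eq_one_iff h _).1 hs
  refine ⟨m, ?_⟩
  have ha' : (a : ℂ) ≠ 0 := by exact_mod_cast ha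
  have : ((m * Real.pi / p.α - c) / a : ℂ) = (s : ℂ) := by
    rw [← hm]; field_simp; ring
  simp only [this, Complex.ofReal_re]

/-- The direction `(1, 2, …, n)`, which lies on no reflection hyperplane. -/
def dir (n : ℕ) (j : Fin n) : ℤ := j + 1

/-- On the real line through `x` in direction `(1, 2, …, n)`, each of the countably many conditions
fails only for countably many parameters, because the direction has nonzero coordinates, sums and
differences. The complement of a countable subset of `ℝ` is dense, so generic points accumulate at
parameter `0`. -/
theorem dense_generic (h : 0 < p.α) (x : Fin n → ℂ) : x ∈ closure {y | p.Generic y} := by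
  have hne : ∀ (j k : Fin n), j ≠ k → ((dir n j : ℝ) - dir n k) ≠ 0 := by
    intro j k hjk h0
    apply hjk
    have : (dir n j : ℝ) = dir n k := sub_eq_zero.1 h0
    have : dir n j = dir n k := by exact_mod_cast this
    simp only [dir] at this
    exact Fin.ext (by omega)
  have hpos : ∀ j : Fin n, (0 : ℝ) < dir n j := by
    intro j
    have : 0 < dir n j := by simp only [dir]; omega
    exact_mod_cast this
  let y : ℝ → Fin n → ℂ := fun s j => x j + s * (dir n j : ℝ)
  have hbad : {s : ℝ | ¬ p.Generic (y s)}.Countable := by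
    have hsub : {s : ℝ | ¬ p.Generic (y s)} ⊆
        (⋃ j : Fin n, ⋃ m : ℤ, {s : ℝ | p.E (2 * (x j + m * p.γ) + s * ((2 * dir n j : ℝ) : ℝ)) = 1})
        ∪ (⋃ j : Fin n, ⋃ k : Fin n, ⋃ m : ℤ,
          {s : ℝ | p.E (x j + x k + m * p.γ + s * ((dir n j + dir n k : ℝ) : ℝ)) = 1})
        ∪ (⋃ j : Fin n, ⋃ k : Fin n, ⋃ (_ : j ≠ k), ⋃ m : ℤ,
          {s : ℝ | p.E (x j - x k + m * p.γ + s * ((dir n j - dir n k : ℝ) : ℝ)) = 1}) := by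
      intro s hs
      by_contra hcon
      simp only [Set.mem_union, Set.mem_iUnion, Set.mem_ofPred_eq, not_or, not_exists] at hcon
      apply hs
      refine ⟨fun j m => ?_, fun j k hjk m => ?_, fun j k hjk m => ?_⟩
      · have := hcon.1.1 j m
        contrapose! this
        rw [← this, sq, ← E_add]; congr 1; simp only [y]; push_cast; ring
      · have := hcon.1.2 j k m
        contrapose! this
        rw [← this]; congr 1; simp only [y]; push_cast; ring
      · have := hcon.2 j k hjk m
        contrapose! this
        rw [← this]; congr 1; simp only [y]; push_cast; ring
    refine Set.Countable.mono hsub ?_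
    refine Set.Countable.union (Set.Countable.union ?_ ?_) ?_
    · exact Set.countable_iUnion fun j => Set.countable_iUnion fun m =>
        countable_line h _ (by have := hpos j; positivity)
    · exact Set.countable_iUnion fun j => Set.countable_iUnion fun k => Set.countable_iUnion fun m =>
        countable_line h _ (by have := hpos j; have := hpos k; positivity)
    · exact Set.countable_iUnion fun j => Set.countable_iUnion fun k =>
        Set.countable_iUnion fun hjk => Set.countable_iUnion fun m =>
          countable_line h _ (hne j k hjk)
  have hd := (hbad.dense_compl ℝ) 0
  have hc : Continuous y := by
    refine continuous_pi fun j => ?_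
    simp only [y]; fun_prop
  have h0 : y 0 = x := by funext j; simp [y]
  rw [← h0]
  refine closure_mono ?_ (image_closure_subset_closure_image hc ⟨0, hd, rfl⟩)
  rintro _ ⟨s, hs, rfl⟩
  simpa using hs

/-- This is the device that lets identities be checked only where all denominators are invertible.
-/
theorem eq_zero_of_generic (h : 0 < p.α) {φ : (Fin n → ℂ) → ℂ} {x : Fin n → ℂ}
    (hφ : ContinuousAt φ x) (h0 : ∀ y, p.Generic y → φ y = 0) : φ x = 0 := by
  have hx := mem_closure_iff_frequently.1 (dense_generic h x)
  by_contra hne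
  have := hφ.eventually_ne hne
  obtain ⟨y, hy, hy'⟩ := (hx.and_eventually this).exists
  exact hy' (h0 y hy)

variable (p)

/-! ### Laurent polynomials as functions -/

/-- The Laurent monomial `exp(2iα⟨k,x⟩)`. -/
def mono (k : Fin n → ℤ) (x : Fin n → ℂ) : ℂ := p.E (∑ j, k j * x j)

theorem mono_add (k l : Fin n → ℤ) (x : Fin n → ℂ) :
    p.mono (k + l) x = p.mono k x * p.mono l x := by
  simp only [mono, ← E_add, ← Finset.sum_add_distrib]
  congr 1
  refine Finset.sum_congr rfl fun j _ => ?_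
  simp only [Pi.add_apply, Int.cast_add]; ring

theorem mono_zero (x : Fin n → ℂ) : p.mono 0 x = 1 := by simp [mono, E_zero]

theorem mono_vadd (k : Fin n → ℤ) (x y : Fin n → ℂ) :
    p.mono k (x + y) = p.mono k x * p.mono k y := by
  simp only [mono, ← E_add, ← Finset.sum_add_distrib]
  congr 1
  refine Finset.sum_congr rfl fun j _ => ?_
  simp only [Pi.add_apply]; ring

theorem continuous_mono (k : Fin n → ℤ) : Continuous (p.mono k) := by
  unfold mono
  exact p.continuous_E.comp (by fun_prop)

/-- The Laurent polynomial with given coefficients, as a function of `x`. -/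
def ev : ((Fin n → ℤ) →₀ ℂ) →ₗ[ℂ] ((Fin n → ℂ) → ℂ) := Finsupp.linearCombination ℂ p.mono

theorem ev_apply (c : (Fin n → ℤ) →₀ ℂ) (x : Fin n → ℂ) :
    p.ev c x = ∑ k ∈ c.support, c k * p.mono k x := by
  simp [ev, Finsupp.linearCombination_apply, Finsupp.sum, Finset.sum_apply]

theorem ev_single (k : Fin n → ℤ) (a : ℂ) (x : Fin n → ℂ) :
    p.ev (Finsupp.single k a) x = a * p.mono k x := by
  simp [ev]

theorem continuous_ev (c : (Fin n → ℤ) →₀ ℂ) : Continuous (p.ev c) := by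
  have : p.ev c = fun x => ∑ k ∈ c.support, c k * p.mono k x := funext (p.ev_apply c)
  rw [this]
  exact continuous_finsetSum _ fun k _ => continuous_const.mul (p.continuous_mono k)

variable {p}

theorem mono_injective (h : 0 < p.α) : Function.Injective (p.mono (n := n)) := by
  intro k l hkl
  funext j
  have hα : (p.α : ℂ) ≠ 0 := by exact_mod_cast h.ne'
  have hI := Complex.I_ne_zero
  -- At this test point the two monomials take the values `exp (k j)` and `exp (l j)`, and the real
  -- exponential is injective.
  have h1 := congrFun hkl (Pi.single j (1 / (2 * Complex.I * p.α)))
  simp only [mono, E, Pi.single_apply, mul_ite, mul_zero, Finset.sum_ite_eq', Finset.mem_univ,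
    if_true] at h1
  have e : ∀ a : ℤ, 2 * Complex.I * p.α * (a * (1 / (2 * Complex.I * p.α))) = a := by
    intro a; field_simp
  rw [e, e] at h1
  have h2 : Real.exp (k j) = Real.exp (l j) := by
    have : ((Real.exp (k j) : ℝ) : ℂ) = (Real.exp (l j) : ℝ) := by push_cast; exact h1
    exact_mod_cast this
  exact_mod_cast Real.exp_injective h2

/-- Monomials are pairwise distinct characters of the additive group `ℂⁿ`, so Dedekind's
independence of characters applies. -/
theorem linearIndependent_mono (h : 0 < p.α) : LinearIndependent ℂ (p.mono (n := n)) := by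
  let χ : (Fin n → ℤ) → (Multiplicative (Fin n → ℂ) →* ℂ) := fun k =>
    { toFun := fun x => p.mono k x.toAdd
      map_one' := by simp [mono, E_zero]
      map_mul' := fun x y => by rw [toAdd_mul, mono_vadd] }
  have hχ : Function.Injective χ := by
    intro k l hkl
    apply mono_injective h
    funext x
    exact DFunLike.congr_fun hkl (Multiplicative.ofAdd x)
  exact (linearIndependent_monoidHom (Multiplicative (Fin n → ℂ)) ℂ).comp χ hχ

theorem ev_eq_zero (h : 0 < p.α) {c : (Fin n → ℤ) →₀ ℂ} (hc : ∀ x, p.Generic x → p.ev c x = 0) :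
    c = 0 := by
  have : p.ev c = 0 := by
    funext x
    exact eq_zero_of_generic h (p.continuous_ev c).continuousAt hc
  exact (linearIndependent_iff.1 (linearIndependent_mono h)) c this

theorem ev_inj (h : 0 < p.α) {c d : (Fin n → ℤ) →₀ ℂ}
    (hc : ∀ x, p.Generic x → p.ev c x = p.ev d x) : c = d := by
  refine sub_eq_zero.1 (ev_eq_zero h fun x hx => ?_)
  rw [map_sub, Pi.sub_apply, hc x hx, sub_self]

variable (p n)

/-- The algebra of Laurent polynomials, as functions of `x`. -/
def laurent : Subalgebra ℂ ((Fin n → ℂ) → ℂ) where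
  carrier := Set.range p.ev
  mul_mem' := by
    rintro _ _ ⟨c, rfl⟩ ⟨d, rfl⟩
    refine ⟨∑ k ∈ c.support, ∑ l ∈ d.support, Finsupp.single (k + l) (c k * d l), ?_⟩
    funext x
    rw [Pi.mul_apply, ev_apply p c, ev_apply p d, Finset.sum_mul_sum]
    simp only [map_sum, Finset.sum_apply, ev_single, mono_add]
    refine Finset.sum_congr rfl fun k _ => Finset.sum_congr rfl fun l _ => ?_
    ring
  add_mem' := by
    rintro _ _ ⟨c, rfl⟩ ⟨d, rfl⟩
    exact ⟨c + d, map_add _ _ _⟩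
  algebraMap_mem' a := ⟨Finsupp.single 0 a, by
    funext x; simp [ev_single, mono_zero]⟩

variable {n}

/-- The function agrees at generic points with a Laurent polynomial. -/
def IsLaurent (φ : (Fin n → ℂ) → ℂ) : Prop :=
  ∃ ψ ∈ p.laurent n, ∀ x, p.Generic x → φ x = ψ x

variable {p}

theorem isLaurent_iff {φ : (Fin n → ℂ) → ℂ} :
    p.IsLaurent φ ↔ ∃ c, ∀ x, p.Generic x → φ x = p.ev c x := by
  constructor
  · rintro ⟨_, ⟨c, rfl⟩, h⟩; exact ⟨c, h⟩
  · rintro ⟨c, h⟩; exact ⟨_, ⟨c, rfl⟩, h⟩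

theorem isLaurent_ev (c : (Fin n → ℤ) →₀ ℂ) : p.IsLaurent (p.ev c) := ⟨_, ⟨c, rfl⟩, fun _ _ => rfl⟩

theorem isLaurent_of_mem {φ : (Fin n → ℂ) → ℂ} (h : φ ∈ p.laurent n) : p.IsLaurent φ :=
  ⟨_, h, fun _ _ => rfl⟩

namespace IsLaurent

theorem congr {φ ψ : (Fin n → ℂ) → ℂ} (hφ : p.IsLaurent φ) (h : ∀ x, p.Generic x → ψ x = φ x) :
    p.IsLaurent ψ := by
  obtain ⟨χ, hχ, hc⟩ := hφ
  exact ⟨χ, hχ, fun x hx => (h x hx).trans (hc x hx)⟩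

theorem const (a : ℂ) : p.IsLaurent (fun _ : Fin n → ℂ => a) :=
  ⟨_, (p.laurent n).algebraMap_mem a, fun _ _ => rfl⟩

theorem add {φ ψ : (Fin n → ℂ) → ℂ} (hφ : p.IsLaurent φ) (hψ : p.IsLaurent ψ) :
    p.IsLaurent (fun x => φ x + ψ x) := by
  obtain ⟨φ', h1, h1'⟩ := hφ
  obtain ⟨ψ', h2, h2'⟩ := hψ
  exact ⟨_, add_mem h1 h2, fun x hx => by simp only [h1' x hx, h2' x hx, Pi.add_apply]⟩

theorem mul {φ ψ : (Fin n → ℂ) → ℂ} (hφ : p.IsLaurent φ) (hψ : p.IsLaurent ψ) :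
    p.IsLaurent (fun x => φ x * ψ x) := by
  obtain ⟨φ', h1, h1'⟩ := hφ
  obtain ⟨ψ', h2, h2'⟩ := hψ
  exact ⟨_, mul_mem h1 h2, fun x hx => by simp only [h1' x hx, h2' x hx, Pi.mul_apply]⟩

theorem const_mul (a : ℂ) {φ : (Fin n → ℂ) → ℂ} (hφ : p.IsLaurent φ) :
    p.IsLaurent (fun x => a * φ x) := (const a).mul hφ

theorem neg {φ : (Fin n → ℂ) → ℂ} (hφ : p.IsLaurent φ) : p.IsLaurent (fun x => -φ x) :=
  (hφ.const_mul (-1)).congr fun x _ => by ring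

theorem sub {φ ψ : (Fin n → ℂ) → ℂ} (hφ : p.IsLaurent φ) (hψ : p.IsLaurent ψ) :
    p.IsLaurent (fun x => φ x - ψ x) := by
  simpa [sub_eq_add_neg] using hφ.add hψ.neg

theorem sum {ι : Type*} {s : Finset ι} {φ : ι → (Fin n → ℂ) → ℂ} (h : ∀ i ∈ s, p.IsLaurent (φ i)) :
    p.IsLaurent (fun x => ∑ i ∈ s, φ i x) := by
  classical
  induction s using Finset.induction_on with
  | empty => simpa using const 0
  | insert a s ha ih =>
    simp only [Finset.sum_insert ha]
    exact (h a (by simp)).add (ih fun i hi => h i (by simp [hi]))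

theorem prod {ι : Type*} {s : Finset ι} {φ : ι → (Fin n → ℂ) → ℂ} (h : ∀ i ∈ s, p.IsLaurent (φ i)) :
    p.IsLaurent (fun x => ∏ i ∈ s, φ i x) := by
  classical
  induction s using Finset.induction_on with
  | empty => simpa using const 1
  | insert a s ha ih =>
    simp only [Finset.prod_insert ha]
    exact (h a (by simp)).mul (ih fun i hi => h i (by simp [hi]))

theorem E_linear (k : Fin n → ℤ) (a : ℂ) : p.IsLaurent (fun x => p.E (∑ j, k j * x j + a)) :=
  ((isLaurent_ev (Finsupp.single k (p.E a)))).congr fun x _ => by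
    rw [ev_single, E_add, mono, mul_comm]

theorem E_coord (j : Fin n) (ε : ℤ) (a : ℂ) : p.IsLaurent (fun x => p.E (ε * x j + a)) := by
  refine (E_linear (Pi.single j ε) a).congr fun x _ => ?_
  congr 2
  rw [Finset.sum_eq_single j]
  · simp
  · intro b _ hb; simp [hb]
  · simp

theorem E_pair (j k : Fin n) (ε ε' : ℤ) (a : ℂ) :
    p.IsLaurent (fun x => p.E (ε * x j + ε' * x k + a)) :=
  ((E_coord j ε 0).mul (E_coord k ε' a)).congr fun x _ => by
    rw [← E_add]; congr 1; ring

/-- Laurent polynomials are stable under signed permutations and translations. -/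
theorem comp_affine {φ : (Fin n → ℂ) → ℂ} (hφ : p.IsLaurent φ) (π : Equiv.Perm (Fin n))
    (ε m : Fin n → ℤ) (hε : ∀ j, ε j = 1 ∨ ε j = -1) :
    p.IsLaurent (fun x => φ (fun j => ε j * x (π j) + m j * p.γ)) := by
  obtain ⟨c, hc⟩ := isLaurent_iff.1 hφ
  have : p.IsLaurent (fun x : Fin n → ℂ => ∑ k ∈ c.support,
      c k * ∏ j, p.E (((k j * ε j : ℤ) : ℂ) * x (π j) + k j * m j * p.γ)) :=
    sum fun k _ => const_mul _ (prod fun j _ => E_coord _ _ _)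
  refine this.congr fun x hx => ?_
  rw [hc _ (hx.affine π ε m hε), ev_apply]
  refine Finset.sum_congr rfl fun k _ => ?_
  rw [mono, E_sum]
  congr 1
  refine Finset.prod_congr rfl fun j _ => ?_
  congr 1; push_cast; ring

end IsLaurent

end Params

end Koornwinder

end

noncomputable section

namespace Koornwinder

/-! ### Vandermonde divisibility and products over pairs -/

/-- A generalized Vandermonde determinant is divisible by the Vandermonde product. -/
theorem vandermonde_dvd_det {R : Type*} [CommRing R] : ∀ (m : ℕ) (y : Fin m → R)
    (P : Fin m → Polynomial R),
    (∏ i : Fin m, ∏ j ∈ Finset.Ioi i, (y j - y i)) ∣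
      (Matrix.of fun i j => (P j).eval (y i)).det
  | 0, y, P => by simp
  | m + 1, y, P => by
    have hq : ∀ j, ∃ q : Polynomial R, P j = (Polynomial.X - Polynomial.C (y 0)) * q +
        Polynomial.C ((P j).eval (y 0)) := fun j => by
      obtain ⟨q, hq⟩ := Polynomial.X_sub_C_dvd_sub_C_eval (p := P j) (a := y 0)
      exact ⟨q, by rw [← hq]; ring⟩
    choose q hq using hq
    have hval : ∀ i j, (P j).eval (y i) = (P j).eval (y 0) + (y i - y 0) * (q j).eval (y i) := by
      intro i j
      conv_lhs => rw [hq j]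
      simp; ring
    -- Subtracting row `0` leaves `(y i - y 0) * (q j).eval (y i)` in row `i`; `N` is the matrix
    -- after these linear factors have been taken out of the rows.
    let N : Matrix (Fin (m + 1)) (Fin (m + 1)) R := Matrix.of fun i j =>
      Fin.cases ((P j).eval (y 0)) (fun i' => (q j).eval (y i'.succ)) i
    have hdet : (Matrix.of fun i j => (P j).eval (y i)).det =
        (∏ i : Fin m, (y i.succ - y 0)) * N.det := by
      have h1 : (Matrix.of fun i j => (P j).eval (y i)).det =
          (Matrix.of fun i j => (Fin.cases 1 (fun i' : Fin m => y i'.succ - y 0) i : R) * N i j).det := by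
        refine Matrix.det_eq_of_forall_row_eq_smul_add_const (fun i => if i = 0 then 0 else 1) 0
          (by simp) fun i j => ?_
        refine Fin.cases ?_ (fun i => ?_) i
        · simp [N]
        · simp [N, hval i.succ j]; ring
      rw [h1, Matrix.det_mul_column, Fin.prod_univ_succ]
      simp
    rw [hdet, Fin.prod_univ_succ]
    have h0 : ∏ j ∈ Finset.Ioi (0 : Fin (m + 1)), (y j - y 0) = ∏ i : Fin m, (y i.succ - y 0) := by
      rw [Fin.Ioi_zero_eq_map, Finset.prod_map]; rfl
    rw [h0]
    refine mul_dvd_mul_left _ ?_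
    -- Each minor in the expansion along row `0` is again a generalized Vandermonde determinant, in
    -- the remaining points and for the quotient polynomials.
    rw [Matrix.det_succ_row_zero]
    refine Finset.dvd_sum fun j _ => Dvd.dvd.mul_left ?_ _
    have ih := vandermonde_dvd_det m (fun i => y i.succ) (fun l => q (j.succAbove l))
    convert ih using 1
    · refine Finset.prod_congr rfl fun i _ => ?_
      rw [Fin.Ioi_succ, Finset.prod_map]; rfl
    · congr 1

/-- The product of `h j k` over the pairs `j < k` in `J`. -/
def pairProd {ι M : Type*} [LinearOrder ι] [CommMonoid M] (J : Finset ι) (h : ι → ι → M) : M :=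
  ∏ j ∈ J, ∏ k ∈ J with j < k, h j k

section pairProd

variable {ι M : Type*} [LinearOrder ι] [CommMonoid M]

theorem pairProd_congr {J : Finset ι} {h h' : ι → ι → M}
    (H : ∀ j ∈ J, ∀ k ∈ J, j < k → h j k = h' j k) : pairProd J h = pairProd J h' :=
  Finset.prod_congr rfl fun j hj => Finset.prod_congr rfl fun k hk => by
    rw [Finset.mem_filter] at hk; exact H j hj k hk.1 hk.2

theorem pairProd_mul (J : Finset ι) (h h' : ι → ι → M) :
    pairProd J (fun j k => h j k * h' j k) = pairProd J h * pairProd J h' := by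
  simp only [pairProd, Finset.prod_mul_distrib]

theorem pairProd_orderEmb {m : ℕ} (J : Finset ι) (hm : J.card = m) (h : ι → ι → M) :
    pairProd J h = ∏ i : Fin m, ∏ j ∈ Finset.Ioi i,
      h (J.orderEmbOfFin hm i) (J.orderEmbOfFin hm j) := by
  have hJ := Finset.map_orderEmbOfFin_univ J hm
  conv_lhs => rw [pairProd, ← hJ]
  rw [Finset.prod_map]
  refine Finset.prod_congr rfl fun i _ => ?_
  rw [Finset.filter_map, Finset.prod_map]
  refine Finset.prod_congr ?_ fun j _ => rfl
  ext j; simp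

/-- Symmetry of `h` makes it irrelevant where `a` stands in the order. -/
theorem pairProd_insert {J : Finset ι} {a : ι} (ha : a ∉ J) {h : ι → ι → M}
    (hs : ∀ j k, h j k = h k j) :
    pairProd (insert a J) h = (∏ k ∈ J, h a k) * pairProd J h := by
  rw [pairProd, Finset.prod_insert ha]
  have h1 : ∀ j ∈ J, ∏ k ∈ insert a J with j < k, h j k =
      (if j < a then h a j else 1) * ∏ k ∈ J with j < k, h j k := by
    intro j hj
    rw [Finset.filter_insert]
    split_ifs with hja
    · rw [Finset.prod_insert (by simp [ha]), hs]
    · simp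
  rw [Finset.prod_congr rfl h1, Finset.prod_mul_distrib, ← mul_assoc, pairProd]
  congr 1
  rw [Finset.filter_insert, if_neg (lt_irrefl a), Finset.prod_filter, ← Finset.prod_mul_distrib]
  refine Finset.prod_congr rfl fun j hj => ?_
  have hne : j ≠ a := fun h => ha (h ▸ hj)
  rcases lt_or_gt_of_ne hne with h | h
  · simp [h, not_lt_of_gt h]
  · simp [h, not_lt_of_gt h]

theorem pairProd_union {J K : Finset ι} (hd : Disjoint J K) {h : ι → ι → M}
    (hs : ∀ j k, h j k = h k j) :
    pairProd (J ∪ K) h = pairProd J h * pairProd K h * ∏ j ∈ J, ∏ k ∈ K, h j k := by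
  classical
  induction J using Finset.induction_on with
  | empty => simp [pairProd]
  | insert a J ha ih =>
    rw [Finset.disjoint_insert_left] at hd
    rw [Finset.insert_union, pairProd_insert (by simp [ha, hd.1]) hs, ih hd.2,
      pairProd_insert ha hs, Finset.prod_union hd.2, Finset.prod_insert ha]
    simp only [mul_assoc, mul_comm, mul_left_comm]

theorem pairProd_map {J : Finset ι} (π : Equiv.Perm ι) {h : ι → ι → M}
    (hs : ∀ j k, h j k = h k j) :
    pairProd (J.map π.toEmbedding) h = pairProd J (fun j k => h (π j) (π k)) := by
  classical
  induction J using Finset.induction_on with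
  | empty => simp [pairProd]
  | insert a J ha ih =>
    rw [Finset.map_insert, pairProd_insert (by simpa using ha) hs,
      pairProd_insert ha (fun j k => hs _ _), ih, Finset.prod_map]
    rfl

end pairProd

namespace Params

variable {p : Params} {n : ℕ}

theorem IsLaurent.pairProd {J : Finset (Fin n)} {h : Fin n → Fin n → (Fin n → ℂ) → ℂ}
    (H : ∀ j ∈ J, ∀ k ∈ J, j < k → p.IsLaurent (h j k)) :
    p.IsLaurent (fun x => Koornwinder.pairProd J (fun j k => h j k x)) :=
  IsLaurent.prod fun j hj => IsLaurent.prod fun k hk => by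
    rw [Finset.mem_filter] at hk; exact H j hj k hk.1 hk.2

/-! ### The Weyl denominator and antisymmetrization -/

/-- The coordinate sine `sin(2αz)`. -/
def sn (p : Params) (z : ℂ) : ℂ := Complex.sin (2 * p.α * z)

/-- The coordinate cosine `cos(2αz)`. -/
def cs (p : Params) (z : ℂ) : ℂ := Complex.cos (2 * p.α * z)

theorem sn_eq (z : ℂ) : p.sn z = (p.E (-z) - p.E z) * Complex.I / 2 := by
  have h1 : -(2 * p.α * z) * Complex.I = 2 * Complex.I * p.α * (-z) := by ring
  have h2 : 2 * p.α * z * Complex.I = 2 * Complex.I * p.α * z := by ring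
  rw [sn, Complex.sin, E, E, h1, h2]

theorem cs_eq (z : ℂ) : p.cs z = (p.E z + p.E (-z)) / 2 := by
  have h1 : -(2 * p.α * z) * Complex.I = 2 * Complex.I * p.α * (-z) := by ring
  have h2 : 2 * p.α * z * Complex.I = 2 * Complex.I * p.α * z := by ring
  rw [cs, Complex.cos, E, E, h1, h2]

theorem sn_neg (z : ℂ) : p.sn (-z) = -p.sn z := by simp [sn]

theorem cs_neg (z : ℂ) : p.cs (-z) = p.cs z := by simp [cs]

/-- The type `C` Weyl denominator in the variables with index in `J`. -/
def weylDen (p : Params) (J : Finset (Fin n)) (x : Fin n → ℂ) : ℂ :=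
  (∏ j ∈ J, p.sn (x j)) * pairProd J (fun j k => p.cs (x k) - p.cs (x j))

theorem IsLaurent.sn (j : Fin n) (ε : ℤ) (a : ℂ) :
    p.IsLaurent (fun x => p.sn (ε * x j + a)) := by
  refine (((E_coord j (-ε) (-a)).sub (E_coord j ε a)).mul (const (Complex.I / 2))).congr
    fun x _ => ?_
  rw [sn_eq, mul_div_assoc]
  congr 4; push_cast; ring

theorem IsLaurent.cs (j : Fin n) (ε : ℤ) (a : ℂ) :
    p.IsLaurent (fun x => p.cs (ε * x j + a)) := by
  refine (((E_coord j ε a).add (E_coord j (-ε) (-a))).mul (const (1 / 2))).congr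
    fun x _ => ?_
  rw [cs_eq, div_eq_mul_one_div]
  congr 4; push_cast; ring

theorem sn_ne_zero {z : ℂ} (h : p.E z ^ 2 ≠ 1) : p.sn z ≠ 0 := by
  rw [sn_eq, E_neg]
  have h0 := p.E_ne_zero z
  intro h1
  apply h
  have h2 : (p.E z)⁻¹ - p.E z = 0 := by
    simpa [Complex.I_ne_zero] using h1
  field_simp at h2
  linear_combination -h2

/-- The factorization displays the mirrors `z = ±w`: a difference of cosines cancels a simple pole
along either of them. -/
theorem cs_sub (z w : ℂ) : p.cs z - p.cs w =
    (p.E (z + w) - 1) * (p.E (z - w) - 1) / (2 * p.E z) := by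
  rw [cs_eq, cs_eq, E_neg, E_neg, E_add, E_sub]
  have h0 := p.E_ne_zero z
  have h1 := p.E_ne_zero w
  field_simp
  ring

theorem weylDen_ne_zero {x : Fin n → ℂ} (hx : p.Generic x) (J : Finset (Fin n)) :
    p.weylDen J x ≠ 0 := by
  refine mul_ne_zero (Finset.prod_ne_zero_iff.2 fun j _ => ?_)
    (Finset.prod_ne_zero_iff.2 fun j _ => Finset.prod_ne_zero_iff.2 fun k hk => ?_)
  · exact sn_ne_zero (by simpa using hx.sq_ne j 0)
  · rw [Finset.mem_filter] at hk
    show p.cs (x k) - p.cs (x j) ≠ 0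
    rw [cs_sub]
    have h1 := hx.add_ne k j hk.2.ne' 0
    have h2 := hx.sub_ne k j hk.2.ne' 0
    simp only [Int.cast_zero, zero_mul, add_zero] at h1 h2
    exact div_ne_zero (mul_ne_zero (sub_ne_zero.2 h1) (sub_ne_zero.2 h2))
      (mul_ne_zero two_ne_zero (E_ne_zero _ _))

/-- The Weyl group element acting on the coordinates in the range of `e` by a signed
permutation. -/
def signedPerm {m : ℕ} (e : Fin m ↪ Fin n) (π : Equiv.Perm (Fin m)) (η : Fin m → ℤˣ)
    (x : Fin n → ℂ) : Fin n → ℂ :=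
  fun j => (Function.extend e (fun i => ((η i : ℤ))) 1 j : ℤ) * x (π.viaFintypeEmbedding e j)

theorem signedPerm_image {m : ℕ} (e : Fin m ↪ Fin n) (π : Equiv.Perm (Fin m)) (η : Fin m → ℤˣ)
    (x : Fin n → ℂ) (i : Fin m) : signedPerm e π η x (e i) = (η i : ℤ) * x (e (π i)) := by
  rw [signedPerm, e.injective.extend_apply, Equiv.Perm.viaFintypeEmbedding_apply_image]

theorem signedPerm_notMem {m : ℕ} (e : Fin m ↪ Fin n) (π : Equiv.Perm (Fin m)) (η : Fin m → ℤˣ)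
    (x : Fin n → ℂ) {j : Fin n} (hj : j ∉ Set.range e) : signedPerm e π η x j = x j := by
  rw [signedPerm, Function.extend_apply' _ _ _ (by simpa using hj),
    Equiv.Perm.viaFintypeEmbedding_apply_notMem_range _ _ hj]
  simp

/-- Antisymmetrizing a monomial over signed permutations gives a multiple of the Weyl
denominator. -/
theorem alternant_mono {m : ℕ} (e : Fin m ↪ Fin n) (k : Fin n → ℤ) :
    ∃ H, p.IsLaurent (n := n) H ∧ ∀ x,
      ∑ π : Equiv.Perm (Fin m), ∑ η : Fin m → ℤˣ,
        ((Equiv.Perm.sign π : ℤ) : ℂ) * (∏ i, ((η i : ℤ) : ℂ)) * p.mono k (signedPerm e π η x) =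
      ((∏ i, p.sn (x (e i))) * ∏ i, ∏ j ∈ Finset.Ioi i, (p.cs (x (e j)) - p.cs (x (e i)))) * H x := by
  classical
  have hcs : ∀ j : Fin n, (fun x : Fin n → ℂ => p.cs (x j)) ∈ p.laurent n := by
    intro j
    have : ∀ ε : ℤ, (fun x : Fin n → ℂ => p.E (ε * x j)) ∈ p.laurent n := by
      intro ε
      refine ⟨Finsupp.single (Pi.single j ε) 1, ?_⟩
      funext x
      rw [ev_single, one_mul, mono]
      congr 1
      rw [Finset.sum_eq_single j]
      · simp
      · intro b _ hb; simp [hb]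
      · simp
    have h2 := Subalgebra.smul_mem _ (add_mem (this 1) (this (-1))) (1 / 2 : ℂ)
    convert h2 using 1
    funext x
    simp [cs_eq]; ring
  -- Summing over the sign of one coordinate turns `E (a z)` into `2i · sn z · U_{a-1}(cs z)`. The
  -- sum over permutations is then a generalized Vandermonde determinant in the cosines.
  -- Divisibility is taken in the ring of Laurent polynomials, so the quotient `D` is one; Chebyshev
  -- polynomials with integer index cover negative exponents too.
  let y : Fin m → p.laurent n := fun i => ⟨_, hcs (e i)⟩
  obtain ⟨D, hD⟩ := vandermonde_dvd_det m y
    (fun j => (Polynomial.Chebyshev.U ℂ (k (e j) - 1)).map (algebraMap ℂ (p.laurent n)))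
  let R : (Fin n → ℂ) → ℂ := fun x => ∏ j ∈ Finset.univ.filter (fun j => j ∉ Set.range e),
    p.E (k j * x j)
  refine ⟨fun x => (2 * Complex.I) ^ m * (D.1 x * R x),
    IsLaurent.const_mul _ ((isLaurent_of_mem D.2).mul (IsLaurent.prod fun j _ => by
      simpa using IsLaurent.E_coord j (k j) 0)), fun x => ?_⟩
  -- Evaluation at `x` is a ring homomorphism, which carries the factorization of the determinant
  -- from Laurent polynomials to values.
  let φ : p.laurent n →+* ℂ := (Pi.evalRingHom (fun _ => ℂ) x).comp (p.laurent n).val.toRingHom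
  have hφ : ∀ f : p.laurent n, φ f = f.1 x := fun f => rfl
  have hφa : φ.comp (algebraMap ℂ (p.laurent n)) = RingHom.id ℂ := by
    ext; rfl
  have hD' := congrArg φ hD
  rw [RingHom.map_det, map_mul, map_prod] at hD'
  have hM : φ.mapMatrix (Matrix.of fun i j => Polynomial.eval (y i)
      ((Polynomial.Chebyshev.U ℂ (k (e j) - 1)).map (algebraMap ℂ (p.laurent n)))) =
      Matrix.of fun i j => (Polynomial.Chebyshev.U ℂ (k (e j) - 1)).eval (p.cs (x (e i))) := by
    ext i j
    simp only [RingHom.mapMatrix_apply, Matrix.map_apply, Matrix.of_apply]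
    rw [Polynomial.eval_map, Polynomial.hom_eval₂, hφa]
    rfl
  rw [hM] at hD'
  have hV : ∀ i, φ (∏ j ∈ Finset.Ioi i, (y j - y i)) =
      ∏ j ∈ Finset.Ioi i, (p.cs (x (e j)) - p.cs (x (e i))) := by
    intro i; rw [map_prod]; rfl
  rw [Finset.prod_congr rfl fun i _ => hV i, hφ] at hD'
  have hs : ∀ (z : ℂ) (a : ℤ), p.E (a * z) - p.E (-(a * z)) =
      2 * Complex.I * (p.sn z * (Polynomial.Chebyshev.U ℂ (a - 1)).eval (p.cs z)) := by
    intro z a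
    have h1 := Polynomial.Chebyshev.U_complex_cos (2 * p.α * z) (a - 1)
    rw [sn, cs, mul_comm (Complex.sin _), h1]
    have h2 := p.sn_eq (a * z)
    rw [sn] at h2
    have e1 : (((a - 1 : ℤ) : ℂ) + 1) * (2 * p.α * z) = 2 * p.α * (a * z) := by push_cast; ring
    rw [e1, h2]
    linear_combination (-1) * (p.E (-(a * z)) - p.E (a * z)) * Complex.I_sq
  have hmono : ∀ (π : Equiv.Perm (Fin m)) (η : Fin m → ℤˣ), p.mono k (signedPerm e π η x) =
      (∏ i, p.E (k (e i) * ((η i : ℤ) * x (e (π i))))) * R x := by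
    intro π η
    rw [mono, E_sum, ← Finset.prod_filter_mul_prod_filter_not Finset.univ (fun j => j ∈ Set.range e)]
    congr 1
    · have : Finset.univ.filter (fun j => j ∈ Set.range e) = Finset.univ.map e := by
        ext j; simp
      rw [this, Finset.prod_map]
      exact Finset.prod_congr rfl fun i _ => by rw [signedPerm_image]
    · refine Finset.prod_congr rfl fun j hj => ?_
      rw [signedPerm_notMem]
      simpa using hj
  have hη : ∀ π : Equiv.Perm (Fin m), ∑ η : Fin m → ℤˣ,
      (∏ i, ((η i : ℤ) : ℂ)) * ∏ i, p.E (k (e i) * ((η i : ℤ) * x (e (π i)))) =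
      ∏ i, (2 * Complex.I * (p.sn (x (e (π i))) *
        (Polynomial.Chebyshev.U ℂ (k (e i) - 1)).eval (p.cs (x (e (π i)))))) := by
    intro π
    simp only [← Finset.prod_mul_distrib]
    rw [← Fintype.prod_sum (fun (i : Fin m) (u : ℤˣ) =>
      ((u : ℤ) : ℂ) * p.E (k (e i) * ((u : ℤ) * x (e (π i)))))]
    refine Finset.prod_congr rfl fun i _ => ?_
    rw [← hs, UnitsInt.univ, Finset.sum_pair (by decide)]
    simp [sub_eq_add_neg]
  have hfac : ∀ π : Equiv.Perm (Fin m), ∏ i, (2 * Complex.I * (p.sn (x (e (π i))) *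
        (Polynomial.Chebyshev.U ℂ (k (e i) - 1)).eval (p.cs (x (e (π i)))))) =
      (2 * Complex.I) ^ m * (∏ i, p.sn (x (e i))) *
        ∏ i, (Polynomial.Chebyshev.U ℂ (k (e i) - 1)).eval (p.cs (x (e (π i)))) := by
    intro π
    rw [← Equiv.prod_comp π (fun i => p.sn (x (e i)))]
    simp only [Finset.prod_mul_distrib, Finset.prod_const, Finset.card_univ, Fintype.card_fin,
      mul_pow]
    ring
  rw [Matrix.det_apply] at hD'
  calc _ = ∑ π : Equiv.Perm (Fin m), ((Equiv.Perm.sign π : ℤ) : ℂ) * (((2 * Complex.I) ^ m *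
        (∏ i, p.sn (x (e i))) *
        ∏ i, (Polynomial.Chebyshev.U ℂ (k (e i) - 1)).eval (p.cs (x (e (π i))))) * R x) := by
        refine Finset.sum_congr rfl fun π _ => ?_
        rw [← hfac, ← hη, Finset.sum_mul, Finset.mul_sum]
        refine Finset.sum_congr rfl fun η _ => ?_
        rw [hmono]; ring
    _ = (2 * Complex.I) ^ m * (∏ i, p.sn (x (e i))) * R x *
        ∑ π : Equiv.Perm (Fin m), Equiv.Perm.sign π •
        ∏ i, (Matrix.of fun i j => (Polynomial.Chebyshev.U ℂ (k (e j) - 1)).eval (p.cs (x (e i))))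
          (π i) i := by
        rw [Finset.mul_sum]
        refine Finset.sum_congr rfl fun π _ => ?_
        simp only [Matrix.of_apply, Units.smul_def, zsmul_eq_mul]
        ring
    _ = _ := by rw [hD']; ring

/-- The antisymmetrization of a Laurent polynomial is a Laurent multiple of the Weyl
denominator. -/
theorem alternant_ev {m : ℕ} (e : Fin m ↪ Fin n) (c : (Fin n → ℤ) →₀ ℂ) :
    ∃ H, p.IsLaurent (n := n) H ∧ ∀ x,
      ∑ π : Equiv.Perm (Fin m), ∑ η : Fin m → ℤˣ,
        ((Equiv.Perm.sign π : ℤ) : ℂ) * (∏ i, ((η i : ℤ) : ℂ)) * p.ev c (signedPerm e π η x) =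
      ((∏ i, p.sn (x (e i))) * ∏ i, ∏ j ∈ Finset.Ioi i, (p.cs (x (e j)) - p.cs (x (e i)))) * H x := by
  choose H hH hx using fun k => alternant_mono (p := p) e k
  refine ⟨fun x => ∑ k ∈ c.support, c k * H k x,
    IsLaurent.sum fun k _ => (hH k).const_mul _, fun x => ?_⟩
  rw [Finset.mul_sum]
  simp only [ev_apply, Finset.mul_sum]
  rw [Finset.sum_congr rfl fun π _ => Finset.sum_comm, Finset.sum_comm]
  refine Finset.sum_congr rfl fun k _ => ?_
  rw [mul_left_comm, ← hx, Finset.mul_sum]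
  refine Finset.sum_congr rfl fun π _ => ?_
  rw [Finset.mul_sum]
  refine Finset.sum_congr rfl fun η _ => ?_
  ring

theorem weylDen_eq {m : ℕ} (J : Finset (Fin n)) (hm : J.card = m) (x : Fin n → ℂ) :
    p.weylDen J x = (∏ i, p.sn (x (J.orderEmbOfFin hm i))) *
      ∏ i, ∏ j ∈ Finset.Ioi i,
        (p.cs (x (J.orderEmbOfFin hm j)) - p.cs (x (J.orderEmbOfFin hm i))) := by
  rw [weylDen, pairProd_orderEmb J hm]
  congr 1
  conv_lhs => rw [← Finset.map_orderEmbOfFin_univ J hm]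
  rw [Finset.prod_map]
  rfl

/-- The sines contribute the product of the signs, the cosines ignore the signs, and the product of
cosine differences is a Vandermonde determinant whose rows are permuted. -/
theorem weylDen_signedPerm {m : ℕ} (J : Finset (Fin n)) (hm : J.card = m)
    (π : Equiv.Perm (Fin m)) (η : Fin m → ℤˣ) (x : Fin n → ℂ) :
    p.weylDen J (signedPerm (J.orderEmbOfFin hm).toEmbedding π η x) =
      ((Equiv.Perm.sign π : ℤ) : ℂ) * (∏ i, ((η i : ℤ) : ℂ)) * p.weylDen J x := by
  set e := (J.orderEmbOfFin hm).toEmbedding with he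
  have hsn : ∀ (u : ℤˣ) (z : ℂ), p.sn ((u : ℤ) * z) = (u : ℤ) * p.sn z := by
    intro u z
    rcases Int.units_eq_one_or u with rfl | rfl <;> simp [sn_neg]
  have hcs : ∀ (u : ℤˣ) (z : ℂ), p.cs ((u : ℤ) * z) = p.cs z := by
    intro u z
    rcases Int.units_eq_one_or u with rfl | rfl <;> simp [cs_neg]
  have himg : ∀ i, signedPerm e π η x (J.orderEmbOfFin hm i) =
      (η i : ℤ) * x (J.orderEmbOfFin hm (π i)) := fun i => signedPerm_image e π η x i
  rw [weylDen_eq J hm, weylDen_eq J hm]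
  simp only [himg, hsn, hcs]
  rw [Finset.prod_mul_distrib, Equiv.prod_comp π (fun i => p.sn (x (J.orderEmbOfFin hm i)))]
  have hv := Matrix.det_vandermonde (fun i => p.cs (x (J.orderEmbOfFin hm (π i))))
  have hv' := Matrix.det_vandermonde (fun i => p.cs (x (J.orderEmbOfFin hm i)))
  rw [← hv, ← hv']
  have : Matrix.vandermonde (fun i => p.cs (x (J.orderEmbOfFin hm (π i)))) =
      (Matrix.vandermonde (fun i => p.cs (x (J.orderEmbOfFin hm i)))).submatrix π id := by
    ext i j; simp [Matrix.vandermonde]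
  rw [this, Matrix.det_permute]
  ring

/-- A function that is invariant under the signed permutations of the coordinates in `J` and has
at most simple poles along their mirrors is a Laurent polynomial. -/
theorem isLaurent_of_invariant (J : Finset (Fin n)) {φ : (Fin n → ℂ) → ℂ}
    (hperm : ∀ π : Equiv.Perm (Fin n), (∀ j, j ∉ J → π j = j) → ∀ x, p.Generic x →
      φ (fun j => x (π j)) = φ x)
    (hflip : ∀ η : Fin n → ℤ, (∀ j, η j = 1 ∨ η j = -1) → (∀ j, j ∉ J → η j = 1) → ∀ x,
      p.Generic x → φ (fun j => η j * x j) = φ x)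
    (hL : p.IsLaurent (fun x => p.weylDen J x * φ x)) : p.IsLaurent φ := by
  obtain ⟨c, hc⟩ := isLaurent_iff.1 hL
  have hrange : ∀ j, j ∉ J → j ∉ Set.range (J.orderEmbOfFin rfl).toEmbedding := by
    intro j hj
    have := J.range_orderEmbOfFin rfl
    intro h
    apply hj
    have h' : j ∈ Set.range (J.orderEmbOfFin rfl) := h
    rw [this] at h'
    exact h'
  obtain ⟨H, hH, hx⟩ := alternant_ev (p := p) (J.orderEmbOfFin rfl).toEmbedding c
  set e := (J.orderEmbOfFin rfl).toEmbedding with he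
  -- `N` is the order of the group of signed permutations of `J`.
  set N : ℂ := ∑ π : Equiv.Perm (Fin J.card), ∑ η : Fin J.card → ℤˣ, (1 : ℂ) with hN
  have hN0 : N ≠ 0 := by
    simp only [hN, Finset.sum_const, Finset.card_univ, nsmul_eq_mul, mul_one]
    exact mul_ne_zero (Nat.cast_ne_zero.2 Fintype.card_ne_zero)
      (Nat.cast_ne_zero.2 Fintype.card_ne_zero)
  refine (hH.const_mul N⁻¹).congr fun x hg => ?_
  have hext : ∀ (η : Fin J.card → ℤˣ) (j : Fin n),
      (Function.extend e (fun i => ((η i : ℤ))) 1 j : ℤ) = 1 ∨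
      (Function.extend e (fun i => ((η i : ℤ))) 1 j : ℤ) = -1 := by
    intro η j
    by_cases hj : j ∈ Set.range e
    · obtain ⟨i, rfl⟩ := hj
      rw [e.injective.extend_apply]
      rcases Int.units_eq_one_or (η i) with h | h <;> simp [h]
    · rw [Function.extend_apply' _ _ _ (by simpa using hj)]
      simp
  have hinv : ∀ (π : Equiv.Perm (Fin J.card)) (η : Fin J.card → ℤˣ),
      p.Generic (signedPerm e π η x) ∧ φ (signedPerm e π η x) = φ x := by
    intro π η
    have h1 := hg.affine (π.viaFintypeEmbedding e) (fun _ => 1) 0 (fun _ => Or.inl rfl)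
    simp only [Int.cast_one, one_mul, Pi.zero_apply, Int.cast_zero, zero_mul, add_zero] at h1
    have h2 := h1.affine 1 (fun j => Function.extend e (fun i => ((η i : ℤ))) 1 j) 0 (hext η)
    simp only [Pi.zero_apply, Int.cast_zero, zero_mul, add_zero, Equiv.Perm.coe_one, id] at h2
    refine ⟨h2, ?_⟩
    rw [← hperm (π.viaFintypeEmbedding e) (fun j hj =>
      Equiv.Perm.viaFintypeEmbedding_apply_notMem_range _ _ (hrange j hj)) x hg]
    exact hflip _ (hext η) (fun j hj => by
      rw [Function.extend_apply' _ _ _ (by simpa using hrange j hj)]; rfl) _ h1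
  have key := hx x
  -- `weylDen * φ` is antisymmetric because `φ` is invariant, so every term of its alternant equals
  -- `weylDen * φ`. The alternant is thus `N` times it, and it is also a Laurent multiple of
  -- `weylDen`, which can be cancelled.
  have hterm : ∀ (π : Equiv.Perm (Fin J.card)) (η : Fin J.card → ℤˣ),
      ((Equiv.Perm.sign π : ℤ) : ℂ) * (∏ i, ((η i : ℤ) : ℂ)) * p.ev c (signedPerm e π η x) =
      p.weylDen J x * φ x * 1 := by
    intro π η
    rw [← hc _ (hinv π η).1, (hinv π η).2, weylDen_signedPerm]
    have h1 : ((Equiv.Perm.sign π : ℤ) : ℂ) * ((Equiv.Perm.sign π : ℤ) : ℂ) = 1 := by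
      rcases Int.units_eq_one_or (Equiv.Perm.sign π) with h | h <;> simp [h]
    have h2 : (∏ i, ((η i : ℤ) : ℂ)) * (∏ i, ((η i : ℤ) : ℂ)) = 1 := by
      rw [← Finset.prod_mul_distrib]
      refine Finset.prod_eq_one fun i _ => ?_
      rcases Int.units_eq_one_or (η i) with h | h <;> simp [h]
    linear_combination (p.weylDen J x * φ x) * h1 +
      (p.weylDen J x * φ x) * ((Equiv.Perm.sign π : ℤ) : ℂ) ^ 2 * h2
  simp only [hterm, ← Finset.mul_sum] at key
  rw [← hN] at key
  have hw := weylDen_eq (p := p) J rfl x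
  have hw0 := weylDen_ne_zero hg J
  have key' : p.weylDen J x * (φ x * N) = p.weylDen J x * H x := by
    rw [← mul_assoc, key]; congr 1; exact hw.symm
  have := mul_left_cancel₀ hw0 key'
  rw [← this]; field_simp

end Params

end Koornwinder

end

noncomputable section

namespace Koornwinder

open Filter Topology

/-! ### Asymptotics along rays -/

/-- The ray through `x` that goes to infinity in the imaginary direction `-v`. -/
def ray {n : ℕ} (v : Fin n → ℤ) (x : Fin n → ℂ) (y : ℝ) : Fin n → ℂ :=
  fun j => x j - Complex.I * y * v j

/-- The pairing of two weights. -/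
def dot {n : ℕ} (v k : Fin n → ℤ) : ℤ := ∑ j, v j * k j

namespace Params

variable {p : Params} {n : ℕ}

theorem E_ray (z : ℂ) (y : ℝ) (m : ℤ) :
    p.E (z - Complex.I * y * m) = p.E z * (Real.exp (2 * p.α * y * m) : ℝ) := by
  rw [E, E, Complex.ofReal_exp, ← Complex.exp_add]
  congr 1
  push_cast
  linear_combination (-2 * p.α * y * m) * Complex.I_sq

theorem mono_ray (v k : Fin n → ℤ) (x : Fin n → ℂ) (y : ℝ) :
    p.mono k (ray v x y) = p.mono k x * (Real.exp (2 * p.α * y * dot v k) : ℝ) := by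
  rw [mono, mono, ← E_ray]
  congr 1
  simp only [ray, dot, mul_sub, Finset.sum_sub_distrib, Int.cast_sum, Finset.mul_sum]
  congr 1
  refine Finset.sum_congr rfl fun j _ => ?_
  push_cast; ring

theorem tendsto_exp_neg (h : 0 < p.α) {m : ℤ} (hm : m < 0) :
    Tendsto (fun y : ℝ => ((Real.exp (2 * p.α * y * m) : ℝ) : ℂ)) atTop (𝓝 0) := by
  have h1 : Tendsto (fun y : ℝ => 2 * p.α * y * m) atTop atBot := by
    have : (fun y : ℝ => 2 * p.α * y * m) = fun y => (2 * p.α * m) * y := by funext y; ring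
    rw [this]
    refine tendsto_id.const_mul_atTop_of_neg ?_
    have : (m : ℝ) < 0 := by exact_mod_cast hm
    nlinarith
  have := (Complex.continuous_ofReal.tendsto 0).comp (Real.tendsto_exp_atBot.comp h1)
  rw [Complex.ofReal_zero] at this
  exact this

/-- A monomial grows like the exponential of its degree in direction `v`; after division by the top
growth rate only the monomials of degree exactly `d` survive. -/
theorem tendsto_ev (h : 0 < p.α) {v : Fin n → ℤ} {d : ℤ} {c : (Fin n → ℤ) →₀ ℂ}
    (hc : ∀ k ∈ c.support, dot v k ≤ d) (x : Fin n → ℂ) :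
    Tendsto (fun y : ℝ => ((Real.exp (2 * p.α * y * (-d : ℤ)) : ℝ) : ℂ) * p.ev c (ray v x y)) atTop
      (𝓝 (p.ev (c.filter fun k => dot v k = d) x)) := by
  classical
  have h1 : p.ev (c.filter fun k => dot v k = d) x =
      ∑ k ∈ c.support, if dot v k = d then c k * p.mono k x else 0 := by
    rw [ev_apply, Finsupp.support_filter, Finset.sum_filter]
    refine Finset.sum_congr rfl fun k _ => ?_
    split_ifs with hk
    · rw [Finsupp.filter_apply_pos (fun k => dot v k = d) c hk]
    · rfl
  have h2 : (fun y : ℝ => ((Real.exp (2 * p.α * y * (-d : ℤ)) : ℝ) : ℂ) * p.ev c (ray v x y)) =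
      fun y : ℝ => ∑ k ∈ c.support, c k * p.mono k x *
        ((Real.exp (2 * p.α * y * (dot v k - d : ℤ)) : ℝ) : ℂ) := by
    funext y
    rw [ev_apply, Finset.mul_sum]
    refine Finset.sum_congr rfl fun k _ => ?_
    rw [mono_ray]
    have : Real.exp (2 * p.α * y * (dot v k - d : ℤ)) =
        Real.exp (2 * p.α * y * (-d : ℤ)) * Real.exp (2 * p.α * y * dot v k) := by
      rw [← Real.exp_add]; congr 1; push_cast; ring
    rw [this]; push_cast; ring
  rw [h1, h2]
  refine tendsto_finsetSum _ fun k hk => ?_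
  split_ifs with hkd
  · simp [hkd]
  · have : dot v k - d < 0 := by have := hc k hk; omega
    simpa using (tendsto_exp_neg h this).const_mul (c k * p.mono k x)

/-- Limits of functions known only at generic points are taken along the parameters `β N`: these
points of the ray stay generic, whereas other points of the ray need not be. -/
theorem tendsto_mul_natCast {b : ℝ} (hb : 0 < b) :
    Tendsto (fun N : ℕ => b * (N : ℝ)) atTop atTop :=
  tendsto_natCast_atTop_atTop.const_mul_atTop hb

/-- The points of a ray at distance a multiple of `β` from a generic point are generic. -/
theorem Generic.ray {x : Fin n → ℂ} (hx : p.Generic x) (v : Fin n → ℤ) (N : ℕ) :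
    p.Generic (ray v x (p.β * N)) := by
  -- The displacement is a multiple of `γ` because `iβN = 2Nγ`.
  have := hx.affine 1 (fun _ => 1) (fun j => -(2 * N * v j)) (fun _ => Or.inl rfl)
  convert this using 1
  funext j
  simp only [Koornwinder.ray, Equiv.Perm.coe_one, id, γ]
  push_cast; ring

/-- A Laurent polynomial that is `o(exp(2αdy))` along the rays in direction `v` has no monomials of
degree `≥ d`. -/
theorem coeff_eq_zero_of_tendsto (h : 0 < p.α) (hβ : 0 < p.β) {v : Fin n → ℤ} {d : ℤ} {c : (Fin n → ℤ) →₀ ℂ}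
    (hc : ∀ x, p.Generic x →
      Tendsto (fun N : ℕ => ((Real.exp (2 * p.α * (p.β * N) * (-d : ℤ)) : ℝ) : ℂ) *
        p.ev c (ray v x (p.β * N))) atTop (𝓝 0)) (k : Fin n → ℤ) (hk : d ≤ dot v k) : c k = 0 := by
  classical
  by_contra hk0
  obtain ⟨l, hl, hmax⟩ := Finset.exists_max_image c.support (dot v) ⟨k, by simpa using hk0⟩
  have hld : d ≤ dot v l := hk.trans (hmax k (by simpa using hk0))
  -- Take the largest degree that occurs. The part of that degree is the limit of the rescaled
  -- polynomial by `tendsto_ev`, while the hypothesis makes this limit zero, with an extra decaying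
  -- factor when the degree exceeds `d`.
  have hz : c.filter (fun k => dot v k = dot v l) = 0 := by
    refine ev_eq_zero h fun x hx => ?_
    refine tendsto_nhds_unique ((tendsto_ev h (fun k hk => hmax k hk) x).comp
      (tendsto_mul_natCast hβ)) ?_
    have h1 := hc x hx
    rcases hld.eq_or_lt with heq | hlt
    · rwa [heq] at h1
    · have h2 := ((tendsto_exp_neg (p := p) h (m := d - dot v l) (by omega)).comp
        (tendsto_mul_natCast hβ)).mul h1
      rw [mul_zero] at h2
      refine h2.congr fun y => ?_
      simp only [Function.comp_apply]
      rw [← mul_assoc, ← Complex.ofReal_mul, ← Real.exp_add]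
      congr 3; push_cast; ring
  have := DFunLike.congr_fun hz l
  rw [Finsupp.filter_apply_pos (fun k => dot v k = dot v l) c rfl] at this
  simp [this] at hl

/-- If the exponential decays, numerator and denominator both tend to `s`; if it grows, the quotient
tends to the ratio `E μ` of leading coefficients. Neither limit involves `z`. The value `s = -1`
serves the sines and `s = 1` the cosines. -/
theorem tendsto_ratio (h : 0 < p.α) (μ : ℂ) {s : ℂ} (hs : s ≠ 0) {m : ℤ} (hm : m ≠ 0) :
    ∃ L, ∀ z, Tendsto (fun y : ℝ => (p.E (μ + (z - Complex.I * y * m)) + s) /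
      (p.E (z - Complex.I * y * m) + s)) atTop (𝓝 L) := by
  rcases lt_or_gt_of_ne hm with hm | hm
  · refine ⟨1, fun z => ?_⟩
    have h1 := (tendsto_exp_neg (p := p) h hm).const_mul (p.E z)
    have h2 := ((h1.const_mul (p.E μ)).add_const s).div (h1.add_const s) (by simpa using hs)
    simp only [mul_zero, zero_add, div_self hs] at h2
    refine h2.congr fun y => ?_
    simp only [Pi.div_apply, E_add, E_ray]
  · refine ⟨p.E μ, fun z => ?_⟩
    have h1 := (tendsto_exp_neg (p := p) h (m := -m) (by omega)).const_mul (s * p.E (-z))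
    have h2 := (h1.const_add (p.E μ)).div (h1.const_add 1) (by simp)
    simp only [mul_zero, add_zero, div_one] at h2
    refine h2.congr fun y => ?_
    simp only [Pi.div_apply, E_add, E_ray, E_neg]
    have e1 : ((Real.exp (2 * p.α * y * (-m : ℤ)) : ℝ) : ℂ) =
        ((Real.exp (2 * p.α * y * m) : ℝ) : ℂ)⁻¹ := by
      rw [← Complex.ofReal_inv, ← Real.exp_neg]; congr 2; push_cast; ring
    rw [e1]
    have e2 : ((Real.exp (2 * p.α * y * m) : ℝ) : ℂ) ≠ 0 := by
      exact_mod_cast (Real.exp_pos _).ne'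
    set R := ((Real.exp (2 * p.α * y * m) : ℝ) : ℂ)
    have e3 := p.E_ne_zero z
    have e4 : p.E μ + s * (p.E z)⁻¹ * R⁻¹ = (p.E μ * (p.E z * R) + s) / (p.E z * R) := by
      field_simp
    have e5 : 1 + s * (p.E z)⁻¹ * R⁻¹ = (p.E z * R + s) / (p.E z * R) := by
      field_simp
    rw [e4, e5, div_div_div_cancel_right₀ (mul_ne_zero e3 e2)]

theorem tendsto_va (h : 0 < p.α) {m : ℤ} (hm : m ≠ 0) :
    ∃ L, ∀ z, Tendsto (fun y : ℝ => p.va (z - Complex.I * y * m)) atTop (𝓝 L) := by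
  obtain ⟨L, hL⟩ := tendsto_ratio (p := p) h p.μ (neg_ne_zero.2 one_ne_zero) hm
  refine ⟨p.phase p.μ * L, fun z => ?_⟩
  simp only [va_eq, sub_eq_add_neg _ (1 : ℂ)]
  exact (hL z).const_mul _

theorem tendsto_vb (h : 0 < p.α) {m : ℤ} (hm : m ≠ 0) :
    ∃ L, ∀ z, Tendsto (fun y : ℝ => p.vb (z - Complex.I * y * m)) atTop (𝓝 L) := by
  obtain ⟨L₁, h₁⟩ := tendsto_ratio (p := p) h p.μ₀ (neg_ne_zero.2 one_ne_zero) hm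
  obtain ⟨L₂, h₂⟩ := tendsto_ratio (p := p) h p.μ₁ one_ne_zero hm
  obtain ⟨L₃, h₃⟩ := tendsto_ratio (p := p) h p.μ₀' (neg_ne_zero.2 one_ne_zero) hm
  obtain ⟨L₄, h₄⟩ := tendsto_ratio (p := p) h p.μ₁' one_ne_zero hm
  refine ⟨p.phase p.μ₀ * p.phase p.μ₁ * p.phase p.μ₀' * p.phase p.μ₁' * (L₁ * L₂ * L₃ * L₄),
    fun z => ?_⟩
  simp only [vb_eq, sub_eq_add_neg _ (1 : ℂ), ← add_sub_assoc p.γ z]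
  exact ((((h₁ z).mul (h₂ z)).mul (h₃ (p.γ + z))).mul (h₄ (p.γ + z))).const_mul _

/-- A function of `x` that converges along all rays in direction `v`, to a limit that does not
depend on the ray. -/
def HasRayLimit (v : Fin n → ℤ) (φ : (Fin n → ℂ) → ℂ) (L : ℂ) : Prop :=
  ∀ x, Tendsto (fun y : ℝ => φ (ray v x y)) atTop (𝓝 L)

/-- Directions on no mirror of the Weyl group. -/
structure RegularDir (v : Fin n → ℤ) : Prop where
  ne_zero : ∀ j, v j ≠ 0
  pair_ne : ∀ j k, j ≠ k → ∀ ε ε' : ℤ, (ε = 1 ∨ ε = -1) → (ε' = 1 ∨ ε' = -1) →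
    ε * v j + ε' * v k ≠ 0

theorem regularDir_dir : RegularDir (dir n) where
  ne_zero j := by simp only [dir]; omega
  pair_ne j k hjk ε ε' hε hε' := by
    have : (j : ℕ) ≠ k := fun h => hjk (Fin.ext h)
    rcases hε with rfl | rfl <;> rcases hε' with rfl | rfl <;> simp only [dir] <;> omega

namespace HasRayLimit

variable {v : Fin n → ℤ}

theorem mul {φ ψ : (Fin n → ℂ) → ℂ} {L M : ℂ} (h : HasRayLimit v φ L) (h' : HasRayLimit v ψ M) :
    HasRayLimit v (fun x => φ x * ψ x) (L * M) := fun x => (h x).mul (h' x)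

theorem congr {φ ψ : (Fin n → ℂ) → ℂ} {L : ℂ} (h : HasRayLimit v φ L) (h' : ∀ x, φ x = ψ x) :
    HasRayLimit v ψ L := fun x => (h x).congr fun _ => h' _

theorem const (a : ℂ) : HasRayLimit v (fun _ => a) a := fun _ => tendsto_const_nhds

theorem prod {ι : Type*} {s : Finset ι} {φ : ι → (Fin n → ℂ) → ℂ}
    (h : ∀ i ∈ s, ∃ L, HasRayLimit v (φ i) L) : ∃ L, HasRayLimit v (fun x => ∏ i ∈ s, φ i x) L := by
  classical
  choose! L hL using h
  exact ⟨∏ i ∈ s, L i, fun x => tendsto_finsetProd _ fun i hi => hL i hi x⟩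

theorem sum {ι : Type*} {s : Finset ι} {φ : ι → (Fin n → ℂ) → ℂ}
    (h : ∀ i ∈ s, ∃ L, HasRayLimit v (φ i) L) : ∃ L, HasRayLimit v (fun x => ∑ i ∈ s, φ i x) L := by
  classical
  choose! L hL using h
  exact ⟨∑ i ∈ s, L i, fun x => tendsto_finsetSum _ fun i hi => hL i hi x⟩

theorem va_pair (h : 0 < p.α) (hv : RegularDir v) {j k : Fin n} (hjk : j ≠ k) {ε ε' : ℤ}
    (hε : ε = 1 ∨ ε = -1) (hε' : ε' = 1 ∨ ε' = -1) (a : ℂ) :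
    ∃ L, HasRayLimit v (fun x => p.va (ε * x j + ε' * x k + a)) L := by
  obtain ⟨L, hL⟩ := tendsto_va (p := p) h (hv.pair_ne j k hjk ε ε' hε hε')
  refine ⟨L, fun x => (hL (ε * x j + ε' * x k + a)).congr fun y => ?_⟩
  simp only [ray]; congr 1; push_cast; ring

theorem vb_coord (h : 0 < p.α) (hv : RegularDir v) (j : Fin n) {ε : ℤ}
    (hε : ε = 1 ∨ ε = -1) : ∃ L, HasRayLimit v (fun x => p.vb (ε * x j)) L := by
  have : ε * v j ≠ 0 := mul_ne_zero (by rcases hε with rfl | rfl <;> simp) (hv.ne_zero j)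
  obtain ⟨L, hL⟩ := tendsto_vb (p := p) h this
  refine ⟨L, fun x => (hL (ε * x j)).congr fun y => ?_⟩
  simp only [ray]; congr 1; push_cast; ring

end HasRayLimit

/-- A Laurent polynomial with limits along all regular rays is constant. -/
theorem ev_const_of_limits (h : 0 < p.α) (hβ : 0 < p.β) {c : (Fin n → ℤ) →₀ ℂ}
    (hc : ∀ v : Fin n → ℤ, RegularDir v → ∃ L, ∀ x, p.Generic x →
      Tendsto (fun N : ℕ => p.ev c (ray v x (p.β * N))) atTop (𝓝 L)) (k : Fin n → ℤ) (hk : k ≠ 0) :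
    c k = 0 := by
  have key : ∀ v : Fin n → ℤ, RegularDir v → 0 < dot v k → c k = 0 := by
    intro v hv hd
    obtain ⟨L, hL⟩ := hc v hv
    refine coeff_eq_zero_of_tendsto (d := 1) h hβ (fun x hx => ?_) k hd
    have := ((tendsto_exp_neg (p := p) h (m := -1) (by norm_num)).comp
      (tendsto_mul_natCast hβ)).mul (hL x hx)
    rw [zero_mul] at this
    exact this
  obtain ⟨i, hi⟩ := Function.ne_iff.1 hk
  -- Giving the entries of `dir n` the signs of the entries of `k` keeps the direction regular and
  -- makes its pairing with `k` positive.
  let s : Fin n → ℤ := fun j => if 0 ≤ k j then 1 else -1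
  have hs : ∀ j, s j = 1 ∨ s j = -1 := fun j => by
    by_cases hj : 0 ≤ k j <;> simp [s, hj]
  have hv : RegularDir (fun j => s j * dir n j) := by
    refine ⟨fun j => mul_ne_zero (by rcases hs j with h | h <;> simp [h])
      (regularDir_dir.ne_zero j), fun j l hjl ε ε' hε hε' => ?_⟩
    have hm : ∀ {a b : ℤ}, (a = 1 ∨ a = -1) → (b = 1 ∨ b = -1) → (a * b = 1 ∨ a * b = -1) := by
      rintro a b (rfl | rfl) (rfl | rfl) <;> simp
    have := regularDir_dir.pair_ne j l hjl (ε * s j) (ε' * s l) (hm hε (hs j)) (hm hε' (hs l))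
    simpa only [mul_assoc] using this
  refine key _ hv ?_
  have hnn : ∀ j, 0 ≤ s j * dir n j * k j := by
    intro j
    have hd : 0 < dir n j := by simp only [dir]; omega
    by_cases hj : 0 ≤ k j
    · simp only [s, hj, if_true]; positivity
    · simp only [s, hj, if_false]; nlinarith
  refine Finset.sum_pos' (fun j _ => hnn j) ⟨i, Finset.mem_univ _, ?_⟩
  refine lt_of_le_of_ne (hnn i) (Ne.symm (mul_ne_zero (mul_ne_zero ?_ ?_) hi))
  · rcases hs i with h | h <;> simp [h]
  · exact regularDir_dir.ne_zero i

end Params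

end Koornwinder

end

noncomputable section

namespace Koornwinder

open Filter Topology

namespace Params

variable {p : Params} {n : ℕ}

/-! ### Sums over signs and the vanishing alternating sum -/

theorem mem_signs {J : Finset (Fin n)} {σ : Fin n → ℤ} :
    σ ∈ signs J ↔ (∀ j ∈ J, σ j = 1 ∨ σ j = -1) ∧ ∀ j, j ∉ J → σ j = 0 := by
  simp only [signs, Fintype.mem_piFinset]
  constructor
  · intro h
    refine ⟨fun j hj => ?_, fun j hj => ?_⟩
    · simpa [hj] using h j
    · simpa [hj] using h j
  · rintro ⟨h1, h2⟩ j
    by_cases hj : j ∈ J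
    · simpa [hj] using h1 j hj
    · simpa [hj] using h2 j hj

theorem sum_signs_mul {M : Type*} [AddCommMonoid M] (J : Finset (Fin n)) {η : Fin n → ℤ}
    (hη : ∀ j, η j = 1 ∨ η j = -1) (g : (Fin n → ℤ) → M) :
    ∑ σ ∈ signs J, g (fun j => η j * σ j) = ∑ σ ∈ signs J, g σ := by
  have hm : ∀ σ ∈ signs J, (fun j => η j * σ j) ∈ signs J := by
    intro σ hσ
    rw [mem_signs] at hσ ⊢
    refine ⟨fun j hj => ?_, fun j hj => by simp [hσ.2 j hj]⟩
    rcases hσ.1 j hj with h | h <;> rcases hη j with h' | h' <;> simp [h, h']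
  have hi : ∀ σ : Fin n → ℤ, (fun j => η j * (η j * σ j)) = σ := by
    intro σ; funext j
    rcases hη j with h' | h' <;> simp [h']
  exact Finset.sum_nbij' (fun σ j => η j * σ j) (fun σ j => η j * σ j) hm hm
    (fun σ _ => hi σ) (fun σ _ => hi σ) (fun _ _ => rfl)

theorem sum_signs_perm {M : Type*} [AddCommMonoid M] (J : Finset (Fin n))
    (π : Equiv.Perm (Fin n)) (g : (Fin n → ℤ) → M) :
    ∑ σ ∈ signs (J.map π.toEmbedding), g (fun j => σ (π j)) = ∑ σ ∈ signs J, g σ := by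
  refine Finset.sum_nbij' (fun σ j => σ (π j)) (fun σ j => σ (π.symm j)) ?_ ?_
    (fun σ _ => by simp) (fun σ _ => by simp) (fun _ _ => rfl)
  · intro σ hσ
    rw [mem_signs] at hσ ⊢
    exact ⟨fun j hj => hσ.1 _ (by simpa using hj), fun j hj => hσ.2 _ (by simpa using hj)⟩
  · intro σ hσ
    rw [mem_signs] at hσ ⊢
    exact ⟨fun j hj => hσ.1 _ (by simpa using hj), fun j hj => hσ.2 _ (by simpa using hj)⟩

/-- Functions invariant under signed permutations of the coordinates. -/
structure WeylInvariant (f : (Fin n → ℂ) → ℂ) : Prop where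
  perm : ∀ (π : Equiv.Perm (Fin n)) x, f (fun j => x (π j)) = f x
  flip : ∀ η : Fin n → ℤ, (∀ j, η j = 1 ∨ η j = -1) → ∀ x, f (fun j => η j * x j) = f x

/-- The alternating sum over the signs of the coordinates in `J` of the interaction factors and of
the values of `f`. -/
def innerSum (p : Params) (J : Finset (Fin n)) (f : (Fin n → ℂ) → ℂ) (y : Fin n → ℂ) : ℂ :=
  ∑ σ ∈ signs J, (∏ j ∈ J, (σ j : ℂ)) * pairProd J (fun j k => p.va (σ j * y j + σ k * y k)) *
    f (fun j => if j ∈ J then σ j * y j + p.γ else y j)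

theorem innerSum_perm {f : (Fin n → ℂ) → ℂ} (hf : ∀ (π : Equiv.Perm (Fin n)) x,
    f (fun j => x (π j)) = f x) (J : Finset (Fin n)) (π : Equiv.Perm (Fin n)) (y : Fin n → ℂ) :
    p.innerSum J f (fun j => y (π j)) = p.innerSum (J.map π.toEmbedding) f y := by
  rw [innerSum, ← sum_signs_perm J π, innerSum]
  refine Finset.sum_congr rfl fun σ _ => ?_
  rw [Finset.prod_map, pairProd_map π (fun j k => by rw [add_comm]),
    ← hf π (fun j => if j ∈ J.map π.toEmbedding then _ else _)]
  simp

/-- The substitution `σ ↦ ησ` absorbs the flip everywhere except in the factor `∏ σ_j`. -/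
theorem innerSum_flip (f : (Fin n → ℂ) → ℂ) (J : Finset (Fin n)) {η : Fin n → ℤ}
    (hη : ∀ j, η j = 1 ∨ η j = -1) (h1 : ∀ j, j ∉ J → η j = 1) (y : Fin n → ℂ) :
    p.innerSum J f (fun j => η j * y j) = (∏ j ∈ J, (η j : ℂ)) * p.innerSum J f y := by
  rw [innerSum, ← sum_signs_mul J hη, innerSum, Finset.mul_sum]
  refine Finset.sum_congr rfl fun σ _ => ?_
  have hc : ∀ j, ((η j * σ j : ℤ) : ℂ) * (η j * y j) = σ j * y j := by
    intro j
    rcases hη j with h | h <;> simp [h]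
  simp only [hc]
  have hf : (fun j => if j ∈ J then (σ j : ℂ) * y j + p.γ else η j * y j) =
      fun j => if j ∈ J then (σ j : ℂ) * y j + p.γ else y j := by
    funext j
    split_ifs with hj
    · rfl
    · simp [h1 j hj]
  rw [hf]
  simp only [Int.cast_mul, Finset.prod_mul_distrib]
  ring

/-- Up to a unit, one of the two factors of the cosine difference in `cs_sub` is the denominator of
`va`. -/
theorem IsLaurent.cs_mul_va {j k : Fin n} (hjk : j ≠ k) {σ σ' : ℤ} (hσ : σ = 1 ∨ σ = -1)
    (hσ' : σ' = 1 ∨ σ' = -1) :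
    p.IsLaurent (fun y => (p.cs (y k) - p.cs (y j)) * p.va (σ * y j + σ' * y k)) := by
  have h1 := ((E_pair (p := p) j k σ σ' p.μ).sub (const 1)).mul
    (((E_pair (p := p) k j σ' (-σ) 0).sub (const 1)).mul (E_coord (p := p) k (-σ') 0))
  refine (h1.const_mul (p.phase p.μ / 2)).congr fun y hy => ?_
  have hcs : ∀ (s : ℤ), (s = 1 ∨ s = -1) → ∀ z, p.cs z = p.cs (s * z) := by
    rintro s (rfl | rfl) z <;> simp [cs_neg]
  have hne := hy.pair_ne hjk 0 hσ hσ'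
  simp only [Int.cast_zero, zero_mul, add_zero] at hne
  rw [hcs σ' hσ' (y k), hcs σ hσ (y j), cs_sub, va_eq, add_comm ((σ' : ℂ) * y k)]
  have e1 : (σ : ℂ) * y j + σ' * y k + p.μ = p.μ + (σ * y j + σ' * y k) := by ring
  have e2 : (σ' : ℂ) * y k + ((-σ : ℤ) : ℂ) * y j + 0 = σ' * y k - σ * y j := by push_cast; ring
  have e3 : ((-σ' : ℤ) : ℂ) * y k + 0 = -(σ' * y k) := by push_cast; ring
  rw [e1, e2, e3, E_neg]
  have h0 := sub_ne_zero.2 hne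
  have h2 := p.E_ne_zero (σ' * y k)
  field_simp

theorem Generic.sn_ne {x : Fin n → ℂ} (hx : p.Generic x) (j : Fin n) : p.sn (x j) ≠ 0 :=
  sn_ne_zero (by simpa using hx.sq_ne j 0)

/-- The inner sum of an invariant Laurent polynomial is a Laurent polynomial divisible by
`∏ sin(2αy_j)`. -/
theorem innerSum_div_isLaurent {c : (Fin n → ℤ) →₀ ℂ} (hf : ∀ (π : Equiv.Perm (Fin n)) x,
    p.ev c (fun j => x (π j)) = p.ev c x) (J : Finset (Fin n)) :
    p.IsLaurent (fun y => p.innerSum J (p.ev c) y / ∏ j ∈ J, p.sn (y j)) := by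
  -- Under a flip the inner sum and the product of sines acquire the same sign, so the quotient is
  -- invariant. In `weylDen` the sines cancel the divisor and the cosine differences cancel the
  -- poles of the factors `va`.
  refine isLaurent_of_invariant J (fun π hπ x hx => ?_) (fun η hη hη1 x hx => ?_) ?_
  · have hJ : J.map π.toEmbedding = J := by
      have hsub : J.map π.toEmbedding ⊆ J := by
        intro j hj
        rw [Finset.mem_map_equiv] at hj
        by_contra hj'
        have h1 : π.symm j = j := by rw [Equiv.symm_apply_eq, hπ j hj']
        rw [h1] at hj
        exact hj' hj
      exact Finset.eq_of_subset_of_card_le hsub (by simp)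
    have h2 : ∏ j ∈ J, p.sn (x (π j)) = ∏ j ∈ J, p.sn (x j) := by
      conv_rhs => rw [← hJ, Finset.prod_map]
      rfl
    rw [innerSum_perm hf, hJ, h2]
  · have h2 : ∏ j ∈ J, p.sn (η j * x j) = (∏ j ∈ J, (η j : ℂ)) * ∏ j ∈ J, p.sn (x j) := by
      rw [← Finset.prod_mul_distrib]
      refine Finset.prod_congr rfl fun j _ => ?_
      rcases hη j with h | h <;> simp [h, sn_neg]
    rw [innerSum_flip _ J hη hη1, h2, mul_div_mul_left]
    refine Finset.prod_ne_zero_iff.2 fun j _ => ?_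
    rcases hη j with h | h <;> simp [h]
  · have h1 : p.IsLaurent (fun y : Fin n → ℂ => ∑ σ ∈ signs J, (∏ j ∈ J, (σ j : ℂ)) *
        (pairProd J (fun j k => (p.cs (y k) - p.cs (y j)) * p.va (σ j * y j + σ k * y k)) *
        p.ev c (fun j => if j ∈ J then σ j * y j + p.γ else y j))) := by
      refine IsLaurent.sum fun σ hσ => IsLaurent.const_mul _ (IsLaurent.mul ?_ ?_)
      · rw [mem_signs] at hσ
        exact IsLaurent.pairProd fun j hj k hk hjk =>
          IsLaurent.cs_mul_va hjk.ne (hσ.1 j hj) (hσ.1 k hk)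
      · rw [mem_signs] at hσ
        have := (isLaurent_ev (p := p) c).comp_affine 1 (fun j => if j ∈ J then σ j else 1)
          (fun j => if j ∈ J then 1 else 0) (fun j => by
            split_ifs with hj
            · exact hσ.1 j hj
            · exact Or.inl rfl)
        refine this.congr fun y _ => ?_
        refine congrArg _ (funext fun j => ?_)
        split_ifs <;> simp
    refine h1.congr fun y hy => ?_
    have hsn : ∏ j ∈ J, p.sn (y j) ≠ 0 := Finset.prod_ne_zero_iff.2 fun j _ => hy.sn_ne j
    rw [weylDen]
    simp only [pairProd_mul]
    have h2 : p.innerSum J (p.ev c) y * pairProd J (fun j k => p.cs (y k) - p.cs (y j)) =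
      ∑ σ ∈ signs J, (∏ j ∈ J, (σ j : ℂ)) *
        (pairProd J (fun j k => p.cs (y k) - p.cs (y j)) *
          pairProd J (fun j k => p.va (σ j * y j + σ k * y k)) *
        p.ev c (fun j => if j ∈ J then σ j * y j + p.γ else y j)) := by
      rw [innerSum, Finset.sum_mul]
      refine Finset.sum_congr rfl fun σ _ => ?_
      ring
    rw [← h2]
    field_simp

/-- The alternating sum of the interaction factors vanishes. -/
theorem alternating_sum_eq_zero (h : 0 < p.α) (hβ : 0 < p.β) {J : Finset (Fin n)} (hJ : J.Nonempty)
    {y : Fin n → ℂ} (hy : p.Generic y) :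
    ∑ σ ∈ signs J, (∏ j ∈ J, (σ j : ℂ)) *
      pairProd J (fun j k => p.va (σ j * y j + σ k * y k)) = 0 := by
  -- The sum is the inner sum of the constant function `1`, hence a Laurent polynomial. It converges
  -- along all regular rays, so it is constant; flipping a single coordinate of `J` changes its
  -- sign, so the constant is zero.
  have hone : p.ev (Finsupp.single (0 : Fin n → ℤ) 1) = fun _ => 1 := by
    funext x; rw [ev_single, mono_zero, mul_one]
  set F : (Fin n → ℂ) → ℂ := fun y => ∑ σ ∈ signs J, (∏ j ∈ J, (σ j : ℂ)) *
      pairProd J (fun j k => p.va (σ j * y j + σ k * y k)) with hF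
  have hFi : ∀ y, F y = p.innerSum J (p.ev (Finsupp.single (0 : Fin n → ℤ) 1)) y := by
    intro y; simp only [hF, innerSum, hone, mul_one]
  have hL : p.IsLaurent F := by
    have h1 := innerSum_div_isLaurent (p := p) (c := Finsupp.single (0 : Fin n → ℤ) 1)
      (fun π x => by simp only [hone]) J
    have h2 : p.IsLaurent (fun y : Fin n → ℂ => ∏ j ∈ J, p.sn (y j)) :=
      IsLaurent.prod fun j _ => by simpa using IsLaurent.sn (p := p) j 1 0
    refine (h1.mul h2).congr fun y hy => ?_
    rw [hFi, div_mul_cancel₀]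
    exact Finset.prod_ne_zero_iff.2 fun j _ => hy.sn_ne j
  obtain ⟨c, hc⟩ := isLaurent_iff.1 hL
  have hlim : ∀ v : Fin n → ℤ, RegularDir v → ∃ L, HasRayLimit v F L := by
    intro v hv
    refine HasRayLimit.sum fun σ hσ => ?_
    rw [mem_signs] at hσ
    have : ∃ L, HasRayLimit v (fun y => pairProd J (fun j k => p.va (σ j * y j + σ k * y k))) L := by
      refine HasRayLimit.prod fun j hj => HasRayLimit.prod fun k hk => ?_
      rw [Finset.mem_filter] at hk
      simpa using HasRayLimit.va_pair (p := p) h hv hk.2.ne (hσ.1 j hj) (hσ.1 k hk.1) 0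
    obtain ⟨L, hL⟩ := this
    exact ⟨_, (HasRayLimit.const _).mul hL⟩
  obtain ⟨i, hi⟩ := hJ
  have hc0 : ∀ k, k ≠ 0 → c k = 0 := by
    refine ev_const_of_limits h hβ fun v hv => ?_
    obtain ⟨L, hL⟩ := hlim v hv
    refine ⟨L, fun x hx => ?_⟩
    refine ((hL x).comp (tendsto_mul_natCast hβ)).congr fun N => ?_
    exact hc _ (hx.ray v N)
  have hconst : ∀ y, p.Generic y → F y = c 0 := by
    intro y hy
    rw [hc y hy, ev_apply]
    by_cases h0 : c 0 = 0
    · rw [h0]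
      refine Finset.sum_eq_zero fun k _ => ?_
      by_cases hk : k = 0
      · simp [hk, h0]
      · simp [hc0 k hk]
    · rw [Finset.sum_eq_single 0 (fun k _ hk => by simp [hc0 k hk]) (by simp [h0]), mono_zero,
        mul_one]
  let η : Fin n → ℤ := fun j => if j = i then -1 else 1
  have hη : ∀ j, η j = 1 ∨ η j = -1 := fun j => by by_cases hj : j = i <;> simp [η, hj]
  have hg := hy.affine 1 η 0 hη
  simp only [Pi.zero_apply, Int.cast_zero, zero_mul, add_zero, Equiv.Perm.coe_one, id] at hg
  have hodd : F (fun j => η j * y j) = -F y := by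
    rw [hFi, innerSum_flip _ J hη (fun j hj => if_neg (by rintro rfl; exact hj hi)), hFi]
    have : ∏ j ∈ J, (η j : ℂ) = -1 := by
      rw [Finset.prod_eq_single i]
      · simp [η]
      · intro j _ hj; simp [η, hj]
      · intro h; exact absurd hi h
    rw [this]; ring
  have h1 := hconst _ hg
  have h2 := hconst _ hy
  have h3 : F y = 0 := by
    have : F y = -F y := by rw [← hodd, h1, h2]
    linear_combination this / 2
  exact h3

/-! ### Resummation of the chains and the closed form of the operators -/

/-- The chains of length `s` from `K` to `J`. -/
def chainsFrom (s : ℕ) (K J : Finset (Fin n)) : Finset (Fin (s + 1) → Finset (Fin n)) :=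
  {c | c 0 = K ∧ StrictMono c ∧ c (Fin.last s) = J}

theorem mem_chainsFrom {s : ℕ} {K J : Finset (Fin n)} {c : Fin (s + 1) → Finset (Fin n)} :
    c ∈ chainsFrom s K J ↔ c 0 = K ∧ StrictMono c ∧ c (Fin.last s) = J := by
  simp [chainsFrom]

theorem chains_eq (s : ℕ) (J : Finset (Fin n)) : chains s J = chainsFrom s ∅ J := rfl

theorem strictMono_cons {s : ℕ} {K : Finset (Fin n)} {c : Fin (s + 1) → Finset (Fin n)} :
    StrictMono (Fin.cons K c : Fin (s + 2) → Finset (Fin n)) ↔ K ⊂ c 0 ∧ StrictMono c := by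
  rw [Fin.strictMono_iff_lt_succ, Fin.forall_fin_succ, Fin.strictMono_iff_lt_succ]
  refine and_congr ?_ (forall_congr' fun i => ?_)
  · simp
  · rw [Fin.cons_succ, ← Fin.succ_castSucc, Fin.cons_succ]

theorem chainCoeff_cons {s : ℕ} (ε : Fin n → ℤ) (K : Finset (Fin n))
    (c : Fin (s + 1) → Finset (Fin n)) (x : Fin n → ℂ) :
    p.chainCoeff ε (Fin.cons K c : Fin (s + 2) → Finset (Fin n)) x =
      p.V ε (c 0 \ K) (c 0)ᶜ x * p.chainCoeff ε c x := by
  rw [chainCoeff, Fin.prod_univ_succ, chainCoeff]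
  congr 1

/-- Splitting a sum over chains according to the first step. -/
theorem sum_chainsFrom_succ (t : ℕ) (K J : Finset (Fin n)) (ε : Fin n → ℤ) (x : Fin n → ℂ)
    (g : Finset (Fin n) → ℂ) :
    ∑ c ∈ chainsFrom (t + 1) K J, p.chainCoeff ε c x * g (c 1) =
      ∑ L ∈ Finset.Ioc K J, g L * p.V ε (L \ K) Lᶜ x *
        ∑ c ∈ chainsFrom t L J, p.chainCoeff ε c x := by
  simp only [Finset.mul_sum]
  rw [Finset.sum_sigma' (Finset.Ioc K J) (fun L => chainsFrom t L J)]
  refine Finset.sum_bij' (fun c _ => ⟨c 1, Fin.tail c⟩)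
    (fun a _ => (Fin.cons K a.2 : Fin (t + 2) → Finset (Fin n))) ?_ ?_ ?_ ?_ ?_
  · intro c hc
    rw [mem_chainsFrom] at hc
    obtain ⟨h0, hm, hl⟩ := hc
    simp only [Finset.mem_sigma, Finset.mem_Ioc, mem_chainsFrom]
    have hct : c = Fin.cons K (Fin.tail c) := by rw [← h0, Fin.cons_self_tail]
    rw [hct, strictMono_cons] at hm
    refine ⟨⟨hm.1, ?_⟩, rfl, hm.2, hl⟩
    have : Fin.tail c 0 ≤ Fin.tail c (Fin.last t) := hm.2.monotone (Fin.zero_le _)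
    exact this.trans (le_of_eq hl)
  · rintro ⟨L, c⟩ hc
    simp only [Finset.mem_sigma, Finset.mem_Ioc, mem_chainsFrom] at hc
    obtain ⟨⟨hKL, _⟩, h0, hm, hl⟩ := hc
    rw [mem_chainsFrom]
    refine ⟨rfl, strictMono_cons.2 ⟨?_, hm⟩, ?_⟩
    · exact h0 ▸ hKL
    · rw [← Fin.succ_last, Fin.cons_succ]
      exact hl
  · intro c hc
    rw [mem_chainsFrom] at hc
    simp only
    rw [← hc.1, Fin.cons_self_tail]
  · rintro ⟨L, c⟩ hc
    simp only [Finset.mem_sigma, Finset.mem_Ioc, mem_chainsFrom] at hc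
    have h1 : (Fin.cons K c : Fin (t + 2) → Finset (Fin n)) 1 = L := hc.2.1
    simp only [h1, Fin.tail_cons]
  · intro c hc
    rw [mem_chainsFrom] at hc
    have hct : c = Fin.cons K (Fin.tail c) := by rw [← hc.1, Fin.cons_self_tail]
    conv_lhs => rw [hct, chainCoeff_cons]
    have : (Fin.cons K (Fin.tail c) : Fin (t + 2) → Finset (Fin n)) 1 = c 1 := rfl
    rw [this]
    have : Fin.tail c 0 = c 1 := rfl
    rw [this]
    ring

/-- The alternating sum over the chains from `K` to `J` of length less than `m`. -/
def chainSum (p : Params) (m : ℕ) (ε : Fin n → ℤ) (K J : Finset (Fin n)) (x : Fin n → ℂ) : ℂ :=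
  ∑ t ∈ Finset.range m, (-1) ^ t * ∑ c ∈ chainsFrom t K J, p.chainCoeff ε c x

/-- A chain of positive length is its first step `K ⊂ L` followed by a chain from `L`, one shorter
and so of opposite sign. The chain of length `0` exists only for `K = J`. -/
theorem chainSum_succ (m : ℕ) (ε : Fin n → ℤ) (K J : Finset (Fin n)) (x : Fin n → ℂ) :
    p.chainSum (m + 1) ε K J x = (if K = J then 1 else 0) -
      ∑ L ∈ Finset.Ioc K J, p.V ε (L \ K) Lᶜ x * p.chainSum m ε L J x := by
  rw [chainSum, Finset.sum_range_succ', add_comm, sub_eq_add_neg]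
  congr 1
  · simp only [pow_zero, one_mul]
    split_ifs with h
    · subst h
      have : chainsFrom 0 K K = {fun _ => K} := by
        ext c
        rw [mem_chainsFrom, Finset.mem_singleton]
        constructor
        · rintro ⟨h, -, -⟩
          funext i
          rw [Fin.fin_one_eq_zero i]
          exact h
        · rintro rfl
          exact ⟨rfl, fun i j hij => absurd hij (by simp), rfl⟩
      rw [this, Finset.sum_singleton, chainCoeff, Finset.univ_eq_empty, Finset.prod_empty]
    · refine Finset.sum_eq_zero fun c hc => ?_
      rw [mem_chainsFrom] at hc
      exact absurd (hc.1.symm.trans hc.2.2) h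
  · simp only [chainSum, Finset.mul_sum]
    rw [Finset.sum_comm, ← Finset.sum_neg_distrib]
    refine Finset.sum_congr rfl fun t _ => ?_
    have := sum_chainsFrom_succ (p := p) t K J ε x (fun _ => 1)
    simp only [mul_one, one_mul] at this
    rw [← Finset.mul_sum, this, Finset.mul_sum, ← Finset.sum_neg_distrib]
    refine Finset.sum_congr rfl fun L _ => ?_
    rw [pow_succ, ← Finset.mul_sum, ← Finset.mul_sum]
    ring

/-- The coefficient attached to the signs `ε` and `σ` of the indices in `J`, relative to the
complementary indices in `R`. -/
def block (p : Params) (J R : Finset (Fin n)) (ε σ : Fin n → ℤ) (x : Fin n → ℂ) : ℂ :=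
  (∏ j ∈ J, (σ j : ℂ) * p.vb (ε j * x j)) *
  pairProd J (fun j k => p.va (ε j * x j + ε k * x k) *
    p.va (σ j * (ε j * x j + p.γ) + σ k * (ε k * x k + p.γ))) *
  ∏ j ∈ J, ∏ k ∈ R, p.va (ε j * x j + x k) * p.va (ε j * x j - x k)

/-- With all `σ` equal to `1` the second pair factor has argument `ε_j x_j + ε_k x_k + 2γ`, as in
`V`. -/
theorem V_eq_block (ε : Fin n → ℤ) (J R : Finset (Fin n)) (x : Fin n → ℂ) :
    p.V ε J R x = p.block J R ε 1 x := by
  rw [V, block, pairProd]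
  congr 2
  · simp
  · refine Finset.prod_congr rfl fun j _ => Finset.prod_congr rfl fun k _ => ?_
    congr 2
    simp; ring

theorem block_congr {J R : Finset (Fin n)} {ε σ σ' : Fin n → ℤ} (h : ∀ j ∈ J, σ j = σ' j)
    (x : Fin n → ℂ) : p.block J R ε σ x = p.block J R ε σ' x := by
  rw [block, block, pairProd_congr (h' := fun j k => p.va (ε j * x j + ε k * x k) *
    p.va (σ' j * (ε j * x j + p.γ) + σ' k * (ε k * x k + p.γ)))
    (fun j hj k hk _ => by rw [h j hj, h k hk]), Finset.prod_congr rfl (fun j hj => by rw [h j hj])]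

theorem va_mul_signed {u z : ℂ} {ε : ℤ} (hε : ε = 1 ∨ ε = -1) :
    p.va (u + z) * p.va (u - z) = p.va (u + ε * z) * p.va (u - ε * z) := by
  rcases hε with rfl | rfl
  · simp
  · simp [mul_comm, sub_eq_add_neg]

/-- For `j ∈ I` and `k ∈ I'` the signs `σ_j = 1`, `σ_k = -1` cancel the two `γ`. The two pair
factors then become `va (ε_j x_j ± ε_k x_k)`, which is exactly what `k` contributes as a
complementary index of the first block. -/
theorem block_union {I I' R : Finset (Fin n)} (hd : Disjoint I I') (hR : Disjoint I' R)
    {ε σ : Fin n → ℤ} (hε : ∀ j ∈ I', ε j = 1 ∨ ε j = -1) (h1 : ∀ j ∈ I, σ j = 1)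
    (h2 : ∀ j ∈ I', σ j = -1) (x : Fin n → ℂ) :
    p.block I (I' ∪ R) ε 1 x * p.block I' R ε (-1) x = p.block (I ∪ I') R ε σ x := by
  rw [block_congr (σ := 1) (σ' := σ) (fun j hj => by simp [h1 j hj]),
    block_congr (σ := -1) (σ' := σ) (fun j hj => by simp [h2 j hj])]
  rw [block, block, block, pairProd_union hd (fun j k => by
    rw [add_comm ((ε j : ℂ) * x j), add_comm ((σ j : ℂ) * _)]), Finset.prod_union hd, Finset.prod_union hd]
  have hx : ∏ j ∈ I, ∏ k ∈ I' ∪ R, p.va (ε j * x j + x k) * p.va (ε j * x j - x k) =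
      (∏ j ∈ I, ∏ k ∈ I', p.va (ε j * x j + ε k * x k) *
        p.va (σ j * (ε j * x j + p.γ) + σ k * (ε k * x k + p.γ))) *
      ∏ j ∈ I, ∏ k ∈ R, p.va (ε j * x j + x k) * p.va (ε j * x j - x k) := by
    rw [← Finset.prod_mul_distrib]
    refine Finset.prod_congr rfl fun j hj => ?_
    rw [Finset.prod_union hR]
    congr 1
    refine Finset.prod_congr rfl fun k hk => ?_
    rw [va_mul_signed (hε k hk), h1 j hj, h2 k hk]
    congr 2
    push_cast; ring
  rw [hx]
  ring

/-- The sign function that is `1` on `I`, `-1` on the rest of `M` and `0` outside. -/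
def signOf (M I : Finset (Fin n)) (j : Fin n) : ℤ := if j ∈ I then 1 else if j ∈ M then -1 else 0

theorem sum_signs_eq {A : Type*} [AddCommMonoid A] (M : Finset (Fin n)) (g : (Fin n → ℤ) → A) :
    ∑ σ ∈ signs M, g σ = ∑ I ∈ M.powerset, g (signOf M I) := by
  symm
  refine Finset.sum_nbij' (fun I => signOf M I) (fun σ => M.filter fun j => σ j = 1) ?_ ?_ ?_ ?_
    (fun _ _ => rfl)
  · intro I hI
    rw [Finset.mem_powerset] at hI
    rw [mem_signs]
    refine ⟨fun j hj => ?_, fun j hj => ?_⟩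
    · by_cases hjI : j ∈ I <;> simp [signOf, hjI, hj]
    · have : j ∉ I := fun h => hj (hI h)
      simp [signOf, this, hj]
  · intro σ _
    simp
  · intro I hI
    rw [Finset.mem_powerset] at hI
    ext j
    rw [Finset.mem_filter]
    constructor
    · rintro ⟨hj, h⟩
      by_contra hjI
      simp [signOf, hjI, hj] at h
    · intro h
      exact ⟨hI h, by simp [signOf, h]⟩
  · intro σ hσ
    rw [mem_signs] at hσ
    funext j
    by_cases hj : j ∈ M
    · rcases hσ.1 j hj with h | h <;> simp [signOf, hj, h]
    · simp [signOf, hj, hσ.2 j hj]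

/-- The factors independent of `σ` come out of the sum, and what is left is the alternating sum at
the point `y_j = ε_j x_j + γ`. -/
theorem sum_block_eq_zero (h : 0 < p.α) (hβ : 0 < p.β) {M R : Finset (Fin n)} (hM : M.Nonempty)
    {ε : Fin n → ℤ} (hε : ∀ j ∈ M, ε j = 1 ∨ ε j = -1) {x : Fin n → ℂ} (hx : p.Generic x) :
    ∑ σ ∈ signs M, p.block M R ε σ x = 0 := by
  have hg := hx.affine 1 (fun j => if j ∈ M then ε j else 1) (fun j => if j ∈ M then 1 else 0)
    (fun j => by
      split_ifs with hj
      · exact hε j hj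
      · exact Or.inl rfl)
  have h0 := alternating_sum_eq_zero h hβ hM hg
  calc _ = ∑ σ ∈ signs M, ((∏ j ∈ M, p.vb (ε j * x j)) *
        pairProd M (fun j k => p.va (ε j * x j + ε k * x k)) *
        ∏ j ∈ M, ∏ k ∈ R, p.va (ε j * x j + x k) * p.va (ε j * x j - x k)) *
        ((∏ j ∈ M, (σ j : ℂ)) *
          pairProd M (fun j k => p.va (σ j * (ε j * x j + p.γ) + σ k * (ε k * x k + p.γ)))) := by
        refine Finset.sum_congr rfl fun σ _ => ?_
        rw [block, pairProd_mul, Finset.prod_mul_distrib]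
        ring
    _ = 0 := by
        rw [← Finset.mul_sum]
        convert mul_zero _ using 2
        rw [← h0]
        refine Finset.sum_congr rfl fun σ _ => ?_
        congr 1
        refine pairProd_congr fun j hj k hk _ => ?_
        simp [hj, hk]

/-- Induction on the first step `L`. By `block_union` the contribution of `L` is the block with
signs `1` on `L \ K` and `-1` on `J \ L`. Over all `L` from `K` to `J` these blocks are all sign
choices on `J \ K` and sum to zero, so minus the sum over `L ≠ K` is the term `L = K`, whose signs
are all `-1`. The bound on `m` guarantees that no chain is left out. -/
theorem chainSum_eq (h : 0 < p.α) (hβ : 0 < p.β) {ε : Fin n → ℤ} {J : Finset (Fin n)}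
    (hε : ∀ j ∈ J, ε j = 1 ∨ ε j = -1) {x : Fin n → ℂ} (hx : p.Generic x) :
    ∀ (m : ℕ) (K : Finset (Fin n)), K ⊆ J → (J \ K).card < m →
      p.chainSum m ε K J x = p.block (J \ K) Jᶜ ε (-1) x := by
  intro m
  induction m with
  | zero => intro K _ h; simp at h
  | succ m ih =>
    intro K hK hm
    rw [chainSum_succ]
    by_cases hKJ : K = J
    · subst hKJ
      simp [block, pairProd]
    · rw [if_neg hKJ, zero_sub]
      have hne : (J \ K).Nonempty := by
        rw [Finset.sdiff_nonempty]
        exact fun h => hKJ (hK.antisymm h)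
      have hstep : ∀ L ∈ Finset.Icc K J, p.V ε (L \ K) Lᶜ x * p.block (J \ L) Jᶜ ε (-1) x =
          p.block (J \ K) Jᶜ ε (signOf (J \ K) (L \ K)) x := by
        intro L hL
        rw [Finset.mem_Icc] at hL
        obtain ⟨hKL, hLJ⟩ := hL
        have hKL' : K ⊆ L := hKL
        have hLJ' : L ⊆ J := hLJ
        have e1 : Lᶜ = (J \ L) ∪ Jᶜ := by
          ext j
          simp only [Finset.mem_compl, Finset.mem_union, Finset.mem_sdiff]
          constructor
          · intro hj; by_cases hjJ : j ∈ J <;> simp [hj, hjJ]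
          · rintro (h | h)
            · exact h.2
            · exact fun hj => h (hLJ' hj)
        have e2 : J \ K = (L \ K) ∪ (J \ L) := by
          ext j
          simp only [Finset.mem_union, Finset.mem_sdiff]
          constructor
          · rintro ⟨h1, h2⟩; by_cases hjL : j ∈ L <;> simp [h1, h2, hjL]
          · rintro (h | h)
            · exact ⟨hLJ' h.1, h.2⟩
            · exact ⟨h.1, fun hj => h.2 (hKL' hj)⟩
        rw [V_eq_block, e1, block_union (σ := signOf (J \ K) (L \ K))]
        · rw [← e2]
        · rw [Finset.disjoint_left]
          intro j hj hj'
          exact (Finset.mem_sdiff.1 hj').2 (Finset.mem_sdiff.1 hj).1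
        · rw [Finset.disjoint_left]
          intro j hj hj'
          exact (Finset.mem_compl.1 hj') (Finset.mem_sdiff.1 hj).1
        · intro j hj; exact hε j (Finset.mem_sdiff.1 hj).1
        · intro j hj; simp [signOf, hj]
        · intro j hj
          rw [Finset.mem_sdiff] at hj
          have h1 : j ∉ L \ K := fun h => hj.2 (Finset.mem_sdiff.1 h).1
          have h2 : j ∈ J \ K := Finset.mem_sdiff.2 ⟨hj.1, fun h => hj.2 (hKL' h)⟩
          rw [signOf, if_neg h1, if_pos h2]
      have hIoc : ∑ L ∈ Finset.Ioc K J, p.V ε (L \ K) Lᶜ x * p.chainSum m ε L J x =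
          ∑ L ∈ Finset.Ioc K J, p.V ε (L \ K) Lᶜ x * p.block (J \ L) Jᶜ ε (-1) x := by
        refine Finset.sum_congr rfl fun L hL => ?_
        rw [Finset.mem_Ioc] at hL
        rw [ih L hL.2]
        have hss : J \ L ⊂ J \ K := by
          refine Finset.ssubset_iff_subset_ne.2
            ⟨Finset.sdiff_subset_sdiff (Finset.Subset.refl _) hL.1.le, ?_⟩
          intro heq
          apply hL.1.not_ge
          intro j hj
          by_contra hjK
          have : j ∈ J \ K := Finset.mem_sdiff.2 ⟨hL.2 hj, hjK⟩
          rw [← heq] at this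
          exact (Finset.mem_sdiff.1 this).2 hj
        have := Finset.card_lt_card hss
        omega
      have hKJ' : K ≤ J := hK
      have hsum : ∑ L ∈ Finset.Icc K J, p.V ε (L \ K) Lᶜ x * p.block (J \ L) Jᶜ ε (-1) x = 0 := by
        rw [Finset.sum_congr rfl hstep, ← sum_block_eq_zero (M := J \ K) (R := Jᶜ) h hβ hne
          (fun j hj => hε j (Finset.mem_sdiff.1 hj).1) hx, sum_signs_eq]
        refine Finset.sum_nbij' (fun L => L \ K) (fun I => K ∪ I) ?_ ?_ ?_ ?_ (fun _ _ => rfl)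
        · intro L hL
          rw [Finset.mem_Icc] at hL
          rw [Finset.mem_powerset]
          exact Finset.sdiff_subset_sdiff hL.2 (Finset.Subset.refl _)
        · intro I hI
          rw [Finset.mem_powerset] at hI
          rw [Finset.mem_Icc]
          exact ⟨Finset.subset_union_left,
            Finset.union_subset hK (hI.trans Finset.sdiff_subset)⟩
        · intro L hL
          rw [Finset.mem_Icc] at hL
          exact Finset.union_sdiff_of_subset hL.1
        · intro I hI
          rw [Finset.mem_powerset] at hI
          have : Disjoint K I := by
            rw [Finset.disjoint_left]
            intro j hj hj'
            exact (Finset.mem_sdiff.1 (hI hj')).2 hj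
          rw [Finset.union_sdiff_left, Finset.sdiff_eq_self_of_disjoint this.symm]
      rw [hIoc]
      have hins : Finset.Icc K J = insert K (Finset.Ioc K J) := (Finset.Ioc_insert_left hKJ').symm
      rw [hins, Finset.sum_insert (by simp)] at hsum
      have hV : p.V ε (K \ K) Kᶜ x = 1 := by simp [V]
      rw [hV, one_mul] at hsum
      linear_combination -hsum

/-- The point to which the term with signs `ε`, `σ` translates `x`. -/
def move (p : Params) (ε σ : Fin n → ℤ) (x : Fin n → ℂ) : Fin n → ℂ :=
  fun j => x j + (ε j + ε j * σ j) * p.γ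

/-- The action of the difference operator of order `r`, in closed form. -/
def closedOp (p : Params) (r : ℕ) (f : (Fin n → ℂ) → ℂ) (x : Fin n → ℂ) : ℂ :=
  ∑ J : Finset (Fin n) with J.card = r, ∑ ε ∈ signs J, ∑ σ ∈ signs J,
    p.block J Jᶜ ε σ x * f (p.move ε σ x)

end Params

namespace DiffOp

variable {n : ℕ}

/-- The action at a point, as an additive map in the operator. -/
def actHom (β : ℝ) (f : (Fin n → ℂ) → ℂ) (x : Fin n → ℂ) : DiffOp n →+ ℂ :=
  Finsupp.liftAddHom fun κ =>
    { toFun := fun a => a x * f (shift β κ x)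
      map_zero' := by simp
      map_add' := fun a b => by simp [add_mul] }

theorem act_eq_actHom (β : ℝ) (A : DiffOp n) (f : (Fin n → ℂ) → ℂ) (x : Fin n → ℂ) :
    act β A f x = actHom β f x A := rfl

theorem actHom_single (β : ℝ) (f : (Fin n → ℂ) → ℂ) (x : Fin n → ℂ) (κ : Fin n → ℤ)
    (a : (Fin n → ℂ) → ℂ) : actHom β f x (Finsupp.single κ a) = a x * f (shift β κ x) := by
  simp [actHom]

end DiffOp

namespace Params

variable {p : Params} {n : ℕ}

/-- Group the chains by their first set `L`, on which the translation acts. `chainSum_eq` sums the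
remaining steps, and `block_union` merges the result into the block whose `σ` is `1` on `L` and `-1`
on the rest of `J`. The term `-1` in `T - 1` multiplies the sum of all these blocks, which vanishes
since `r ≥ 1` makes `J` nonempty. -/
theorem act_D (h : 0 < p.α) (hβ : 0 < p.β) {r : ℕ} (hr : 1 ≤ r) (f : (Fin n → ℂ) → ℂ)
    {x : Fin n → ℂ} (hx : p.Generic x) :
    DiffOp.act p.β (p.D n r) f x = p.closedOp r f x := by
  rw [DiffOp.act_eq_actHom, D, closedOp]
  simp only [map_sum, map_sub, DiffOp.actHom_single]
  refine Finset.sum_congr rfl fun J hJ => Finset.sum_congr rfl fun ε hε => ?_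
  have hJr : J.card = r := (Finset.mem_filter.1 hJ).2
  have hJne : J.Nonempty := by rw [← Finset.card_pos]; omega
  rw [mem_signs] at hε
  have hmove : ∀ L ∈ Finset.Icc ∅ J, shift p.β (signVec ε L) x = p.move ε (signOf J L) x := by
    intro L hL
    have hLJ : L ⊆ J := (Finset.mem_Icc.1 hL).2
    funext j
    simp only [shift, signVec, move, signOf, γ]
    by_cases hjL : j ∈ L
    · simp [hjL]; ring
    · by_cases hjJ : j ∈ J
      · simp [hjL, hjJ]
      · simp [hjL, hjJ, hε.2 j hjJ]
  have hstep : ∀ L ∈ Finset.Icc ∅ J, p.V ε L Lᶜ x * p.block (J \ L) Jᶜ ε (-1) x =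
      p.block J Jᶜ ε (signOf J L) x := by
    intro L hL
    have hLJ : L ⊆ J := (Finset.mem_Icc.1 hL).2
    have e1 : Lᶜ = (J \ L) ∪ Jᶜ := by
      ext j
      simp only [Finset.mem_compl, Finset.mem_union, Finset.mem_sdiff]
      constructor
      · intro hj; by_cases hjJ : j ∈ J <;> simp [hj, hjJ]
      · rintro (h | h)
        · exact h.2
        · exact fun hj => h (hLJ hj)
    rw [V_eq_block, e1, block_union (σ := signOf J L)]
    · rw [Finset.union_sdiff_of_subset hLJ]
    · exact Finset.disjoint_sdiff
    · rw [Finset.disjoint_left]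
      intro j hj hj'
      exact (Finset.mem_compl.1 hj') (Finset.mem_sdiff.1 hj).1
    · intro j hj; exact hε.1 j (Finset.mem_sdiff.1 hj).1
    · intro j hj; simp [signOf, hj]
    · intro j hj
      rw [Finset.mem_sdiff] at hj
      rw [signOf, if_neg hj.2, if_pos hj.1]
  have hIcc : Finset.Icc ∅ J = J.powerset := by
    ext L; simp [Finset.mem_Icc]
  have hins : Finset.Icc ∅ J = insert ∅ (Finset.Ioc ∅ J) :=
    (Finset.Ioc_insert_left (Finset.empty_subset J)).symm
  have hzero : ∑ L ∈ Finset.Icc ∅ J, p.block J Jᶜ ε (signOf J L) x = 0 := by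
    rw [hIcc, ← sum_signs_eq J (fun σ => p.block J Jᶜ ε σ x)]
    exact sum_block_eq_zero h hβ hJne hε.1 hx
  have hs0 : shift p.β (signVec ε ∅) x = shift p.β 0 x := by
    congr 1
  set g : Finset (Fin n) → ℂ := fun L => f (shift p.β (signVec ε L) x) - f (shift p.β 0 x) with hg
  have hg0 : g ∅ = 0 := by simp only [hg, hs0, sub_self]
  have hlhs : ∑ t ∈ Finset.range r, ∑ c ∈ chains (t + 1) J,
      ((-1) ^ t * p.chainCoeff ε c x * f (shift p.β (signVec ε (c 1)) x) -
        (-1) ^ t * p.chainCoeff ε c x * f (shift p.β 0 x)) =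
      ∑ L ∈ Finset.Ioc ∅ J, g L * p.block J Jᶜ ε (signOf J L) x := by
    have h1 : ∀ t ∈ Finset.range r, ∑ c ∈ chains (t + 1) J,
        ((-1) ^ t * p.chainCoeff ε c x * f (shift p.β (signVec ε (c 1)) x) -
        (-1) ^ t * p.chainCoeff ε c x * f (shift p.β 0 x)) =
        ∑ L ∈ Finset.Ioc ∅ J, g L * p.V ε L Lᶜ x *
          ((-1) ^ t * ∑ c ∈ chainsFrom t L J, p.chainCoeff ε c x) := by
      intro t _
      have h2 := sum_chainsFrom_succ (p := p) t ∅ J ε x g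
      rw [chains_eq]
      calc _ = (-1) ^ t * ∑ c ∈ chainsFrom (t + 1) ∅ J, p.chainCoeff ε c x * g (c 1) := by
            rw [Finset.mul_sum]
            refine Finset.sum_congr rfl fun c _ => ?_
            simp only [hg]; ring
        _ = _ := by
            rw [h2, Finset.mul_sum]
            refine Finset.sum_congr rfl fun L _ => ?_
            rw [Finset.sdiff_empty]; ring
    rw [Finset.sum_congr rfl h1, Finset.sum_comm]
    refine Finset.sum_congr rfl fun L hL => ?_
    rw [← Finset.mul_sum]
    have hL' := Finset.mem_Ioc.1 hL
    have hc : (J \ L).card < r := by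
      rw [← hJr]
      refine Finset.card_lt_card ?_
      refine Finset.sdiff_ssubset hL'.2 ?_
      have := hL'.1
      exact Finset.nonempty_iff_ne_empty.2 (Ne.symm this.ne)
    have := chainSum_eq h hβ hε.1 hx r L hL'.2 hc
    rw [chainSum] at this
    rw [this, mul_assoc, hstep L (Finset.Ioc_subset_Icc_self hL)]
  rw [hlhs]
  -- The set `L = ∅` never occurs as a first step, but it may be added since it translates nothing
  -- and `g ∅ = 0`. This completes the sum to all sign choices on `J`.
  have hfull : ∑ L ∈ Finset.Ioc ∅ J, g L * p.block J Jᶜ ε (signOf J L) x =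
      ∑ L ∈ Finset.Icc ∅ J, g L * p.block J Jᶜ ε (signOf J L) x := by
    rw [hins, Finset.sum_insert (by simp), hg0, zero_mul, zero_add]
  rw [hfull, sum_signs_eq, ← hIcc]
  calc _ = ∑ L ∈ Finset.Icc ∅ J, p.block J Jᶜ ε (signOf J L) x * f (p.move ε (signOf J L) x) -
        f (shift p.β 0 x) * ∑ L ∈ Finset.Icc ∅ J, p.block J Jᶜ ε (signOf J L) x := by
        rw [Finset.mul_sum, ← Finset.sum_sub_distrib]
        refine Finset.sum_congr rfl fun L hL => ?_
        rw [← hmove L hL]; simp only [hg]; ring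
    _ = _ := by rw [hzero, mul_zero, sub_zero]

end Params

end Koornwinder

end

noncomputable section

namespace Koornwinder

open Filter Topology

/-! ### The operators preserve invariant Laurent polynomials -/

theorem pairProd_subset {ι M : Type*} [LinearOrder ι] [CommMonoid M] [Fintype ι] (J : Finset ι)
    (h : ι → ι → M) :
    pairProd Finset.univ (fun j k => if j ∈ J ∧ k ∈ J then h j k else 1) = pairProd J h := by
  classical
  rw [pairProd, pairProd, ← Finset.prod_subset (Finset.subset_univ J)]
  · refine Finset.prod_congr rfl fun j hj => ?_
    rw [Finset.prod_filter, Finset.prod_filter, ← Finset.prod_subset (Finset.subset_univ J)]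
    · exact Finset.prod_congr rfl fun k hk => by simp [hj, hk]
    · intro k _ hk; simp [hk]
  · intro j _ hj; simp [hj]

namespace Params

variable {p : Params} {n : ℕ}

/-- The pair factor of a coefficient that does not involve the second set of signs. -/
def outerFac (p : Params) (J : Finset (Fin n)) (ε : Fin n → ℤ) (x : Fin n → ℂ) (j k : Fin n) : ℂ :=
  if j ∈ J then
    if k ∈ J then p.va (ε j * x j + ε k * x k)
    else p.va (ε j * x j + x k) * p.va (ε j * x j - x k)
  else if k ∈ J then p.va (ε k * x k + x j) * p.va (ε k * x k - x j)
  else 1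

theorem outerFac_comm (J : Finset (Fin n)) (ε : Fin n → ℤ) (x : Fin n → ℂ) (j k : Fin n) :
    p.outerFac J ε x j k = p.outerFac J ε x k j := by
  rw [outerFac, outerFac]
  by_cases hj : j ∈ J <;> by_cases hk : k ∈ J <;> simp [hj, hk, add_comm]

/-- The pair factor of a coefficient that involves both sets of signs. -/
def innerFac (p : Params) (ε σ : Fin n → ℤ) (x : Fin n → ℂ) (j k : Fin n) : ℂ :=
  p.va (σ j * (ε j * x j + p.γ) + σ k * (ε k * x k + p.γ))

theorem pairProd_outerFac (J : Finset (Fin n)) (ε : Fin n → ℤ) (x : Fin n → ℂ) :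
    pairProd Finset.univ (p.outerFac J ε x) =
      pairProd J (fun j k => p.va (ε j * x j + ε k * x k)) *
      ∏ j ∈ J, ∏ k ∈ Jᶜ, p.va (ε j * x j + x k) * p.va (ε j * x j - x k) := by
  rw [← Finset.union_compl J, pairProd_union disjoint_compl_right (outerFac_comm J ε x)]
  have h1 : pairProd Jᶜ (p.outerFac J ε x) = 1 := by
    refine Finset.prod_eq_one fun j hj => Finset.prod_eq_one fun k hk => ?_
    rw [Finset.mem_filter] at hk
    rw [outerFac, if_neg (Finset.mem_compl.1 hj), if_neg (Finset.mem_compl.1 hk.1)]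
  rw [h1, mul_one]
  congr 1
  · refine pairProd_congr fun j hj k hk _ => ?_
    rw [outerFac, if_pos hj, if_pos hk]
  · refine Finset.prod_congr rfl fun j hj => Finset.prod_congr rfl fun k hk => ?_
    rw [outerFac, if_pos hj, if_neg (Finset.mem_compl.1 hk)]

/-- Separates the factors that depend on `ε` alone from those that depend on `σ`; the latter are
what `innerSum` sums up. -/
theorem block_eq_outer (J : Finset (Fin n)) (ε σ : Fin n → ℤ) (x : Fin n → ℂ) :
    p.block J Jᶜ ε σ x = (∏ j ∈ J, p.vb (ε j * x j)) * pairProd Finset.univ (p.outerFac J ε x) *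
      ((∏ j ∈ J, (σ j : ℂ)) * pairProd J (p.innerFac ε σ x)) := by
  rw [block, pairProd_mul, pairProd_outerFac, Finset.prod_mul_distrib]
  unfold innerFac
  ring

theorem block_perm (J : Finset (Fin n)) (ε σ : Fin n → ℤ) (x : Fin n → ℂ)
    (π : Equiv.Perm (Fin n)) :
    p.block J Jᶜ (fun j => ε (π j)) (fun j => σ (π j)) (fun j => x (π j)) =
      p.block (J.map π.toEmbedding) (J.map π.toEmbedding)ᶜ ε σ x := by
  have hc : (J.map π.toEmbedding)ᶜ = Jᶜ.map π.toEmbedding := by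
    ext j; simp
  rw [block, block, hc, pairProd_map π (fun j k => by
    rw [add_comm ((ε j : ℂ) * x j), add_comm ((σ j : ℂ) * _)])]
  simp only [Finset.prod_map]
  rfl

/-- The flip of an index in `J` is absorbed in `ε`; for an index in `R` the product `va (u + z) * va
(u - z)` is even in `z`. -/
theorem block_flip (J R : Finset (Fin n)) (ε σ : Fin n → ℤ) (x : Fin n → ℂ) {η : Fin n → ℤ}
    (hη : ∀ j, η j = 1 ∨ η j = -1) :
    p.block J R ε σ (fun j => η j * x j) = p.block J R (fun j => η j * ε j) σ x := by
  have hc : ∀ j, (ε j : ℂ) * (η j * x j) = ((η j * ε j : ℤ) : ℂ) * x j := by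
    intro j; push_cast; ring
  rw [block, block]
  simp only [hc]
  congr 1
  refine Finset.prod_congr rfl fun j _ => Finset.prod_congr rfl fun k _ => ?_
  rw [← va_mul_signed (hη k)]

theorem closedOp_weylInvariant {f : (Fin n → ℂ) → ℂ} (hf : WeylInvariant f) (r : ℕ) :
    WeylInvariant (p.closedOp r f) where
  perm π x := by
    rw [closedOp, closedOp]
    have h1 : ∀ g : Finset (Fin n) → ℂ, ∑ J : Finset (Fin n) with J.card = r, g J =
        ∑ J : Finset (Fin n) with J.card = r, g (J.map π.toEmbedding) := by
      intro g
      symm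
      refine Finset.sum_nbij' (fun J => J.map π.toEmbedding) (fun J => J.map π.symm.toEmbedding)
        ?_ ?_ ?_ ?_ (fun _ _ => rfl)
      · intro J hJ; simpa using hJ
      · intro J hJ; simpa using hJ
      · intro J _; ext j; simp
      · intro J _; ext j; simp
    rw [h1 (fun J => ∑ ε ∈ signs J, ∑ σ ∈ signs J,
      p.block J Jᶜ ε σ x * f (p.move ε σ x))]
    refine Finset.sum_congr rfl fun J _ => ?_
    rw [← sum_signs_perm J π]
    refine Finset.sum_congr rfl fun ε _ => ?_
    rw [← sum_signs_perm J π]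
    refine Finset.sum_congr rfl fun σ _ => ?_
    rw [block_perm, ← hf.perm π (p.move ε σ x)]
    rfl
  flip η hη x := by
    rw [closedOp, closedOp]
    refine Finset.sum_congr rfl fun J _ => ?_
    rw [← sum_signs_mul J hη (fun ε => ∑ σ ∈ signs J, p.block J Jᶜ ε σ x * f (p.move ε σ x))]
    refine Finset.sum_congr rfl fun ε _ => Finset.sum_congr rfl fun σ _ => ?_
    rw [block_flip J _ ε σ x hη, ← hf.flip η hη (p.move (fun j => η j * ε j) σ x)]
    congr 2
    funext j
    simp only [move]
    rcases hη j with h | h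
    · simp [h]
    · simp [h]; ring

/-- Flipping the coordinates in `J` of the translated point by `ε_j σ_j` gives `σ_j (ε_j x_j + γ) +
γ`. By invariance of `f` the sum over `σ` is therefore the inner sum at the point with coordinates
`ε_j x_j + γ` on `J`. -/
theorem closedOp_eq {f : (Fin n → ℂ) → ℂ} (hf : WeylInvariant f) (r : ℕ) (x : Fin n → ℂ) :
    p.closedOp r f x = ∑ J : Finset (Fin n) with J.card = r, ∑ ε ∈ signs J,
      (∏ j ∈ J, p.vb (ε j * x j)) * pairProd Finset.univ (p.outerFac J ε x) *
        p.innerSum J f (fun j => if j ∈ J then ε j * x j + p.γ else x j) := by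
  rw [closedOp]
  refine Finset.sum_congr rfl fun J _ => Finset.sum_congr rfl fun ε hε => ?_
  rw [innerSum, Finset.mul_sum]
  refine Finset.sum_congr rfl fun σ hσ => ?_
  rw [mem_signs] at hε hσ
  rw [block_eq_outer, mul_assoc]
  congr 2
  · congr 1
    refine pairProd_congr fun j hj k hk _ => ?_
    simp [innerFac, hj, hk]
  · rw [← hf.flip (fun j => if j ∈ J then ε j * σ j else 1) (fun j => ?_)]
    · congr 1
      funext j
      simp only [move]
      by_cases hj : j ∈ J
      · rcases hε.1 j hj with h | h <;> rcases hσ.1 j hj with h' | h' <;> simp [hj, h, h'] <;> ring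
      · simp [hj, hε.2 j hj]
    · by_cases hj : j ∈ J
      · rcases hε.1 j hj with h | h <;> rcases hσ.1 j hj with h' | h' <;> simp [hj, h, h']
      · simp [hj]

theorem cs_signed {s : ℤ} (hs : s = 1 ∨ s = -1) (z : ℂ) : p.cs (s * z) = p.cs z := by
  rcases hs with rfl | rfl <;> simp [cs_neg]

theorem IsLaurent.cs_mul_va_va {j k : Fin n} (hjk : j ≠ k) {ε : ℤ} (hε : ε = 1 ∨ ε = -1) :
    p.IsLaurent (fun x => (p.cs (x j) - p.cs (x k)) *
      (p.va (ε * x j + x k) * p.va (ε * x j - x k))) := by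
  have h1 := ((E_pair (p := p) j k ε 1 p.μ).sub (const 1)).mul
    (((E_pair (p := p) j k ε (-1) p.μ).sub (const 1)).mul (E_coord (p := p) j (-ε) 0))
  refine (h1.const_mul (p.phase p.μ * p.phase p.μ / 2)).congr fun x hx => ?_
  have hne := hx.pair_ne hjk 0 hε (Or.inl rfl)
  have hne' := hx.pair_ne hjk 0 hε (Or.inr rfl)
  simp only [Int.cast_zero, zero_mul, add_zero, Int.cast_one, one_mul, Int.cast_neg, neg_mul,
    ← sub_eq_add_neg] at hne hne'
  rw [← cs_signed hε (x j), cs_sub, va_eq, va_eq]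
  have e1 : (ε : ℂ) * x j + ((1 : ℤ) : ℂ) * x k + p.μ = p.μ + (ε * x j + x k) := by
    push_cast; ring
  have e2 : (ε : ℂ) * x j + ((-1 : ℤ) : ℂ) * x k + p.μ = p.μ + (ε * x j - x k) := by
    push_cast; ring
  have e3 : ((-ε : ℤ) : ℂ) * x j + 0 = -(ε * x j) := by push_cast; ring
  rw [e1, e2, e3, E_neg]
  have h0 := sub_ne_zero.2 hne
  have h0' := sub_ne_zero.2 hne'
  have h2 := p.E_ne_zero (ε * x j)
  field_simp

theorem sn_eq_mul (z : ℂ) : p.sn z = -(Complex.I / 2) * p.E (-z) * ((p.E z - 1) * (p.E z + 1)) := by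
  rw [sn_eq, E_neg]
  have := p.E_ne_zero z
  field_simp
  ring

theorem cancel_four {a₁ a₂ a₃ a₄ : ℂ} (h₁ : a₁ ≠ 0) (h₂ : a₂ ≠ 0) (h₃ : a₃ ≠ 0) (h₄ : a₄ ≠ 0)
    (s i g₁ g₂ ph N₁ N₂ N₃ N₄ : ℂ) :
    s * (-i * g₁ * (a₁ * a₂)) * (ph * (N₁ / a₁ * (N₂ / a₂) * (N₃ / a₃) * (N₄ / a₄)) *
      (-i * g₂ * (a₃ * a₄))) = s * i ^ 2 * ph * (N₁ * N₂ * (N₃ * N₄) * (g₁ * g₂)) := by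
  field_simp

/-- The sine and cosine in the denominator at `z = ε x_j` combine to the double angle sine `sn z`,
and those at `γ + z` to `sn (z + γ)`. Thus the two sines clear all four denominators of `vb`. -/
theorem IsLaurent.sn_mul_vb (j : Fin n) {ε : ℤ} (hε : ε = 1 ∨ ε = -1) :
    p.IsLaurent (fun x => p.sn (x j) * (p.vb (ε * x j) * p.sn (ε * x j + p.γ))) := by
  have h1 := (((E_coord (p := p) j ε p.μ₀).sub (const 1)).mul
    ((E_coord (p := p) j ε p.μ₁).add (const 1))).mul
    (((E_coord (p := p) j ε (p.μ₀' + p.γ)).sub (const 1)).mul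
    ((E_coord (p := p) j ε (p.μ₁' + p.γ)).add (const 1)))
  have h2 := h1.mul ((E_coord (p := p) j (-ε) 0).mul (E_coord (p := p) j (-ε) (-p.γ)))
  refine (h2.const_mul (ε * (Complex.I / 2) ^ 2 *
    (p.phase p.μ₀ * p.phase p.μ₁ * p.phase p.μ₀' * p.phase p.μ₁'))).congr fun x hx => ?_
  have hn := hx.signed_ne (j := j) 0 hε
  have hn' := hx.signed_ne (j := j) 1 hε
  simp only [Int.cast_zero, zero_mul, add_zero, Int.cast_one, one_mul] at hn hn'
  have hs : p.sn (x j) = ε * p.sn (ε * x j) := by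
    rcases hε with rfl | rfl <;> simp [sn_neg]
  set z : ℂ := ε * x j with hz
  have e1 : z + p.μ₀ = p.μ₀ + z := by ring
  have e2 : z + p.μ₁ = p.μ₁ + z := by ring
  have e3 : z + (p.μ₀' + p.γ) = p.μ₀' + (p.γ + z) := by ring
  have e4 : z + (p.μ₁' + p.γ) = p.μ₁' + (p.γ + z) := by ring
  have e5 : ((-ε : ℤ) : ℂ) * x j + 0 = -z := by rw [hz]; push_cast; ring
  have e6 : ((-ε : ℤ) : ℂ) * x j + -p.γ = -(p.γ + z) := by rw [hz]; push_cast; ring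
  rw [e1, e2, e3, e4, e5, e6, hs, vb_eq, sn_eq_mul, add_comm z p.γ, sn_eq_mul]
  rw [add_comm z p.γ] at hn'
  have a1 : p.E z - 1 ≠ 0 := fun h => hn (by rw [sub_eq_zero.1 h]; norm_num)
  have a2 : p.E z + 1 ≠ 0 := fun h => hn (by rw [eq_neg_of_add_eq_zero_left h]; norm_num)
  have a3 : p.E (p.γ + z) - 1 ≠ 0 := fun h => hn' (by rw [sub_eq_zero.1 h]; norm_num)
  have a4 : p.E (p.γ + z) + 1 ≠ 0 := fun h => hn' (by rw [eq_neg_of_add_eq_zero_left h]; norm_num)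
  exact cancel_four a1 a2 a3 a4 _ _ _ _ _ _ _ _ _

/-- The operators preserve the Weyl invariant Laurent polynomials. -/
theorem closedOp_isLaurent {c : (Fin n → ℤ) →₀ ℂ} (hf : WeylInvariant (p.ev c)) (r : ℕ) :
    p.IsLaurent (p.closedOp r (p.ev c)) := by
  have hW := closedOp_weylInvariant (p := p) hf r
  refine isLaurent_of_invariant Finset.univ (fun π _ x _ => hW.perm π x)
    (fun η hη _ x _ => hW.flip η hη x) ?_
  have key : p.IsLaurent (fun x : Fin n → ℂ => ∑ J : Finset (Fin n) with J.card = r,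
      ∑ ε ∈ signs J, p.weylDen Finset.univ x *
      ((∏ j ∈ J, p.vb (ε j * x j)) * pairProd Finset.univ (p.outerFac J ε x) *
        p.innerSum J (p.ev c) (fun j => if j ∈ J then ε j * x j + p.γ else x j))) := by
    refine IsLaurent.sum fun J _ => IsLaurent.sum fun ε hε => ?_
    rw [mem_signs] at hε
    have hsign : ∀ j, (if j ∈ J then ε j else 1) = 1 ∨ (if j ∈ J then ε j else 1) = -1 := by
      intro j
      split_ifs with hj
      · exact hε.1 j hj
      · exact Or.inl rfl
    have hy : ∀ x : Fin n → ℂ, (fun j => if j ∈ J then ε j * x j + p.γ else x j) =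
        fun j => ((if j ∈ J then ε j else 1 : ℤ) : ℂ) * x ((1 : Equiv.Perm (Fin n)) j) +
          ((if j ∈ J then 1 else 0 : ℤ) : ℂ) * p.γ := by
      intro x; funext j; split_ifs <;> simp
    -- The poles of `vb` off the mirrors, at the zeros of `sn (ε_j x_j + γ)`, are compensated by the
    -- divisibility of the inner sum by these sines. The poles left in `vb` and in the outer factors
    -- lie on mirrors and are cancelled by `weylDen`.
    have h1 : p.IsLaurent (fun x : Fin n → ℂ => p.innerSum J (p.ev c)
        (fun j => if j ∈ J then ε j * x j + p.γ else x j) / ∏ j ∈ J, p.sn (ε j * x j + p.γ)) := by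
      refine ((innerSum_div_isLaurent (p := p) hf.perm J).comp_affine 1
        (fun j => if j ∈ J then ε j else 1) (fun j => if j ∈ J then 1 else 0) hsign).congr
        fun x _ => ?_
      rw [hy x]
      congr 1
      exact Finset.prod_congr rfl fun j hj => by simp [hj]
    have h2 : p.IsLaurent (fun x : Fin n → ℂ => ∏ j, (p.sn (x j) *
        if j ∈ J then p.vb (ε j * x j) * p.sn (ε j * x j + p.γ) else 1)) := by
      refine IsLaurent.prod fun j _ => ?_
      by_cases hj : j ∈ J
      · simpa [hj] using IsLaurent.sn_mul_vb (p := p) j (hε.1 j hj)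
      · simpa [hj] using IsLaurent.sn (p := p) j 1 0
    have h3 : p.IsLaurent (fun x : Fin n → ℂ => pairProd Finset.univ
        (fun j k => (p.cs (x k) - p.cs (x j)) * p.outerFac J ε x j k)) := by
      refine IsLaurent.pairProd fun j _ k _ hjk => ?_
      by_cases hj : j ∈ J
      · by_cases hk : k ∈ J
        · simpa [outerFac, hj, hk] using
            IsLaurent.cs_mul_va (p := p) hjk.ne (hε.1 j hj) (hε.1 k hk)
        · refine (IsLaurent.cs_mul_va_va (p := p) hjk.ne (hε.1 j hj)).neg.congr fun x _ => ?_
          simp [outerFac, hj, hk]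
          ring
      · by_cases hk : k ∈ J
        · simpa [outerFac, hj, hk] using
            IsLaurent.cs_mul_va_va (p := p) hjk.ne' (hε.1 k hk)
        · simpa [outerFac, hj, hk] using
            (IsLaurent.cs (p := p) k 1 0).sub (IsLaurent.cs (p := p) j 1 0)
    refine ((h2.mul h3).mul h1).congr fun x hx => ?_
    have hg := hx.affine 1 (fun j => if j ∈ J then ε j else 1) (fun j => if j ∈ J then 1 else 0)
      hsign
    rw [← hy] at hg
    have hsn : ∏ j ∈ J, p.sn (ε j * x j + p.γ) ≠ 0 :=
      Finset.prod_ne_zero_iff.2 fun j hj => by simpa [hj] using hg.sn_ne j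
    have hprod : ∏ j, (if j ∈ J then p.vb (ε j * x j) * p.sn (ε j * x j + p.γ) else 1) =
        ∏ j ∈ J, p.vb (ε j * x j) * p.sn (ε j * x j + p.γ) := by
      rw [Finset.prod_ite_mem, Finset.univ_inter]
    rw [weylDen, Finset.prod_mul_distrib, hprod, Finset.prod_mul_distrib, pairProd_mul]
    field_simp
  refine key.congr fun x _ => ?_
  rw [closedOp_eq hf, Finset.mul_sum]
  simp only [Finset.mul_sum]

/-- The Laurent polynomial is tied to `f` only at generic points, but both sides of the invariance
are continuous and generic points are dense. -/
theorem weylInvariant_ev_of_generic (h : 0 < p.α) {c : (Fin n → ℤ) →₀ ℂ} {f : (Fin n → ℂ) → ℂ}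
    (hf : WeylInvariant f) (hc : ∀ x, p.Generic x → f x = p.ev c x) : WeylInvariant (p.ev c) where
  perm π x := by
    refine sub_eq_zero.1 (eq_zero_of_generic (φ := fun x : Fin n → ℂ =>
      p.ev c (fun j => x (π j)) - p.ev c x) h ?_ fun y hy => ?_)
    · exact (((p.continuous_ev c).comp (by fun_prop)).sub (p.continuous_ev c)).continuousAt
    · have hg := hy.affine π (fun _ => 1) 0 (fun _ => Or.inl rfl)
      simp only [Int.cast_one, one_mul, Pi.zero_apply, Int.cast_zero, zero_mul, add_zero] at hg
      rw [← hc _ hg, ← hc _ hy, hf.perm, sub_self]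
  flip η hη x := by
    refine sub_eq_zero.1 (eq_zero_of_generic (φ := fun x : Fin n → ℂ =>
      p.ev c (fun j => η j * x j) - p.ev c x) h ?_ fun y hy => ?_)
    · exact (((p.continuous_ev c).comp (by fun_prop)).sub (p.continuous_ev c)).continuousAt
    · have hg := hy.affine 1 η 0 hη
      simp only [Pi.zero_apply, Int.cast_zero, zero_mul, add_zero, Equiv.Perm.coe_one, id] at hg
      rw [← hc _ hg, ← hc _ hy, hf.flip η hη, sub_self]

theorem exists_ev_closedOp (h : 0 < p.α) {c : (Fin n → ℤ) →₀ ℂ} (hf : WeylInvariant (p.ev c))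
    (r : ℕ) : ∃ d : (Fin n → ℤ) →₀ ℂ, WeylInvariant (p.ev d) ∧
      ∀ x, p.Generic x → p.closedOp r (p.ev c) x = p.ev d x := by
  obtain ⟨d, hd⟩ := isLaurent_iff.1 (closedOp_isLaurent (p := p) hf r)
  exact ⟨d, weylInvariant_ev_of_generic h (closedOp_weylInvariant hf r) hd, hd⟩

/-! ### Leading terms: the commutator lowers degrees -/

theorem block_hasRayLimit (h : 0 < p.α) {v : Fin n → ℤ} (hv : RegularDir v) {J : Finset (Fin n)}
    {ε σ : Fin n → ℤ} (hε : ε ∈ signs J) (hσ : σ ∈ signs J) :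
    ∃ L, HasRayLimit v (p.block J Jᶜ ε σ) L := by
  rw [mem_signs] at hε hσ
  have hm : ∀ {a b : ℤ}, (a = 1 ∨ a = -1) → (b = 1 ∨ b = -1) → (a * b = 1 ∨ a * b = -1) := by
    rintro a b (rfl | rfl) (rfl | rfl) <;> simp
  have h1 : ∃ L, HasRayLimit v (fun x => ∏ j ∈ J, (σ j : ℂ) * p.vb (ε j * x j)) L := by
    refine HasRayLimit.prod fun j hj => ?_
    obtain ⟨L, hL⟩ := HasRayLimit.vb_coord (p := p) h hv j (hε.1 j hj)
    exact ⟨_, (HasRayLimit.const _).mul hL⟩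
  have h2 : ∃ L, HasRayLimit v (fun x => pairProd J (fun j k => p.va (ε j * x j + ε k * x k) *
      p.va (σ j * (ε j * x j + p.γ) + σ k * (ε k * x k + p.γ)))) L := by
    refine HasRayLimit.prod fun j hj => HasRayLimit.prod fun k hk => ?_
    rw [Finset.mem_filter] at hk
    obtain ⟨L, hL⟩ := HasRayLimit.va_pair (p := p) h hv hk.2.ne (hε.1 j hj) (hε.1 k hk.1) 0
    obtain ⟨M, hM⟩ := HasRayLimit.va_pair (p := p) h hv hk.2.ne (hm (hσ.1 j hj) (hε.1 j hj))
      (hm (hσ.1 k hk.1) (hε.1 k hk.1)) (σ j * p.γ + σ k * p.γ)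
    exact ⟨_, (hL.mul hM).congr fun x => congrArg₂ (· * ·)
      (congrArg p.va (by ring)) (congrArg p.va (by push_cast; ring))⟩
  have h3 : ∃ L, HasRayLimit v (fun x => ∏ j ∈ J, ∏ k ∈ Jᶜ,
      p.va (ε j * x j + x k) * p.va (ε j * x j - x k)) L := by
    refine HasRayLimit.prod fun j hj => HasRayLimit.prod fun k hk => ?_
    have hjk : j ≠ k := by
      rintro rfl
      exact Finset.mem_compl.1 hk hj
    obtain ⟨L, hL⟩ := HasRayLimit.va_pair (p := p) h hv hjk (hε.1 j hj) (Or.inl rfl) 0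
    obtain ⟨M, hM⟩ := HasRayLimit.va_pair (p := p) h hv hjk (hε.1 j hj) (Or.inr rfl) 0
    exact ⟨_, (hL.mul hM).congr fun x => congrArg₂ (· * ·)
      (congrArg p.va (by push_cast; ring)) (congrArg p.va (by push_cast; ring))⟩
  obtain ⟨L₁, h1⟩ := h1
  obtain ⟨L₂, h2⟩ := h2
  obtain ⟨L₃, h3⟩ := h3
  exact ⟨_, (h1.mul h2).mul h3⟩

/-- The index set of the terms of the operator of order `r`: a set `J` of size `r` and two
families of signs on `J`. -/
def terms (n r : ℕ) : Finset ((_ : Finset (Fin n)) × (Fin n → ℤ) × (Fin n → ℤ)) :=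
  (Finset.univ.filter fun J => J.card = r).sigma fun J => signs J ×ˢ signs J

theorem closedOp_eq_terms (r : ℕ) (f : (Fin n → ℂ) → ℂ) (x : Fin n → ℂ) :
    p.closedOp r f x = ∑ i ∈ terms n r,
      p.block i.1 i.1ᶜ i.2.1 i.2.2 x * f (p.move i.2.1 i.2.2 x) := by
  rw [closedOp, terms, Finset.sum_sigma]
  refine Finset.sum_congr rfl fun J _ => ?_
  rw [Finset.sum_product]

theorem move_generic {x : Fin n → ℂ} (hx : p.Generic x) (ε σ : Fin n → ℤ) :
    p.Generic (p.move ε σ x) := by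
  have := hx.affine 1 (fun _ => 1) (fun j => ε j + ε j * σ j) (fun _ => Or.inl rfl)
  convert this using 1
  funext j
  simp [move]

/-- Translates of generic points are generic, so an operator evaluated at generic points sees `f`
only at such points. -/
theorem closedOp_congr {r : ℕ} {f g : (Fin n → ℂ) → ℂ} (hfg : ∀ y, p.Generic y → f y = g y)
    {x : Fin n → ℂ} (hx : p.Generic x) : p.closedOp r f x = p.closedOp r g x := by
  simp only [closedOp_eq_terms]
  exact Finset.sum_congr rfl fun i _ => by rw [hfg _ (move_generic hx _ _)]

theorem move_ray (ε σ v : Fin n → ℤ) (x : Fin n → ℂ) (y : ℝ) :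
    p.move ε σ (ray v x y) = ray v (p.move ε σ x) y := by
  funext j; simp only [move, ray]; ring

theorem move_comm (ε σ ε' σ' : Fin n → ℤ) (x : Fin n → ℂ) :
    p.move ε σ (p.move ε' σ' x) = p.move ε' σ' (p.move ε σ x) := by
  funext j; simp only [move]; ring

/-- The commutator of two of the operators, acting on a function. -/
def bracket (p : Params) (r s : ℕ) (f : (Fin n → ℂ) → ℂ) (x : Fin n → ℂ) : ℂ :=
  p.closedOp r (p.closedOp s f) x - p.closedOp s (p.closedOp r f) x

theorem closedOp_closedOp (r s : ℕ) (f : (Fin n → ℂ) → ℂ) (x : Fin n → ℂ) :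
    p.closedOp r (p.closedOp s f) x = ∑ i ∈ terms n r, ∑ j ∈ terms n s,
      p.block i.1 i.1ᶜ i.2.1 i.2.2 x * p.block j.1 j.1ᶜ j.2.1 j.2.2 (p.move i.2.1 i.2.2 x) *
        f (p.move j.2.1 j.2.2 (p.move i.2.1 i.2.2 x)) := by
  rw [closedOp_eq_terms]
  refine Finset.sum_congr rfl fun i _ => ?_
  rw [closedOp_eq_terms, Finset.mul_sum]
  exact Finset.sum_congr rfl fun j _ => by ring

/-- The commutator lowers the degree of Laurent polynomials. -/
theorem bracket_lowers (h : 0 < p.α) (hβ : 0 < p.β) {v : Fin n → ℤ} (hv : RegularDir v) {D : ℤ}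
    {c d : (Fin n → ℤ) →₀ ℂ} (hc : ∀ k ∈ c.support, dot v k ≤ D) {r s : ℕ}
    (hd : ∀ x, p.Generic x → p.bracket r s (p.ev c) x = p.ev d x) :
    ∀ k ∈ d.support, dot v k < D := by
  have hlim : ∀ (r : ℕ) (i : (_ : Finset (Fin n)) × (Fin n → ℤ) × (Fin n → ℤ)), ∃ L,
      i ∈ terms n r → HasRayLimit v (p.block i.1 i.1ᶜ i.2.1 i.2.2) L := by
    intro r i
    by_cases hi : i ∈ terms n r
    · rw [terms, Finset.mem_sigma, Finset.mem_product] at hi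
      obtain ⟨L, hL⟩ := block_hasRayLimit (p := p) h hv hi.2.1 hi.2.2
      exact ⟨L, fun _ => hL⟩
    · exact ⟨0, fun h => absurd h hi⟩
  choose L hL using hlim
  set T := p.ev (c.filter fun k => dot v k = D) with hT
  have htop : ∀ (r s : ℕ) (x : Fin n → ℂ), Tendsto (fun y : ℝ =>
      ((Real.exp (2 * p.α * y * (-D : ℤ)) : ℝ) : ℂ) *
        p.closedOp r (p.closedOp s (p.ev c)) (ray v x y)) atTop
      (𝓝 (∑ i ∈ terms n r, ∑ j ∈ terms n s, L r i * L s j *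
        T (p.move j.2.1 j.2.2 (p.move i.2.1 i.2.2 x)))) := by
    intro r s x
    have : ∀ y : ℝ, ∑ i ∈ terms n r, ∑ j ∈ terms n s,
        p.block i.1 i.1ᶜ i.2.1 i.2.2 (ray v x y) *
        p.block j.1 j.1ᶜ j.2.1 j.2.2 (ray v (p.move i.2.1 i.2.2 x) y) *
        (((Real.exp (2 * p.α * y * (-D : ℤ)) : ℝ) : ℂ) *
          p.ev c (ray v (p.move j.2.1 j.2.2 (p.move i.2.1 i.2.2 x)) y)) =
        ((Real.exp (2 * p.α * y * (-D : ℤ)) : ℝ) : ℂ) *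
        p.closedOp r (p.closedOp s (p.ev c)) (ray v x y) := by
      intro y
      rw [closedOp_closedOp, Finset.mul_sum]
      refine Finset.sum_congr rfl fun i _ => ?_
      rw [Finset.mul_sum]
      refine Finset.sum_congr rfl fun j _ => ?_
      rw [move_ray, move_ray]; ring
    refine Tendsto.congr this ?_
    refine tendsto_finsetSum _ fun i hi => tendsto_finsetSum _ fun j hj => ?_
    exact ((hL r i hi x).mul (hL s j hj _)).mul (tendsto_ev h hc _)
  intro k hk
  by_contra hlt
  refine (Finsupp.mem_support_iff.1 hk) (coeff_eq_zero_of_tendsto (v := v) (d := D) h hβ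
    (fun x hx => ?_) k (not_lt.1 hlt))
  have h1 := ((htop r s x).sub (htop s r x)).comp (tendsto_mul_natCast hβ)
  -- In the limit the coefficients are constants and only the top degree part `T` remains. The two
  -- orders of composition then agree, because translations commute.
  have h0 : ∑ i ∈ terms n r, ∑ j ∈ terms n s, L r i * L s j *
        T (p.move j.2.1 j.2.2 (p.move i.2.1 i.2.2 x)) -
      ∑ i ∈ terms n s, ∑ j ∈ terms n r, L s i * L r j *
        T (p.move j.2.1 j.2.2 (p.move i.2.1 i.2.2 x)) = 0 := by
    rw [sub_eq_zero, Finset.sum_comm]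
    refine Finset.sum_congr rfl fun i _ => Finset.sum_congr rfl fun j _ => ?_
    rw [move_comm, mul_comm (L r j)]
  rw [h0] at h1
  refine h1.congr fun N => ?_
  rw [← hd _ (hx.ray v N), bracket, mul_sub]
  rfl

/-! ### The weight for integral couplings -/

/-- Natural numbers that represent the coupling constants. -/
structure NatCouplings (p : Params) where
  a : ℕ
  a₀ : ℕ
  a₁ : ℕ
  a₀' : ℕ
  a₁' : ℕ
  hg : p.g = (a + 1 : ℕ)
  hg₀ : p.g₀ = a₀
  hg₁ : p.g₁ = a₁
  hg₀' : p.g₀' = a₀'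
  hg₁' : p.g₁' = a₁'

/-- A finite `q`-shifted factorial. Translating it by `2γ` removes the first factor and appends a
new last one, so it solves the difference equations attached to the quotients in `v_a` and `v_b`
when the coupling is the integer `a`. -/
def risingProd (p : Params) (s : ℂ) (a : ℕ) (z : ℂ) : ℂ :=
  ∏ m ∈ Finset.range a, (p.E (z + m * (2 * p.γ)) + s)

theorem risingProd_shift (s : ℂ) (a : ℕ) (z : ℂ) :
    p.risingProd s a z * (p.E (a * (2 * p.γ) + z) + s) =
      (p.E z + s) * p.risingProd s a (z + 2 * p.γ) := by
  have h1 := Finset.prod_range_succ (fun m : ℕ => p.E (z + m * (2 * p.γ)) + s) a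
  have h2 := Finset.prod_range_succ' (fun m : ℕ => p.E (z + m * (2 * p.γ)) + s) a
  rw [risingProd, risingProd, add_comm _ z, ← h1, h2, mul_comm]
  congr 1
  · simp
  · refine Finset.prod_congr rfl fun m _ => ?_
    congr 2; push_cast; ring

theorem risingProd_ratio {s z μ : ℂ} {a : ℕ} (hμ : μ = a * (2 * p.γ)) (hz : p.E z + s ≠ 0) :
    (p.E (μ + z) + s) / (p.E z + s) * p.risingProd s a z = p.risingProd s a (z + 2 * p.γ) := by
  have := p.risingProd_shift s a z
  rw [hμ, div_mul_eq_mul_div, div_eq_iff hz, mul_comm, this, mul_comm]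

/-- Since `γ` is purely imaginary and `s` is real, conjugation leaves the steps of the product
unchanged and only replaces `z` by `-conj z`. -/
theorem risingProd_conj (s : ℝ) (a : ℕ) (z : ℂ) :
    (starRingEnd ℂ) (p.risingProd s a z) = p.risingProd s a (-(starRingEnd ℂ) z) := by
  rw [risingProd, risingProd, map_prod]
  refine Finset.prod_congr rfl fun m _ => ?_
  rw [map_add, Complex.conj_ofReal, E, E, ← Complex.exp_conj]
  congr 2
  simp only [map_mul, map_add, γ, map_div₀, Complex.conj_I, Complex.conj_ofReal, map_natCast,
    map_ofNat]
  ring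

theorem IsLaurent.risingProd_pair (s : ℂ) (a : ℕ) (j k : Fin n) (ε ε' : ℤ) (w : ℂ) :
    p.IsLaurent (fun x => p.risingProd s a (ε * x j + ε' * x k + w)) :=
  IsLaurent.prod fun m _ => ((E_pair (p := p) j k ε ε' (w + m * (2 * p.γ))).add (const s)).congr
    fun x _ => by rw [← add_assoc]

theorem IsLaurent.risingProd_coord (s : ℂ) (a : ℕ) (j : Fin n) (ε : ℤ) (w : ℂ) :
    p.IsLaurent (fun x => p.risingProd s a (ε * x j + w)) :=
  IsLaurent.prod fun m _ => ((E_coord (p := p) j ε (w + m * (2 * p.γ))).add (const s)).congr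
    fun x _ => by rw [← add_assoc]

namespace NatCouplings

variable (q : NatCouplings p)

/-- Solution of the difference equation of `v_a`. -/
def wa (z : ℂ) : ℂ := p.risingProd (-1) (q.a + 1) z

/-- Solution of the difference equation of `v_b`. -/
def wb (z : ℂ) : ℂ :=
  p.risingProd (-1) q.a₀ z * p.risingProd 1 q.a₁ z * p.risingProd (-1) q.a₀' (p.γ + z) *
    p.risingProd 1 q.a₁' (p.γ + z)

theorem va_mul_wa {z : ℂ} (hz : p.E z ≠ 1) :
    p.va z * q.wa z = p.phase p.μ * q.wa (z + 2 * p.γ) := by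
  have hμ : p.μ = (q.a + 1 : ℕ) * (2 * p.γ) := by
    rw [μ, γ, q.hg]; push_cast; ring
  rw [va_eq, wa, wa, mul_assoc, ← risingProd_ratio hμ (by rwa [← sub_eq_add_neg, sub_ne_zero])]
  simp only [sub_eq_add_neg]

/-- The phase of `v_b`. -/
def phaseB (p : Params) : ℂ := p.phase p.μ₀ * p.phase p.μ₁ * p.phase p.μ₀' * p.phase p.μ₁'

theorem vb_mul_wb {z : ℂ} (hz : p.E z ^ 2 ≠ 1) (hz' : p.E (p.γ + z) ^ 2 ≠ 1) :
    p.vb z * q.wb z = phaseB p * q.wb (z + 2 * p.γ) := by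
  have h₀ : p.μ₀ = q.a₀ * (2 * p.γ) := by rw [μ₀, γ, q.hg₀]; push_cast; ring
  have h₁ : p.μ₁ = q.a₁ * (2 * p.γ) := by rw [μ₁, γ, q.hg₁]; push_cast; ring
  have h₀' : p.μ₀' = q.a₀' * (2 * p.γ) := by rw [μ₀', γ, q.hg₀']; push_cast; ring
  have h₁' : p.μ₁' = q.a₁' * (2 * p.γ) := by rw [μ₁', γ, q.hg₁']; push_cast; ring
  have a1 : ∀ {w : ℂ}, p.E w ^ 2 ≠ 1 → p.E w + -1 ≠ 0 := fun h h' =>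
    h (by rw [eq_neg_of_add_eq_zero_left h']; norm_num)
  have a2 : ∀ {w : ℂ}, p.E w ^ 2 ≠ 1 → p.E w + 1 ≠ 0 := fun h h' =>
    h (by rw [eq_neg_of_add_eq_zero_left h']; norm_num)
  rw [vb_eq, wb, wb, ← risingProd_ratio h₀ (a1 hz), ← risingProd_ratio h₁ (a2 hz),
    ← add_assoc p.γ z, ← risingProd_ratio h₀' (a1 hz'), ← risingProd_ratio h₁' (a2 hz'), phaseB]
  simp only [sub_eq_add_neg]
  ring

/-- The weight of a coordinate. -/
def W₁ (z : ℂ) : ℂ := q.wb z * q.wb (-z)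

/-- The weight of a pair of coordinates. -/
def W₂ (u v : ℂ) : ℂ := q.wa (u + v) * q.wa (-(u + v)) * (q.wa (u - v) * q.wa (-(u - v)))

theorem W₁_signed {ε : ℤ} (hε : ε = 1 ∨ ε = -1) (z : ℂ) : q.W₁ (ε * z) = q.W₁ z := by
  rcases hε with rfl | rfl
  · simp
  · simp [W₁, mul_comm]

theorem W₂_comm (u v : ℂ) : q.W₂ u v = q.W₂ v u := by
  rw [W₂, W₂, add_comm v u, neg_sub, neg_sub, mul_comm (q.wa (v - u))]

theorem W₂_neg_left (u v : ℂ) : q.W₂ (-u) v = q.W₂ u v := by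
  have e1 : -u + v = -(u - v) := by ring
  have e2 : -u - v = -(u + v) := by ring
  rw [W₂, W₂, e1, e2, neg_neg, neg_neg]
  ring

theorem W₂_signed {ε ε' : ℤ} (hε : ε = 1 ∨ ε = -1) (hε' : ε' = 1 ∨ ε' = -1) (u v : ℂ) :
    q.W₂ (ε * u) (ε' * v) = q.W₂ u v := by
  have h1 : ∀ {ε : ℤ}, (ε = 1 ∨ ε = -1) → ∀ u v, q.W₂ (ε * u) v = q.W₂ u v := by
    rintro ε (rfl | rfl) u v
    · simp
    · simpa using q.W₂_neg_left u v
  rw [h1 hε, W₂_comm, h1 hε', W₂_comm]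

theorem vb_mul_W₁ {u : ℂ} (h : p.E u ^ 2 ≠ 1) (h' : p.E (p.γ + u) ^ 2 ≠ 1) :
    p.vb u * q.W₁ u = phaseB p * (q.wb (u + 2 * p.γ) * q.wb (-u)) := by
  rw [W₁, ← mul_assoc, q.vb_mul_wb h h']; ring

/-- The two factors translate `wa (u + v)` in succession by `2γ`, while the part of the weight in `u
- v` stays. The right side has no denominators, which also gives polynomiality. -/
theorem va_va_W₂_move_both {u v : ℂ} (h : p.E (u + v) ≠ 1) (h' : p.E (u + v + 2 * p.γ) ≠ 1) :
    p.va (u + v) * p.va (u + v + 2 * p.γ) * q.W₂ u v =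
      p.phase p.μ ^ 2 * (q.wa (u + v + 2 * p.γ + 2 * p.γ) * q.wa (-(u + v)) *
        (q.wa (u - v) * q.wa (-(u - v)))) := by
  have h1 := q.va_mul_wa h
  have h2 := q.va_mul_wa h'
  rw [W₂]
  linear_combination (p.va (u + v + 2 * p.γ) * q.wa (-(u + v)) *
    (q.wa (u - v) * q.wa (-(u - v)))) * h1 +
    (p.phase p.μ * q.wa (-(u + v)) * (q.wa (u - v) * q.wa (-(u - v)))) * h2

/-- Only `u` is translated, so each of `wa (u + v)` and `wa (u - v)` advances by one step. -/
theorem va_va_W₂_move_left {u v : ℂ} (h : p.E (u + v) ≠ 1) (h' : p.E (u - v) ≠ 1) :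
    p.va (u + v) * p.va (u - v) * q.W₂ u v =
      p.phase p.μ ^ 2 * (q.wa (u + v + 2 * p.γ) * q.wa (-(u + v)) *
        (q.wa (u - v + 2 * p.γ) * q.wa (-(u - v)))) := by
  have h1 := q.va_mul_wa h
  have h2 := q.va_mul_wa h'
  rw [W₂]
  linear_combination (p.va (u - v) * q.wa (-(u + v)) *
    (q.wa (u - v) * q.wa (-(u - v)))) * h1 +
    (p.phase p.μ * q.wa (u + v + 2 * p.γ) * q.wa (-(u + v)) * q.wa (-(u - v))) * h2

/-- The pole of `va (-z)` is cancelled by the first factor `E z - 1` of `wa z`. That factor is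
present because the coupling `g = a + 1` is at least `1`. -/
theorem va_neg_mul_wa {z : ℂ} (h : p.E z ≠ 1) :
    p.va (-z) * q.wa z = -p.phase p.μ * ((p.E (p.μ - z) - 1) * p.E z *
      p.risingProd (-1) q.a (z + 2 * p.γ)) := by
  have h1 : q.wa z = (p.E z - 1) * p.risingProd (-1) q.a (z + 2 * p.γ) := by
    rw [wa, risingProd, Finset.prod_range_succ', mul_comm, risingProd]
    congr 1
    · simp [sub_eq_add_neg]
    · refine Finset.prod_congr rfl fun m _ => ?_
      congr 2; push_cast; ring
  rw [h1, va_eq, E_neg, ← sub_eq_add_neg]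
  have h0 := p.E_ne_zero z
  have h2 : (p.E z)⁻¹ - 1 ≠ 0 := by
    rw [sub_ne_zero]; rwa [Ne, inv_eq_one]
  have h3 : p.E z - 1 = -p.E z * ((p.E z)⁻¹ - 1) := by field_simp; ring
  rw [h3]
  generalize (p.E z)⁻¹ - 1 = t at h2
  field_simp

/-- The case in which neither argument is translated: the second factor has a reversed argument and
is regularized by `va_neg_mul_wa`. -/
theorem va_va_W₂_move_none {u v : ℂ} (h : p.E (u + v) ≠ 1) (h' : p.E (u + v + 2 * p.γ) ≠ 1) :
    p.va (u + v) * p.va (-(u + v + 2 * p.γ)) * q.W₂ u v =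
      -p.phase p.μ ^ 2 * ((p.E (p.μ - (u + v + 2 * p.γ)) - 1) * p.E (u + v + 2 * p.γ) *
      p.risingProd (-1) q.a (u + v + 2 * p.γ + 2 * p.γ) * q.wa (-(u + v)) *
        (q.wa (u - v) * q.wa (-(u - v)))) := by
  have h1 := q.va_mul_wa h
  have h2 := q.va_neg_mul_wa h'
  rw [W₂]
  linear_combination (p.va (-(u + v + 2 * p.γ)) * q.wa (-(u + v)) *
    (q.wa (u - v) * q.wa (-(u - v)))) * h1 +
    (p.phase p.μ * q.wa (-(u + v)) * (q.wa (u - v) * q.wa (-(u - v)))) * h2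

/-- Moving both arguments is compatible with the weight. -/
theorem move_both {u v : ℂ} (h : p.E (u + v) ≠ 1) (h₂ : p.E (u + v + 2 * p.γ) ≠ 1)
    (h₄ : p.E (u + v + 2 * p.γ + 2 * p.γ) ≠ 1) :
    p.va (u + v) * p.va (u + v + 2 * p.γ) * q.W₂ u v =
    p.va (-u - 2 * p.γ + (-v - 2 * p.γ)) * p.va (-u - 2 * p.γ + (-v - 2 * p.γ) + 2 * p.γ) *
      q.W₂ (-u - 2 * p.γ) (-v - 2 * p.γ) := by
  have hn : ∀ {z w : ℂ}, p.E z ≠ 1 → w = -z → p.E w ≠ 1 := by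
    rintro z w h rfl
    rwa [E_neg, Ne, inv_eq_one]
  -- The reflection `(u, v) ↦ (-u - 2γ, -v - 2γ)` exchanges `u + v + 4γ` with `-(u + v)` and
  -- reverses `u - v`, so the product of four `wa` is unchanged.
  rw [q.va_va_W₂_move_both h h₂, q.va_va_W₂_move_both (hn h₄ (by ring)) (hn h₂ (by ring))]
  have e1 : -u - 2 * p.γ + (-v - 2 * p.γ) + 2 * p.γ + 2 * p.γ = -(u + v) := by ring
  have e2 : -(-u - 2 * p.γ + (-v - 2 * p.γ)) = u + v + 2 * p.γ + 2 * p.γ := by ring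
  have e3 : -u - 2 * p.γ - (-v - 2 * p.γ) = -(u - v) := by ring
  rw [e1, e2, e3, neg_neg]
  ring

/-- Moving the first argument is compatible with the weight. -/
theorem move_left {u v : ℂ} (h : p.E (u + v) ≠ 1) (h' : p.E (u - v) ≠ 1)
    (h₂ : p.E (u + v + 2 * p.γ) ≠ 1) (h₂' : p.E (u - v + 2 * p.γ) ≠ 1) :
    p.va (u + v) * p.va (u - v) * q.W₂ u v =
    p.va (-u - 2 * p.γ + v) * p.va (-u - 2 * p.γ - v) * q.W₂ (-u - 2 * p.γ) v := by
  have hn : ∀ {z w : ℂ}, p.E z ≠ 1 → w = -z → p.E w ≠ 1 := by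
    rintro z w h rfl
    rwa [E_neg, Ne, inv_eq_one]
  rw [q.va_va_W₂_move_left h h', q.va_va_W₂_move_left (hn h₂' (by ring)) (hn h₂ (by ring))]
  have e1 : -u - 2 * p.γ + v + 2 * p.γ = -(u - v) := by ring
  have e2 : -u - 2 * p.γ - v + 2 * p.γ = -(u + v) := by ring
  have e3 : -(-u - 2 * p.γ + v) = u - v + 2 * p.γ := by ring
  have e4 : -(-u - 2 * p.γ - v) = u + v + 2 * p.γ := by ring
  rw [e1, e2, e3, e4]
  ring

/-- Moving the argument of `v_b` is compatible with the weight. -/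
theorem move_single {u : ℂ} (h : p.E u ^ 2 ≠ 1) (h₁ : p.E (p.γ + u) ^ 2 ≠ 1)
    (h₂ : p.E (u + 2 * p.γ) ^ 2 ≠ 1) :
    p.vb u * q.W₁ u = p.vb (-u - 2 * p.γ) * q.W₁ (-u - 2 * p.γ) := by
  have hn : ∀ {z w : ℂ}, p.E z ^ 2 ≠ 1 → w = -z → p.E w ^ 2 ≠ 1 := by
    rintro z w h rfl
    rwa [E_neg, inv_pow, Ne, inv_eq_one]
  rw [q.vb_mul_W₁ h h₁, q.vb_mul_W₁ (hn h₂ (by ring)) (hn h₁ (by ring))]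
  have e1 : -u - 2 * p.γ + 2 * p.γ = -u := by ring
  have e2 : -(-u - 2 * p.γ) = u + 2 * p.γ := by ring
  rw [e1, e2]
  ring

end NatCouplings

/-! ### Adjointness of the terms with respect to the weight -/

/-- The pair factor of a coefficient. -/
def pairFac (p : Params) (J : Finset (Fin n)) (ε σ : Fin n → ℤ) (x : Fin n → ℂ) (j k : Fin n) : ℂ :=
  p.outerFac J ε x j k * if j ∈ J ∧ k ∈ J then p.innerFac ε σ x j k else 1

theorem pairFac_comm (J : Finset (Fin n)) (ε σ : Fin n → ℤ) (x : Fin n → ℂ) (j k : Fin n) :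
    p.pairFac J ε σ x j k = p.pairFac J ε σ x k j := by
  simp only [pairFac, outerFac_comm J ε x j k, innerFac, and_comm (a := j ∈ J),
    add_comm ((σ j : ℂ) * _)]

/-- The factor of a coefficient that belongs to a single coordinate. -/
def singleFac (p : Params) (J : Finset (Fin n)) (ε σ : Fin n → ℤ) (x : Fin n → ℂ) (j : Fin n) : ℂ :=
  if j ∈ J then (σ j : ℂ) * p.vb (ε j * x j) else 1

/-- In this form adjointness and polynomiality can be checked one coordinate and one pair at a time.
-/
theorem block_eq_prod (J : Finset (Fin n)) (ε σ : Fin n → ℤ) (x : Fin n → ℂ) :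
    p.block J Jᶜ ε σ x =
      (∏ j, p.singleFac J ε σ x j) * pairProd Finset.univ (p.pairFac J ε σ x) := by
  have h1 : pairProd Finset.univ (p.pairFac J ε σ x) =
      pairProd Finset.univ (p.outerFac J ε x) * pairProd J (p.innerFac ε σ x) := by
    rw [← pairProd_subset J (p.innerFac ε σ x), ← pairProd_mul]
    rfl
  have h2 : ∏ j, p.singleFac J ε σ x j = ∏ j ∈ J, (σ j : ℂ) * p.vb (ε j * x j) := by
    simp only [singleFac]
    rw [Finset.prod_ite_mem, Finset.univ_inter]
  rw [h1, h2, block_eq_outer, Finset.prod_mul_distrib]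
  ring

/-- The signs of the term that is adjoint to the term with signs `ε`, `σ`. -/
def adjSign (ε σ : Fin n → ℤ) (j : Fin n) : ℤ := -(σ j * ε j)

theorem adjSign_mul_move_pos {ε σ : Fin n → ℤ} {x : Fin n → ℂ} {j : Fin n}
    (hε : ε j = 1 ∨ ε j = -1) (hσ : σ j = 1) :
    (adjSign ε σ j : ℂ) * p.move ε σ x j = -(ε j * x j) - 2 * p.γ := by
  rcases hε with h | h <;> simp [adjSign, move, hσ, h] <;> ring

theorem adjSign_mul_move_neg {ε σ : Fin n → ℤ} {x : Fin n → ℂ} {j : Fin n}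
    (hε : ε j = 1 ∨ ε j = -1) (hσ : σ j = -1) :
    (adjSign ε σ j : ℂ) * p.move ε σ x j = ε j * x j := by
  rcases hε with h | h <;> simp [adjSign, move, hσ, h]

theorem move_eq_self {ε σ : Fin n → ℤ} {x : Fin n → ℂ} {j : Fin n} (hε : ε j = 0) :
    p.move ε σ x j = x j := by simp [move, hε]

theorem adjSign_sign {ε σ : Fin n → ℤ} {j : Fin n} (hε : ε j = 1 ∨ ε j = -1)
    (hσ : σ j = 1 ∨ σ j = -1) : adjSign ε σ j = 1 ∨ adjSign ε σ j = -1 := by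
  rcases hε with h | h <;> rcases hσ with h' | h' <;> simp [adjSign, h, h']

/-- Where `σ_j = 1` the adjoint sign is `-ε_j` and the translation is undone; where `σ_j = -1`
neither term moves the coordinate. -/
theorem move_adjSign {J : Finset (Fin n)} {ε σ : Fin n → ℤ} (hε : ε ∈ signs J) (hσ : σ ∈ signs J)
    (x : Fin n → ℂ) : p.move (adjSign ε σ) σ (p.move ε σ x) = x := by
  rw [mem_signs] at hε hσ
  funext j
  by_cases hj : j ∈ J
  · rcases hσ.1 j hj with h | h <;> simp [move, adjSign, h]; ring
  · simp [move, adjSign, hε.2 j hj]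

/-- For fixed `σ` the map `ε ↦ -σε` permutes the sign configurations on `J`. -/
theorem sum_terms_adj {M : Type*} [AddCommMonoid M] (r : ℕ)
    (g : (J : Finset (Fin n)) → (Fin n → ℤ) → (Fin n → ℤ) → M) :
    ∑ i ∈ terms n r, g i.1 (adjSign i.2.1 i.2.2) i.2.2 = ∑ i ∈ terms n r, g i.1 i.2.1 i.2.2 := by
  rw [terms, Finset.sum_sigma, Finset.sum_sigma]
  refine Finset.sum_congr rfl fun J _ => ?_
  rw [Finset.sum_product_right, Finset.sum_product_right]
  refine Finset.sum_congr rfl fun σ hσ => ?_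
  rw [mem_signs] at hσ
  have := sum_signs_mul J (η := fun j => if j ∈ J then -σ j else 1) (fun j => by
    by_cases hj : j ∈ J
    · rcases hσ.1 j hj with h | h <;> simp [hj, h]
    · simp [hj]) (fun ε => g J ε σ)
  rw [← this]
  refine Finset.sum_congr rfl fun ε hε => ?_
  rw [mem_signs] at hε
  congr 1
  funext j
  by_cases hj : j ∈ J
  · simp [adjSign, hj]
  · simp [adjSign, hj, hε.2 j hj]

namespace NatCouplings

variable (q : NatCouplings p)

theorem singleFac_adjoint {J : Finset (Fin n)} {ε σ : Fin n → ℤ} (hε : ε ∈ signs J)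
    (hσ : σ ∈ signs J) {x : Fin n → ℂ} (hx : p.Generic x) (j : Fin n) :
    p.singleFac J ε σ x j * q.W₁ (x j) =
      p.singleFac J (adjSign ε σ) σ (p.move ε σ x) j * q.W₁ (p.move ε σ x j) := by
  rw [mem_signs] at hε hσ
  rw [singleFac, singleFac]
  by_cases hj : j ∈ J
  · rw [if_pos hj, if_pos hj, ← q.W₁_signed (hε.1 j hj) (x j),
      ← q.W₁_signed (adjSign_sign (hε.1 j hj) (hσ.1 j hj)) (p.move ε σ x j), mul_assoc, mul_assoc]
    rcases hσ.1 j hj with h | h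
    · rw [adjSign_mul_move_pos (hε.1 j hj) h]
      congr 1
      have h0 := hx.signed_ne (j := j) 0 (hε.1 j hj)
      have h1 := hx.signed_ne (j := j) 1 (hε.1 j hj)
      have h2 := hx.signed_ne (j := j) 2 (hε.1 j hj)
      simp only [Int.cast_zero, zero_mul, add_zero, Int.cast_one, one_mul, Int.cast_ofNat]
        at h0 h1 h2
      rw [add_comm] at h1
      exact q.move_single h0 h1 h2
    · rw [adjSign_mul_move_neg (hε.1 j hj) h]
  · rw [if_neg hj, if_neg hj, move_eq_self (hε.2 j hj)]

/-- Replacing the term by its adjoint sends `u = ε_j x_j` to `-u - 2γ` where `σ_j = 1` and fixes it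
where `σ_j = -1`. The cases are therefore: both arguments reflected (`move_both`), one reflected
(`move_left`), none reflected (nothing to prove). An index `k` outside `J` behaves like an
unreflected argument. -/
theorem pairFac_adjoint_aux {J : Finset (Fin n)} {ε σ : Fin n → ℤ} (hε : ε ∈ signs J)
    (hσ : σ ∈ signs J) {x : Fin n → ℂ} (hx : p.Generic x) {j k : Fin n} (hjk : j ≠ k)
    (hj : j ∈ J) :
    p.pairFac J ε σ x j k * q.W₂ (x j) (x k) =
      p.pairFac J (adjSign ε σ) σ (p.move ε σ x) j k *
        q.W₂ (p.move ε σ x j) (p.move ε σ x k) := by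
  rw [mem_signs] at hε hσ
  have hεj := hε.1 j hj
  by_cases hk : k ∈ J
  · have hεk := hε.1 k hk
    rw [← q.W₂_signed hεj hεk (x j), ← q.W₂_signed (adjSign_sign hεj (hσ.1 j hj))
      (adjSign_sign hεk (hσ.1 k hk)) (p.move ε σ x j)]
    simp only [pairFac, outerFac, innerFac, hj, hk, if_true, and_self]
    have hp := fun m => hx.pair_ne hjk m hεj hεk
    have h0 := hp 0
    have h2 := hp 2
    have h4 := hp 4
    have hεk' : -ε k = 1 ∨ -ε k = -1 := by rcases hεk with h | h <;> simp [h]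
    have hεj' : -ε j = 1 ∨ -ε j = -1 := by rcases hεj with h | h <;> simp [h]
    have hm := fun m => hx.pair_ne hjk m hεj hεk'
    have hm' := fun m => hx.pair_ne hjk.symm m hεk hεj'
    have g0 := hm 0
    have g2 := hm 2
    have g0' := hm' 0
    have g2' := hm' 2
    simp only [Int.cast_zero, zero_mul, add_zero, Int.cast_ofNat, Int.cast_neg, neg_mul,
      ← sub_eq_add_neg] at h0 h2 h4 g0 g2 g0' g2'
    rcases hσ.1 j hj with hsj | hsj <;> rcases hσ.1 k hk with hsk | hsk
    · rw [adjSign_mul_move_pos hεj hsj, adjSign_mul_move_pos hεk hsk, hsj, hsk]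
      generalize (ε j : ℂ) * x j = u at *
      generalize (ε k : ℂ) * x k = v at *
      have e1 : ((1 : ℤ) : ℂ) * (u + p.γ) + ((1 : ℤ) : ℂ) * (v + p.γ) = u + v + 2 * p.γ := by
        push_cast; ring
      have e2 : ((1 : ℤ) : ℂ) * (-u - 2 * p.γ + p.γ) + ((1 : ℤ) : ℂ) * (-v - 2 * p.γ + p.γ) =
          -u - 2 * p.γ + (-v - 2 * p.γ) + 2 * p.γ := by push_cast; ring
      rw [e1, e2]
      refine q.move_both h0 h2 ?_
      rwa [show u + v + 2 * p.γ + 2 * p.γ = u + v + 4 * p.γ by ring]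
    · rw [adjSign_mul_move_pos hεj hsj, adjSign_mul_move_neg hεk hsk, hsj, hsk]
      generalize (ε j : ℂ) * x j = u at *
      generalize (ε k : ℂ) * x k = v at *
      have e1 : ((1 : ℤ) : ℂ) * (u + p.γ) + ((-1 : ℤ) : ℂ) * (v + p.γ) = u - v := by
        push_cast; ring
      have e2 : ((1 : ℤ) : ℂ) * (-u - 2 * p.γ + p.γ) + ((-1 : ℤ) : ℂ) * (v + p.γ) =
          -u - 2 * p.γ - v := by push_cast; ring
      rw [e1, e2]
      exact q.move_left h0 g0 h2 g2
    · rw [adjSign_mul_move_neg hεj hsj, adjSign_mul_move_pos hεk hsk, hsj, hsk]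
      generalize (ε j : ℂ) * x j = u at *
      generalize (ε k : ℂ) * x k = v at *
      have e1 : ((-1 : ℤ) : ℂ) * (u + p.γ) + ((1 : ℤ) : ℂ) * (v + p.γ) = v - u := by
        push_cast; ring
      have e2 : ((-1 : ℤ) : ℂ) * (u + p.γ) + ((1 : ℤ) : ℂ) * (-v - 2 * p.γ + p.γ) =
          -v - 2 * p.γ - u := by push_cast; ring
      rw [e1, e2, q.W₂_comm, q.W₂_comm u, add_comm u, add_comm u]
      rw [add_comm u] at h0 h2
      exact q.move_left h0 g0' h2 g2'
    · rw [adjSign_mul_move_neg hεj hsj, adjSign_mul_move_neg hεk hsk]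
  · rw [← q.W₂_signed hεj (Or.inl rfl) (x j),
      ← q.W₂_signed (adjSign_sign hεj (hσ.1 j hj)) (Or.inl rfl) (p.move ε σ x j)]
    simp only [pairFac, outerFac, hj, hk, if_true, and_false, if_false, mul_one, Int.cast_one,
      one_mul]
    rw [move_eq_self (hε.2 k hk)]
    rcases hσ.1 j hj with hsj | hsj
    · rw [adjSign_mul_move_pos hεj hsj]
      have h0 := hx.pair_ne hjk 0 hεj (Or.inl rfl)
      have h2 := hx.pair_ne hjk 2 hεj (Or.inl rfl)
      have g0 := hx.pair_ne hjk 0 hεj (Or.inr rfl)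
      have g2 := hx.pair_ne hjk 2 hεj (Or.inr rfl)
      simp only [Int.cast_zero, zero_mul, add_zero, Int.cast_ofNat, Int.cast_neg, neg_mul,
        ← sub_eq_add_neg, Int.cast_one, one_mul] at h0 h2 g0 g2
      exact q.move_left h0 g0 h2 g2
    · rw [adjSign_mul_move_neg hεj hsj]

theorem pairFac_adjoint {J : Finset (Fin n)} {ε σ : Fin n → ℤ} (hε : ε ∈ signs J)
    (hσ : σ ∈ signs J) {x : Fin n → ℂ} (hx : p.Generic x) {j k : Fin n} (hjk : j ≠ k) :
    p.pairFac J ε σ x j k * q.W₂ (x j) (x k) =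
      p.pairFac J (adjSign ε σ) σ (p.move ε σ x) j k *
        q.W₂ (p.move ε σ x j) (p.move ε σ x k) := by
  by_cases hj : j ∈ J
  · exact q.pairFac_adjoint_aux hε hσ hx hjk hj
  · by_cases hk : k ∈ J
    · rw [pairFac_comm, q.W₂_comm, pairFac_comm J (adjSign ε σ), q.W₂_comm (p.move ε σ x j)]
      exact q.pairFac_adjoint_aux hε hσ hx hjk.symm hk
    · rw [mem_signs] at hε
      rw [move_eq_self (hε.2 j hj), move_eq_self (hε.2 k hk)]
      simp [pairFac, outerFac, hj, hk]

/-- The weight function. -/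
def weight (x : Fin n → ℂ) : ℂ :=
  (∏ j, q.W₁ (x j)) * pairProd Finset.univ (fun j k => q.W₂ (x j) (x k))

theorem block_mul_weight (J : Finset (Fin n)) (ε σ : Fin n → ℤ) (x : Fin n → ℂ) :
    p.block J Jᶜ ε σ x * q.weight x = (∏ j, p.singleFac J ε σ x j * q.W₁ (x j)) *
      pairProd Finset.univ (fun j k => p.pairFac J ε σ x j k * q.W₂ (x j) (x k)) := by
  rw [block_eq_prod, weight, Finset.prod_mul_distrib, pairProd_mul]
  ring

/-- Each term of the operators is adjoint to another term with respect to the weight. -/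
theorem block_adjoint {J : Finset (Fin n)} {ε σ : Fin n → ℤ} (hε : ε ∈ signs J)
    (hσ : σ ∈ signs J) {x : Fin n → ℂ} (hx : p.Generic x) :
    p.block J Jᶜ ε σ x * q.weight x =
      p.block J Jᶜ (adjSign ε σ) σ (p.move ε σ x) * q.weight (p.move ε σ x) := by
  rw [block_mul_weight, block_mul_weight]
  exact congrArg₂ (· * ·) (Finset.prod_congr rfl fun j _ => q.singleFac_adjoint hε hσ hx j)
    (pairProd_congr fun j _ k _ hjk => q.pairFac_adjoint hε hσ hx hjk.ne)

theorem isLaurent_wa (j k : Fin n) (ε ε' : ℤ) (w : ℂ) :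
    p.IsLaurent (fun x => q.wa (ε * x j + ε' * x k + w)) :=
  IsLaurent.risingProd_pair _ _ _ _ _ _ _

theorem isLaurent_wb (j : Fin n) (ε : ℤ) (w : ℂ) : p.IsLaurent (fun x => q.wb (ε * x j + w)) := by
  refine ((((IsLaurent.risingProd_coord (p := p) (-1) q.a₀ j ε w).mul
    (IsLaurent.risingProd_coord (p := p) 1 q.a₁ j ε w)).mul
    (IsLaurent.risingProd_coord (p := p) (-1) q.a₀' j ε (p.γ + w))).mul
    (IsLaurent.risingProd_coord (p := p) 1 q.a₁' j ε (p.γ + w))).congr fun x _ => ?_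
  rw [wb, add_left_comm]

theorem isLaurent_W₁ (j : Fin n) : p.IsLaurent (fun x => q.W₁ (x j)) :=
  ((q.isLaurent_wb j 1 0).mul (q.isLaurent_wb j (-1) 0)).congr fun x _ => by simp [W₁]

theorem isLaurent_singleFac {J : Finset (Fin n)} {ε σ : Fin n → ℤ} (hε : ε ∈ signs J) (j : Fin n) :
    p.IsLaurent (fun x => p.singleFac J ε σ x j * q.W₁ (x j)) := by
  rw [mem_signs] at hε
  by_cases hj : j ∈ J
  · refine (((q.isLaurent_wb j (ε j) (2 * p.γ)).mul
      (q.isLaurent_wb j (-ε j) 0)).const_mul (σ j * phaseB p)).congr fun x hx => ?_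
    have h0 := hx.signed_ne (j := j) 0 (hε.1 j hj)
    have h1 := hx.signed_ne (j := j) 1 (hε.1 j hj)
    simp only [Int.cast_zero, zero_mul, add_zero, Int.cast_one, one_mul] at h0 h1
    rw [add_comm] at h1
    rw [singleFac, if_pos hj, ← q.W₁_signed (hε.1 j hj) (x j), mul_assoc, q.vb_mul_W₁ h0 h1,
      mul_assoc]
    congr 4
    push_cast; ring
  · refine (q.isLaurent_W₁ j).congr fun x _ => ?_
    rw [singleFac, if_neg hj, one_mul]

theorem isLaurent_move_left {j k : Fin n} (hjk : j ≠ k) {ε ε' : ℤ} (hε : ε = 1 ∨ ε = -1)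
    (hε' : ε' = 1 ∨ ε' = -1) :
    p.IsLaurent (fun x => p.va (ε * x j + ε' * x k) * p.va (ε * x j - ε' * x k) *
      q.W₂ (ε * x j) (ε' * x k)) := by
  refine ((((q.isLaurent_wa j k ε ε' (2 * p.γ)).mul (q.isLaurent_wa j k (-ε) (-ε') 0)).mul
    ((q.isLaurent_wa j k ε (-ε') (2 * p.γ)).mul (q.isLaurent_wa j k (-ε) ε' 0))).const_mul
    (p.phase p.μ ^ 2)).congr fun x hx => ?_
  have hε'' : -ε' = 1 ∨ -ε' = -1 := by rcases hε' with h | h <;> simp [h]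
  have h0 := hx.pair_ne hjk 0 hε hε'
  have g0 := hx.pair_ne hjk 0 hε hε''
  simp only [Int.cast_zero, zero_mul, add_zero, Int.cast_neg, neg_mul, ← sub_eq_add_neg] at h0 g0
  rw [q.va_va_W₂_move_left h0 g0]
  refine congrArg _ (congrArg₂ _ (congrArg₂ _ ?_ ?_) (congrArg₂ _ ?_ ?_)) <;>
    refine congrArg q.wa ?_ <;> push_cast <;> ring

theorem isLaurent_pairFac_aux {J : Finset (Fin n)} {ε σ : Fin n → ℤ} (hε : ε ∈ signs J)
    (hσ : σ ∈ signs J) {j k : Fin n} (hjk : j ≠ k) (hj : j ∈ J) :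
    p.IsLaurent (fun x => p.pairFac J ε σ x j k * q.W₂ (x j) (x k)) := by
  rw [mem_signs] at hε hσ
  have hεj := hε.1 j hj
  by_cases hk : k ∈ J
  · have hεk := hε.1 k hk
    have key : p.IsLaurent (fun x => p.va (ε j * x j + ε k * x k) *
        p.va (σ j * (ε j * x j + p.γ) + σ k * (ε k * x k + p.γ)) *
        q.W₂ (ε j * x j) (ε k * x k)) := by
      have hgen : ∀ x : Fin n → ℂ, p.Generic x → p.E (ε j * x j + ε k * x k) ≠ 1 ∧
          p.E (ε j * x j + ε k * x k + 2 * p.γ) ≠ 1 := by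
        intro x hx
        have h0 := hx.pair_ne hjk 0 hεj hεk
        have h2 := hx.pair_ne hjk 2 hεj hεk
        simp only [Int.cast_zero, zero_mul, add_zero, Int.cast_ofNat] at h0 h2
        exact ⟨h0, h2⟩
      have hwd : p.IsLaurent (fun x => q.wa (ε j * x j - ε k * x k) *
          q.wa (-(ε j * x j - ε k * x k))) := by
        refine ((q.isLaurent_wa j k (ε j) (-ε k) 0).mul (q.isLaurent_wa j k (-ε j) (ε k) 0)).congr
          fun x _ => congrArg₂ _ ?_ ?_ <;> refine congrArg q.wa ?_ <;> push_cast <;> ring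
      have hws : p.IsLaurent (fun x => q.wa (-(ε j * x j + ε k * x k))) :=
        (q.isLaurent_wa j k (-ε j) (-ε k) 0).congr fun x _ =>
          congrArg q.wa (by push_cast; ring)
      rcases hσ.1 j hj with hsj | hsj <;> rcases hσ.1 k hk with hsk | hsk
      · refine ((((q.isLaurent_wa j k (ε j) (ε k) (2 * p.γ + 2 * p.γ)).mul hws).mul hwd).const_mul
          (p.phase p.μ ^ 2)).congr fun x hx => ?_
        rw [← add_assoc _ (2 * p.γ), ← q.va_va_W₂_move_both (hgen x hx).1 (hgen x hx).2, hsj, hsk]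
        refine congrArg (· * _) (congrArg (_ * ·) (congrArg p.va ?_))
        push_cast; ring
      · refine (q.isLaurent_move_left hjk hεj hεk).congr fun x _ => ?_
        rw [hsj, hsk]
        refine congrArg (· * _) (congrArg (_ * ·) (congrArg p.va ?_))
        push_cast; ring
      · refine (q.isLaurent_move_left hjk.symm hεk hεj).congr fun x _ => ?_
        rw [hsj, hsk, q.W₂_comm, add_comm ((ε j : ℂ) * x j)]
        refine congrArg (· * _) (congrArg (_ * ·) (congrArg p.va ?_))
        push_cast; ring
      -- With both `σ` equal to `-1` the second pair factor is `va (-(u + v + 2γ))`, where `u = ε_j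
      -- x_j` and `v = ε_k x_k`; this is where `g ≥ 1` is needed.
      · have h1 : p.IsLaurent (fun x => (p.E (p.μ - (ε j * x j + ε k * x k + 2 * p.γ)) - 1) *
            p.E (ε j * x j + ε k * x k + 2 * p.γ) *
            p.risingProd (-1) q.a (ε j * x j + ε k * x k + 2 * p.γ + 2 * p.γ)) := by
          refine ((((IsLaurent.E_pair (p := p) j k (-ε j) (-ε k) (p.μ - 2 * p.γ)).sub
            (IsLaurent.const 1)).mul (IsLaurent.E_pair (p := p) j k (ε j) (ε k) (2 * p.γ))).mul
            (IsLaurent.risingProd_pair (p := p) (-1) q.a j k (ε j) (ε k)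
              (2 * p.γ + 2 * p.γ))).congr fun x _ => ?_
          rw [← add_assoc _ (2 * p.γ)]
          refine congrArg (· * _) (congrArg (· * _) (congrArg (· - 1) (congrArg p.E ?_)))
          push_cast; ring
        refine (((h1.mul hws).mul hwd).const_mul (-p.phase p.μ ^ 2)).congr fun x hx => ?_
        rw [← q.va_va_W₂_move_none (hgen x hx).1 (hgen x hx).2, hsj, hsk]
        refine congrArg (· * _) (congrArg (_ * ·) (congrArg p.va ?_))
        push_cast; ring
    refine key.congr fun x _ => ?_
    rw [← q.W₂_signed hεj hεk (x j)]
    simp only [pairFac, outerFac, innerFac, hj, hk, if_true, and_self]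
  · refine (q.isLaurent_move_left hjk hεj (Or.inl rfl)).congr fun x _ => ?_
    rw [← q.W₂_signed hεj (Or.inl rfl) (x j)]
    simp only [pairFac, outerFac, hj, hk, if_true, and_false, if_false, mul_one, Int.cast_one,
      one_mul]

theorem isLaurent_pairFac {J : Finset (Fin n)} {ε σ : Fin n → ℤ} (hε : ε ∈ signs J)
    (hσ : σ ∈ signs J) {j k : Fin n} (hjk : j ≠ k) :
    p.IsLaurent (fun x => p.pairFac J ε σ x j k * q.W₂ (x j) (x k)) := by
  by_cases hj : j ∈ J
  · exact q.isLaurent_pairFac_aux hε hσ hjk hj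
  · by_cases hk : k ∈ J
    · refine (q.isLaurent_pairFac_aux hε hσ hjk.symm hk).congr fun x _ => ?_
      rw [pairFac_comm, q.W₂_comm]
    · refine (((q.isLaurent_wa j k 1 1 0).mul (q.isLaurent_wa j k (-1) (-1) 0)).mul
        ((q.isLaurent_wa j k 1 (-1) 0).mul (q.isLaurent_wa j k (-1) 1 0))).congr fun x _ => ?_
      simp only [pairFac, outerFac, hj, hk, if_false, and_self, one_mul, W₂]
      refine congrArg₂ _ (congrArg₂ _ ?_ ?_) (congrArg₂ _ ?_ ?_) <;>
        refine congrArg q.wa ?_ <;> push_cast <;> ring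

theorem isLaurent_block_mul_weight {J : Finset (Fin n)} {ε σ : Fin n → ℤ} (hε : ε ∈ signs J)
    (hσ : σ ∈ signs J) : p.IsLaurent (fun x => p.block J Jᶜ ε σ x * q.weight x) :=
  ((IsLaurent.prod fun j _ => q.isLaurent_singleFac hε j).mul
    (IsLaurent.pairProd fun _ _ _ _ hjk => q.isLaurent_pairFac hε hσ hjk.ne)).congr fun x _ =>
    q.block_mul_weight J ε σ x

end NatCouplings

/-! ### The constant term pairing -/

theorem ev_eq_sum {c : (Fin n → ℤ) →₀ ℂ} {s : Finset (Fin n → ℤ)} (hs : c.support ⊆ s)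
    (x : Fin n → ℂ) : p.ev c x = ∑ k ∈ s, c k * p.mono k x := by
  rw [ev_apply]
  refine Finset.sum_subset hs fun k _ hk => ?_
  rw [Finsupp.notMem_support_iff.1 hk, zero_mul]

/-- The function agrees at generic points with a Laurent polynomial whose constant term is `a`. -/
def HasConstTerm (p : Params) (φ : (Fin n → ℂ) → ℂ) (a : ℂ) : Prop :=
  ∃ c : (Fin n → ℤ) →₀ ℂ, c 0 = a ∧ ∀ x, p.Generic x → φ x = p.ev c x

theorem IsLaurent.exists_hasConstTerm {φ : (Fin n → ℂ) → ℂ} (hφ : p.IsLaurent φ) :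
    ∃ a, p.HasConstTerm φ a := by
  obtain ⟨c, hc⟩ := isLaurent_iff.1 hφ
  exact ⟨_, c, rfl, hc⟩

namespace HasConstTerm

theorem unique (h : 0 < p.α) {φ : (Fin n → ℂ) → ℂ} {a b : ℂ} (ha : p.HasConstTerm φ a)
    (hb : p.HasConstTerm φ b) : a = b := by
  obtain ⟨c, rfl, hc⟩ := ha
  obtain ⟨d, rfl, hd⟩ := hb
  rw [ev_inj h fun x hx => (hc x hx).symm.trans (hd x hx)]

theorem congr {φ ψ : (Fin n → ℂ) → ℂ} {a : ℂ} (ha : p.HasConstTerm φ a)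
    (hψ : ∀ x, p.Generic x → ψ x = φ x) : p.HasConstTerm ψ a := by
  obtain ⟨c, rfl, hc⟩ := ha
  exact ⟨c, rfl, fun x hx => (hψ x hx).trans (hc x hx)⟩

theorem sub {φ ψ : (Fin n → ℂ) → ℂ} {a b : ℂ} (ha : p.HasConstTerm φ a)
    (hb : p.HasConstTerm ψ b) : p.HasConstTerm (fun x => φ x - ψ x) (a - b) := by
  obtain ⟨c, rfl, hc⟩ := ha
  obtain ⟨d, rfl, hd⟩ := hb
  exact ⟨c - d, rfl, fun x hx => by
    simp only [hc x hx, hd x hx, map_sub, Pi.sub_apply]⟩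

theorem sum {ι : Type*} {s : Finset ι} {φ : ι → (Fin n → ℂ) → ℂ} {a : ι → ℂ}
    (ha : ∀ i ∈ s, p.HasConstTerm (φ i) (a i)) :
    p.HasConstTerm (fun x => ∑ i ∈ s, φ i x) (∑ i ∈ s, a i) := by
  have : ∀ i, ∃ c : (Fin n → ℤ) →₀ ℂ, i ∈ s → c 0 = a i ∧ ∀ x, p.Generic x → φ i x = p.ev c x := by
    intro i
    by_cases hi : i ∈ s
    · obtain ⟨c, hc⟩ := ha i hi
      exact ⟨c, fun _ => hc⟩
    · exact ⟨0, fun h => absurd h hi⟩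
  choose c hc using this
  refine ⟨∑ i ∈ s, c i, ?_, fun x hx => ?_⟩
  · rw [Finsupp.finsetSum_apply]
    exact Finset.sum_congr rfl fun i hi => (hc i hi).1
  · rw [map_sum, Finset.sum_apply]
    exact Finset.sum_congr rfl fun i hi => (hc i hi).2 x hx

/-- Translations do not change the constant term. -/
theorem comp_move {φ : (Fin n → ℂ) → ℂ} {a : ℂ} (ha : p.HasConstTerm φ a) (ε σ : Fin n → ℤ) :
    p.HasConstTerm (fun x => φ (p.move ε σ x)) a := by
  obtain ⟨c, rfl, hc⟩ := ha
  set t : Fin n → ℂ := p.move ε σ 0 with ht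
  -- Translation by `t` multiplies the coefficient of the monomial `k` by `mono k t`, which is `1`
  -- for `k = 0`.
  refine ⟨Finsupp.onFinset c.support (fun k => c k * p.mono k t) fun k hk => ?_, ?_,
    fun x hx => ?_⟩
  · rw [Finsupp.mem_support_iff]
    exact left_ne_zero_of_mul hk
  · simp [mono_zero]
  · have hm : p.move ε σ x = x + t := by funext j; simp [ht, move]
    simp only [hc _ (move_generic hx ε σ)]
    rw [ev_eq_sum Finsupp.support_onFinset_subset, ev_apply, hm]
    refine Finset.sum_congr rfl fun k _ => ?_
    rw [mono_vadd, Finsupp.onFinset_apply]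
    ring

end HasConstTerm

theorem adjSign_mem {J : Finset (Fin n)} {ε σ : Fin n → ℤ} (hε : ε ∈ signs J) (hσ : σ ∈ signs J) :
    adjSign ε σ ∈ signs J := by
  rw [mem_signs] at hε hσ ⊢
  exact ⟨fun j hj => adjSign_sign (hε.1 j hj) (hσ.1 j hj), fun j hj => by
    simp [adjSign, hε.2 j hj]⟩

theorem IsLaurent.comp_move {φ : (Fin n → ℂ) → ℂ} (hφ : p.IsLaurent φ) (ε σ : Fin n → ℤ) :
    p.IsLaurent (fun x => φ (p.move ε σ x)) := by
  obtain ⟨a, ha⟩ := hφ.exists_hasConstTerm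
  obtain ⟨c, -, hc⟩ := ha.comp_move ε σ
  exact isLaurent_iff.2 ⟨c, hc⟩

/-- The operators are symmetric for the constant term pairing with the weight. -/
theorem NatCouplings.closedOp_symmetric (q : NatCouplings p) (r : ℕ) {f g : (Fin n → ℂ) → ℂ}
    (hf : p.IsLaurent f) (hg : p.IsLaurent g) :
    ∃ a, p.HasConstTerm (fun x => p.closedOp r f x * g x * q.weight x) a ∧
      p.HasConstTerm (fun x => f x * p.closedOp r g x * q.weight x) a := by
  have key : ∀ (J : Finset (Fin n)) (ε σ : Fin n → ℤ), ∃ b, ε ∈ signs J → σ ∈ signs J →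
      p.HasConstTerm (fun x => p.block J Jᶜ ε σ x * q.weight x * (f x * g (p.move ε σ x))) b := by
    intro J ε σ
    by_cases hε : ε ∈ signs J
    · by_cases hσ : σ ∈ signs J
      · obtain ⟨b, hb⟩ := ((q.isLaurent_block_mul_weight hε hσ).mul
          (hf.mul (hg.comp_move ε σ))).exists_hasConstTerm
        exact ⟨b, fun _ _ => hb⟩
      · exact ⟨0, fun _ h => absurd h hσ⟩
    · exact ⟨0, fun h => absurd h hε⟩
  choose b hb using key
  -- The second function is the sum of the terms defining `b`. In the first, `block_adjoint` turns
  -- the term `(ε, σ)` into the adjoint term of that sum evaluated at the translated point;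
  -- translation preserves constant terms, and passing to adjoint terms only permutes the index set.
  refine ⟨∑ i ∈ terms n r, b i.1 i.2.1 i.2.2, ?_, ?_⟩
  · rw [← sum_terms_adj]
    refine (HasConstTerm.sum (p := p) (s := terms n r) (φ := fun i x =>
      p.block i.1 i.1ᶜ i.2.1 i.2.2 x * q.weight x * (f (p.move i.2.1 i.2.2 x) * g x))
      fun i hi => ?_).congr fun x _ => ?_
    · rw [terms, Finset.mem_sigma, Finset.mem_product] at hi
      refine ((hb i.1 _ _ (adjSign_mem hi.2.1 hi.2.2) hi.2.2).comp_move i.2.1 i.2.2).congr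
        fun x hx => ?_
      rw [q.block_adjoint hi.2.1 hi.2.2 hx, move_adjSign hi.2.1 hi.2.2]
    · rw [closedOp_eq_terms, Finset.sum_mul, Finset.sum_mul]
      exact Finset.sum_congr rfl fun i _ => by ring
  · refine (HasConstTerm.sum (p := p) (s := terms n r) (φ := fun i x =>
      p.block i.1 i.1ᶜ i.2.1 i.2.2 x * q.weight x * (f x * g (p.move i.2.1 i.2.2 x)))
      fun i hi => ?_).congr fun x _ => ?_
    · rw [terms, Finset.mem_sigma, Finset.mem_product] at hi
      exact hb _ _ _ hi.2.1 hi.2.2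
    · rw [closedOp_eq_terms, Finset.mul_sum, Finset.sum_mul]
      exact Finset.sum_congr rfl fun i _ => by ring

/-- The function agrees at generic points with an invariant Laurent polynomial. -/
def IsInvariant (p : Params) (φ : (Fin n → ℂ) → ℂ) : Prop :=
  ∃ c, WeylInvariant (p.ev c) ∧ ∀ x, p.Generic x → φ x = p.ev c x

namespace IsInvariant

theorem isLaurent {φ : (Fin n → ℂ) → ℂ} (hφ : p.IsInvariant φ) : p.IsLaurent φ := by
  obtain ⟨c, -, hc⟩ := hφ
  exact isLaurent_iff.2 ⟨c, hc⟩

theorem closedOp (h : 0 < p.α) {φ : (Fin n → ℂ) → ℂ} (hφ : p.IsInvariant φ) (r : ℕ) :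
    p.IsInvariant (p.closedOp r φ) := by
  obtain ⟨c, hc, hφ⟩ := hφ
  obtain ⟨d, hd, h'⟩ := exists_ev_closedOp h hc r
  exact ⟨d, hd, fun x hx => (closedOp_congr hφ hx).trans (h' x hx)⟩

theorem sub {φ ψ : (Fin n → ℂ) → ℂ} (hφ : p.IsInvariant φ) (hψ : p.IsInvariant ψ) :
    p.IsInvariant (fun x => φ x - ψ x) := by
  obtain ⟨c, hc, hφ⟩ := hφ
  obtain ⟨d, hd, hψ⟩ := hψ
  refine ⟨c - d, ⟨fun π x => ?_, fun η hη x => ?_⟩, fun x hx => ?_⟩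
  · rw [map_sub, Pi.sub_apply, hc.perm, hd.perm, Pi.sub_apply]
  · rw [map_sub, Pi.sub_apply, hc.flip η hη, hd.flip η hη, Pi.sub_apply]
  · simp only [map_sub, Pi.sub_apply, hφ x hx, hψ x hx]

theorem bracket (h : 0 < p.α) {φ : (Fin n → ℂ) → ℂ} (hφ : p.IsInvariant φ) (r s : ℕ) :
    p.IsInvariant (p.bracket r s φ) :=
  ((hφ.closedOp h s).closedOp h r).sub ((hφ.closedOp h r).closedOp h s)

end IsInvariant

/-- The outer operator is transferred to `g` first and the inner one afterwards, which reverses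
their order. -/
theorem NatCouplings.closedOp_closedOp_symmetric (q : NatCouplings p) (h : 0 < p.α) (r s : ℕ)
    {f g : (Fin n → ℂ) → ℂ} (hf : p.IsInvariant f) (hg : p.IsInvariant g) :
    ∃ a, p.HasConstTerm (fun x => p.closedOp r (p.closedOp s f) x * g x * q.weight x) a ∧
      p.HasConstTerm (fun x => f x * p.closedOp s (p.closedOp r g) x * q.weight x) a := by
  obtain ⟨a, ha, ha'⟩ := q.closedOp_symmetric r (hf.closedOp h s).isLaurent hg.isLaurent
  obtain ⟨b, hb, hfb⟩ := q.closedOp_symmetric s hf.isLaurent (hg.closedOp h r).isLaurent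
  rw [ha'.unique h hb] at ha
  exact ⟨b, ha, hfb⟩

/-- The commutator is antisymmetric for the constant term pairing. -/
theorem NatCouplings.bracket_antisymmetric (q : NatCouplings p) (h : 0 < p.α) (r s : ℕ)
    {f g : (Fin n → ℂ) → ℂ} (hf : p.IsInvariant f) (hg : p.IsInvariant g) :
    ∃ a, p.HasConstTerm (fun x => p.bracket r s f x * g x * q.weight x) a ∧
      p.HasConstTerm (fun x => -(f x * p.bracket r s g x * q.weight x)) a := by
  obtain ⟨a, ha, ha'⟩ := q.closedOp_closedOp_symmetric h r s hf hg
  obtain ⟨b, hb, hb'⟩ := q.closedOp_closedOp_symmetric h s r hf hg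
  exact ⟨a - b, (ha.sub hb).congr fun x _ => by rw [bracket]; ring,
    (ha'.sub hb').congr fun x _ => by rw [bracket]; ring⟩

/-! ### Conjugation and positivity -/

/-- The conjugate function `x ↦ conj (φ (conj x))`. -/
def conjFun (φ : (Fin n → ℂ) → ℂ) (x : Fin n → ℂ) : ℂ :=
  (starRingEnd ℂ) (φ fun j => (starRingEnd ℂ) (x j))

theorem conj_γ : (starRingEnd ℂ) p.γ = -p.γ := by
  simp only [γ, map_div₀, map_mul, Complex.conj_I, Complex.conj_ofReal, map_ofNat]; ring

theorem conj_E (z : ℂ) : (starRingEnd ℂ) (p.E z) = p.E (-(starRingEnd ℂ) z) := by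
  rw [E, E, ← Complex.exp_conj]
  congr 1
  simp only [map_mul, Complex.conj_I, Complex.conj_ofReal, map_ofNat]
  ring

theorem Generic.conj {x : Fin n → ℂ} (hx : p.Generic x) :
    p.Generic (fun j => (starRingEnd ℂ) (x j)) := by
  have key : ∀ z w : ℂ, w = (starRingEnd ℂ) z → p.E w = ((starRingEnd ℂ) (p.E z))⁻¹ := by
    rintro z w rfl
    rw [conj_E, E_neg, inv_inv]
  refine ⟨fun j m => ?_, fun j k hjk m => ?_, fun j k hjk m => ?_⟩
  · rw [key (x j + (-m : ℤ) * p.γ) _ (by simp [conj_γ]), inv_pow, Ne, inv_eq_one, ← map_pow]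
    exact fun h => hx.sq_ne j (-m) (by simpa using congrArg (starRingEnd ℂ) h)
  · rw [key (x j + x k + (-m : ℤ) * p.γ) _ (by simp [conj_γ]), Ne, inv_eq_one]
    exact fun h => hx.add_ne j k hjk (-m) (by simpa using congrArg (starRingEnd ℂ) h)
  · rw [key (x j - x k + (-m : ℤ) * p.γ) _ (by simp [conj_γ]), Ne, inv_eq_one]
    exact fun h => hx.sub_ne j k hjk (-m) (by simpa using congrArg (starRingEnd ℂ) h)

/-- `conjFun` acts on Laurent polynomials by conjugating coefficients and negating exponents, as
complex conjugation does on the real torus. -/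
theorem conj_mono (k : Fin n → ℤ) (x : Fin n → ℂ) :
    (starRingEnd ℂ) (p.mono k fun j => (starRingEnd ℂ) (x j)) = p.mono (-k) x := by
  rw [mono, mono, conj_E]
  congr 1
  simp [map_sum, ← Finset.sum_neg_distrib]

theorem conjFun_ev (c : (Fin n → ℤ) →₀ ℂ) :
    conjFun (p.ev c) = p.ev (∑ k ∈ c.support, Finsupp.single (-k) ((starRingEnd ℂ) (c k))) := by
  funext x
  rw [conjFun, ev_apply, map_sum, map_sum, Finset.sum_apply]
  refine Finset.sum_congr rfl fun k _ => ?_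
  rw [map_mul, conj_mono, ev_single]

theorem WeylInvariant.conjFun {f : (Fin n → ℂ) → ℂ} (hf : WeylInvariant f) :
    WeylInvariant (conjFun f) where
  perm π x := congrArg (starRingEnd ℂ) (hf.perm π fun j => (starRingEnd ℂ) (x j))
  flip η hη x := by
    refine congrArg (starRingEnd ℂ) (Eq.trans ?_ (hf.flip η hη _))
    simp

theorem IsInvariant.conjFun {f : (Fin n → ℂ) → ℂ} (hf : p.IsInvariant f) :
    p.IsInvariant (conjFun f) := by
  obtain ⟨c, hc, hf⟩ := hf
  have := hc.conjFun
  rw [conjFun_ev] at this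
  refine ⟨_, this, fun x hx => ?_⟩
  rw [← conjFun_ev, Params.conjFun, hf _ hx.conj, Params.conjFun]

/-- As `g` is real, `μ` is purely imaginary and conjugation reverses it; the two resulting signs
cancel because sine is odd. -/
theorem conj_va (z : ℂ) : (starRingEnd ℂ) (p.va z) = p.va (-(starRingEnd ℂ) z) := by
  have hμ : (starRingEnd ℂ) p.μ = -p.μ := by simp [μ]
  rw [va, va, map_div₀, ← Complex.sin_conj, ← Complex.sin_conj, mul_neg, Complex.sin_neg, div_neg,
    ← neg_div, ← Complex.sin_neg]
  simp only [map_mul, map_add, hμ, Complex.conj_ofReal]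
  congr 2; ring

theorem conj_vb (z : ℂ) : (starRingEnd ℂ) (p.vb z) = p.vb (-(starRingEnd ℂ) z) := by
  have h₀ : (starRingEnd ℂ) p.μ₀ = -p.μ₀ := by simp [μ₀]
  have h₁ : (starRingEnd ℂ) p.μ₁ = -p.μ₁ := by simp [μ₁]
  have h₀' : (starRingEnd ℂ) p.μ₀' = -p.μ₀' := by simp [μ₀']
  have h₁' : (starRingEnd ℂ) p.μ₁' = -p.μ₁' := by simp [μ₁']
  have hs : ∀ w w' : ℂ, (starRingEnd ℂ) w = -w' →
      (starRingEnd ℂ) (Complex.sin (p.α * w)) = -Complex.sin (p.α * w') := by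
    intro w w' hw
    rw [← Complex.sin_conj, map_mul, hw, Complex.conj_ofReal, mul_neg, Complex.sin_neg]
  have hc : ∀ w w' : ℂ, (starRingEnd ℂ) w = -w' →
      (starRingEnd ℂ) (Complex.cos (p.α * w)) = Complex.cos (p.α * w') := by
    intro w w' hw
    rw [← Complex.cos_conj, map_mul, hw, Complex.conj_ofReal, mul_neg, Complex.cos_neg]
  simp only [vb, map_mul, map_div₀]
  rw [hs (p.μ₀ + z) (p.μ₀ + -(starRingEnd ℂ) z) (by simp [h₀]; ring),
    hs z (-(starRingEnd ℂ) z) (by simp),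
    hc (p.μ₁ + z) (p.μ₁ + -(starRingEnd ℂ) z) (by simp [h₁]; ring),
    hc z (-(starRingEnd ℂ) z) (by simp),
    hs (p.μ₀' + p.γ + z) (p.μ₀' + p.γ + -(starRingEnd ℂ) z) (by simp [h₀', conj_γ]; ring),
    hs (p.γ + z) (p.γ + -(starRingEnd ℂ) z) (by simp [conj_γ]; ring),
    hc (p.μ₁' + p.γ + z) (p.μ₁' + p.γ + -(starRingEnd ℂ) z) (by simp [h₁', conj_γ]; ring),
    hc (p.γ + z) (p.γ + -(starRingEnd ℂ) z) (by simp [conj_γ]; ring), neg_div_neg_eq,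
    neg_div_neg_eq]

/-- Conjugation negates the arguments of all factors and so amounts to reversing all `ε`. The sum
over `ε` does not notice this, and hence `conjFun` commutes with the operators. -/
theorem conjFun_block (J R : Finset (Fin n)) (ε σ : Fin n → ℤ) (x : Fin n → ℂ) :
    conjFun (p.block J R ε σ) x = p.block J R (fun j => -1 * ε j) σ x := by
  rw [← block_flip (η := fun _ => -1) _ _ _ _ _ fun _ => Or.inr rfl]
  simp only [conjFun, block, pairProd, map_mul, map_prod, conj_va, conj_vb, map_intCast]
  refine congrArg₂ _ (congrArg₂ _ ?_ ?_) ?_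
  · refine Finset.prod_congr rfl fun j _ => ?_
    congr 2; simp
  · refine Finset.prod_congr rfl fun j _ => Finset.prod_congr rfl fun k _ => ?_
    refine congrArg₂ _ (congrArg p.va ?_) (congrArg p.va ?_)
    · simp; ring
    · simp [conj_γ]; ring
  · refine Finset.prod_congr rfl fun j _ => Finset.prod_congr rfl fun k _ => ?_
    refine congrArg₂ _ (congrArg p.va ?_) (congrArg p.va ?_) <;> · simp; ring

theorem closedOp_conjFun (r : ℕ) (f : (Fin n → ℂ) → ℂ) :
    p.closedOp r (conjFun f) = conjFun (p.closedOp r f) := by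
  funext x
  rw [conjFun, closedOp, closedOp, map_sum]
  refine Finset.sum_congr rfl fun J _ => ?_
  rw [map_sum, ← sum_signs_mul J (η := fun _ => -1) fun _ => Or.inr rfl]
  refine Finset.sum_congr rfl fun ε _ => ?_
  rw [map_sum]
  refine Finset.sum_congr rfl fun σ _ => ?_
  rw [map_mul, ← conjFun_block]
  refine congrArg₂ _ rfl (congrArg (fun y => (starRingEnd ℂ) (f y)) ?_)
  funext j
  simp [move, conj_γ]
  ring

theorem bracket_conjFun (r s : ℕ) (f : (Fin n → ℂ) → ℂ) :
    p.bracket r s (conjFun f) = conjFun (p.bracket r s f) := by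
  funext x
  simp only [bracket, closedOp_conjFun]
  simp only [conjFun, bracket, map_sub]

/-- The constant term of `φ · conj φ` is positive definite. -/
theorem eq_zero_of_hasConstTerm (h : 0 < p.α) {φ : (Fin n → ℂ) → ℂ} (hφ : p.IsLaurent φ)
    (h0 : p.HasConstTerm (fun x => φ x * conjFun φ x) 0) {x : Fin n → ℂ} (hx : p.Generic x) :
    φ x = 0 := by
  classical
  obtain ⟨c, hc⟩ := isLaurent_iff.1 hφ
  -- In the product of `∑ c_k e^k` with `∑ conj (c_l) e^{-l}` the constant term collects the pairs
  -- `k = l`.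
  have h1 : p.HasConstTerm (fun x => φ x * conjFun φ x)
      ((∑ k ∈ c.support, ‖c k‖ ^ 2 : ℝ) : ℂ) := by
    refine ⟨∑ k ∈ c.support, ∑ l ∈ c.support,
      Finsupp.single (k + -l) (c k * (starRingEnd ℂ) (c l)), ?_, fun x hx => ?_⟩
    · simp only [Finsupp.finsetSum_apply, Finsupp.single_apply, ← sub_eq_add_neg, sub_eq_zero,
        Finset.sum_ite_eq]
      push_cast
      refine Finset.sum_congr rfl fun k hk => ?_
      rw [if_pos hk, Complex.mul_conj']
    · have e : conjFun φ x = conjFun (p.ev c) x := congrArg (starRingEnd ℂ) (hc _ hx.conj)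
      simp only []
      rw [e, hc x hx, conjFun_ev, ev_apply p c]
      simp only [map_sum, Finset.sum_apply, ev_single, Finset.sum_mul_sum, mono_add]
      exact Finset.sum_congr rfl fun k _ => Finset.sum_congr rfl fun l _ => by ring
  have h2 : ∑ k ∈ c.support, ‖c k‖ ^ 2 = 0 := by exact_mod_cast h1.unique h h0
  rw [Finset.sum_eq_zero_iff_of_nonneg fun k _ => by positivity] at h2
  have hc0 : c = 0 := by
    refine Finsupp.support_eq_empty.1 (Finset.eq_empty_of_forall_notMem fun k hk => ?_)
    exact Finsupp.mem_support_iff.1 hk (by simpa using h2 k hk)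
  rw [hc x hx, hc0, map_zero, Pi.zero_apply]

namespace NatCouplings

variable (q : NatCouplings p)

theorem conj_wa (z : ℂ) : (starRingEnd ℂ) (q.wa z) = q.wa (-(starRingEnd ℂ) z) := by
  have := risingProd_conj (p := p) (-1) (q.a + 1) z
  push_cast at this
  exact this

theorem conj_wb (z : ℂ) : (starRingEnd ℂ) (q.wb z) = q.wb (-(starRingEnd ℂ) z) := by
  have h1 := risingProd_conj (p := p) (-1) q.a₀ z
  have h2 := risingProd_conj (p := p) 1 q.a₁ z
  have h3 := risingProd_conj (p := p) (-1) q.a₀' (p.γ + z)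
  have h4 := risingProd_conj (p := p) 1 q.a₁' (p.γ + z)
  have e : -(starRingEnd ℂ) (p.γ + z) = p.γ + -(starRingEnd ℂ) z := by
    rw [map_add, conj_γ]; ring
  rw [e] at h3 h4
  push_cast at h1 h2 h3 h4
  rw [wb, wb, map_mul, map_mul, map_mul, h1, h2, h3, h4]

/-- The square root of the weight. -/
def halfWeight (x : Fin n → ℂ) : ℂ :=
  (∏ j, q.wb (x j)) * pairProd Finset.univ (fun j k => q.wa (x j + x k) * q.wa (x j - x k))

/-- Each factor of the weight at a negated argument is the conjugate of the factor at the original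
argument. The weight is therefore a square modulus on the real torus, and the pairing of `φ` with
`conjFun φ` becomes that of `φ * halfWeight` with its own conjugate. -/
theorem weight_eq (x : Fin n → ℂ) : q.weight x = q.halfWeight x * conjFun q.halfWeight x := by
  simp only [weight, conjFun, halfWeight, pairProd, map_mul, map_prod, conj_wa, conj_wb, map_add,
    map_sub, Complex.conj_conj, W₁, W₂, Finset.prod_mul_distrib]
  ring

theorem isLaurent_halfWeight : p.IsLaurent (q.halfWeight (n := n)) := by
  refine ((IsLaurent.prod (s := Finset.univ) fun j _ => q.isLaurent_wb j 1 0).mul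
    (IsLaurent.pairProd (J := Finset.univ) fun j _ k _ _ =>
      (q.isLaurent_wa j k 1 1 0).mul (q.isLaurent_wa j k 1 (-1) 0))).congr fun x _ => ?_
  simp [halfWeight, sub_eq_add_neg]

theorem halfWeight_ne_zero {x : Fin n → ℂ} (hx : p.Generic x) : q.halfWeight x ≠ 0 := by
  have h1 : ∀ {w : ℂ}, p.E w ^ 2 ≠ 1 → p.E w + -1 ≠ 0 := fun h h' =>
    h (by rw [eq_neg_of_add_eq_zero_left h']; norm_num)
  have h2 : ∀ {w : ℂ}, p.E w ^ 2 ≠ 1 → p.E w + 1 ≠ 0 := fun h h' =>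
    h (by rw [eq_neg_of_add_eq_zero_left h']; norm_num)
  have h3 : ∀ (j : Fin n) (m : ℕ), p.E (x j + m * (2 * p.γ)) ^ 2 ≠ 1 := fun j m => by
    have := hx.sq_ne j (2 * m)
    convert this using 3; push_cast; ring
  have h4 : ∀ (j : Fin n) (m : ℕ), p.E (p.γ + x j + m * (2 * p.γ)) ^ 2 ≠ 1 := fun j m => by
    have := hx.sq_ne j (2 * m + 1)
    convert this using 3; push_cast; ring
  refine mul_ne_zero (Finset.prod_ne_zero_iff.2 fun j _ => ?_)
    (Finset.prod_ne_zero_iff.2 fun j _ => Finset.prod_ne_zero_iff.2 fun k hk => ?_)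
  · exact mul_ne_zero (mul_ne_zero (mul_ne_zero
      (Finset.prod_ne_zero_iff.2 fun m _ => h1 (h3 j m))
      (Finset.prod_ne_zero_iff.2 fun m _ => h2 (h3 j m)))
      (Finset.prod_ne_zero_iff.2 fun m _ => h1 (h4 j m)))
      (Finset.prod_ne_zero_iff.2 fun m _ => h2 (h4 j m))
  · have hjk : j ≠ k := (Finset.mem_filter.1 hk).2.ne
    refine mul_ne_zero ?_ ?_ <;> rw [wa, risingProd] <;>
      refine Finset.prod_ne_zero_iff.2 fun m _ => ?_ <;> rw [← sub_eq_add_neg, sub_ne_zero]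
    · have := hx.add_ne j k hjk (2 * m)
      convert this using 2; push_cast; ring
    · have := hx.sub_ne j k hjk (2 * m)
      convert this using 2; push_cast; ring

end NatCouplings

/-- If the square of the commutator annihilates an invariant Laurent polynomial, so does the
commutator. -/
theorem NatCouplings.bracket_eq_zero_of_bracket_bracket (q : NatCouplings p) (h : 0 < p.α) (r s : ℕ) {f : (Fin n → ℂ) → ℂ}
    (hf : p.IsInvariant f)
    (h0 : ∀ x, p.Generic x → p.bracket r s (p.bracket r s f) x = 0) {x : Fin n → ℂ}
    (hx : p.Generic x) : p.bracket r s f x = 0 := by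
  have hB := hf.bracket h r s
  -- Pair `C f` with its conjugate, `C` being the commutator. Antisymmetry moves `C` onto `conjFun
  -- (C f)`, which gives `conjFun (C (C f)) = 0`; the constant term of `|C f|²` times the weight is
  -- thus zero.
  obtain ⟨a, ha, ha'⟩ := q.bracket_antisymmetric h r s hf hB.conjFun
  have ha0 : a = 0 := by
    refine ha'.unique h ⟨0, rfl, fun x hx => ?_⟩
    have : p.bracket r s (conjFun (p.bracket r s f)) x = 0 := by
      rw [bracket_conjFun, conjFun, h0 _ hx.conj, map_zero]
    simp [this]
  subst ha0
  have h1 : p.bracket r s f x * q.halfWeight x = 0 := by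
    refine eq_zero_of_hasConstTerm (φ := fun x => p.bracket r s f x * q.halfWeight x) h
      (hB.isLaurent.mul q.isLaurent_halfWeight) (ha.congr fun x _ => ?_) hx
    rw [q.weight_eq]
    simp only [conjFun, map_mul]
    ring
  exact (mul_eq_zero.1 h1).resolve_right (q.halfWeight_ne_zero hx)

/-! ### Commutation on invariant polynomials, by induction on the degree -/

theorem dot_neg (v k : Fin n → ℤ) : dot v (-k) = -dot v k := by
  simp [dot]

/-- Flipping all signs negates the exponents. Consequently a nonzero invariant polynomial cannot
have all its degrees negative, which starts the induction on the degree. -/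
theorem WeylInvariant.neg_mem_support (h : 0 < p.α) {c : (Fin n → ℤ) →₀ ℂ}
    (hc : WeylInvariant (p.ev c)) {k : Fin n → ℤ} (hk : k ∈ c.support) : -k ∈ c.support := by
  have : c = c.equivMapDomain (Equiv.neg _) := by
    refine ev_inj h fun x _ => ?_
    rw [← hc.flip (fun _ => -1) (fun _ => Or.inr rfl) x, ev_apply,
      ev_eq_sum (s := c.support.map (Equiv.neg _).toEmbedding) (fun k hk => ?_), Finset.sum_map]
    · refine Finset.sum_congr rfl fun k _ => ?_
      simp [mono]
    · rw [Finset.mem_map_equiv]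
      simpa using hk
  rw [Finsupp.mem_support_iff] at hk ⊢
  rw [this]
  simpa using hk

/-- The operators commute on invariant Laurent polynomials. -/
theorem NatCouplings.bracket_eq_zero (q : NatCouplings p) (h : 0 < p.α) (hβ : 0 < p.β) (r s : ℕ)
    {c : (Fin n → ℤ) →₀ ℂ} (hc : WeylInvariant (p.ev c)) {x : Fin n → ℂ} (hx : p.Generic x) :
    p.bracket r s (p.ev c) x = 0 := by
  have main : ∀ (N : ℕ) (c : (Fin n → ℤ) →₀ ℂ), WeylInvariant (p.ev c) →
      (∀ k ∈ c.support, dot (dir n) k < N) → ∀ x, p.Generic x → p.bracket r s (p.ev c) x = 0 := by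
    intro N
    induction N with
    | zero =>
      intro c hc hN x _
      have hc0 : c = 0 := by
        refine Finsupp.support_eq_empty.1 (Finset.eq_empty_of_forall_notMem fun k hk => ?_)
        have h1 := hN k hk
        have h2 := hN _ (hc.neg_mem_support h hk)
        rw [dot_neg] at h2
        push_cast at h1 h2
        omega
      have hz : ∀ r, p.closedOp r (0 : (Fin n → ℂ) → ℂ) = 0 := by
        intro r
        funext x
        simp [closedOp_eq_terms]
      simp only [hc0, map_zero, bracket, hz, sub_self]
    | succ N ih =>
      intro c hc hN x hx
      -- The commutator sends `c` to an invariant polynomial `d` of smaller degree. The induction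
      -- hypothesis annihilates `d`, so the squared commutator annihilates `c`, and positivity
      -- removes the square.
      obtain ⟨d, hd, hcd⟩ := IsInvariant.bracket h ⟨c, hc, fun _ _ => rfl⟩ r s
      have hlow := bracket_lowers (D := N) h hβ regularDir_dir
        (fun k hk => by have := hN k hk; push_cast at this; omega) hcd
      refine q.bracket_eq_zero_of_bracket_bracket h r s ⟨c, hc, fun _ _ => rfl⟩ (fun x hx => ?_) hx
      have : p.bracket r s (p.bracket r s (p.ev c)) x = p.bracket r s (p.ev d) x := by
        rw [bracket, bracket]
        exact congrArg₂ _ (closedOp_congr (fun y hy => closedOp_congr hcd hy) hx)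
          (closedOp_congr (fun y hy => closedOp_congr hcd hy) hx)
      rw [this]
      exact ih d hd hlow x hx
  refine main ((∑ k ∈ c.support, |dot (dir n) k|).toNat + 1) c hc (fun k hk => ?_) x hx
  have h1 := Finset.single_le_sum (f := fun k => |dot (dir n) k|) (fun k _ => abs_nonneg _) hk
  have h2 := le_abs_self (dot (dir n) k)
  push_cast
  omega

end Params

end Koornwinder

end

noncomputable section

namespace Koornwinder

open Filter Topology

namespace DiffOp

variable {n : ℕ}

/-! ### From invariant polynomials to the coefficients -/

theorem act_commutator (β : ℝ) (A B : DiffOp n) (f : (Fin n → ℂ) → ℂ) (x : Fin n → ℂ) :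
    act β (commutator β A B) f x = act β A (act β B f) x - act β B (act β A f) x := by
  rw [act_eq_actHom, commutator, map_sub, ← act_eq_actHom, ← act_eq_actHom, act_comp, act_comp]

/-- The coefficients of a product of difference operators. -/
theorem comp_apply (β : ℝ) {A B : DiffOp n} {s : Finset (Fin n → ℤ)} (hs : A.support ⊆ s)
    (κ : Fin n → ℤ) (x : Fin n → ℂ) :
    comp β A B κ x = ∑ l ∈ s, A l x * B (κ - l) (shift β l x) := by
  classical
  rw [comp, Finsupp.sum_of_support_subset A hs _ (by
    intro l _
    simp only [Pi.zero_apply, zero_mul]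
    rw [show (fun _ : Fin n → ℂ => (0 : ℂ)) = 0 from rfl]
    simp), Finsupp.finsetSum_apply, Finset.sum_apply]
  refine Finset.sum_congr rfl fun l _ => ?_
  rw [Finsupp.sum, Finsupp.finsetSum_apply, Finset.sum_apply]
  simp only [Finsupp.single_apply]
  rw [Finset.sum_eq_single (κ - l)]
  · simp
  · intro m _ hm
    rw [if_neg fun h => hm (by rw [← h]; abel), Pi.zero_apply]
  · intro hm
    rw [Finsupp.notMem_support_iff.1 hm]
    simp

end DiffOp

namespace Params

variable {p : Params} {n : ℕ}

theorem Generic.shift {x : Fin n → ℂ} (hx : p.Generic x) (κ : Fin n → ℤ) :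
    p.Generic (shift p.β κ x) := by
  have := hx.affine 1 (fun _ => 1) (fun j => 2 * κ j) (fun _ => Or.inl rfl)
  convert this using 1
  funext j
  simp only [Koornwinder.shift, γ, Equiv.Perm.coe_one, id]
  push_cast
  ring

theorem act_commutator_D (h : 0 < p.α) (hβ : 0 < p.β) {r s : ℕ} (hr : 1 ≤ r) (hs : 1 ≤ s)
    (f : (Fin n → ℂ) → ℂ) {x : Fin n → ℂ} (hx : p.Generic x) :
    DiffOp.act p.β (DiffOp.commutator p.β (p.D n r) (p.D n s)) f x = p.bracket r s f x := by
  rw [DiffOp.act_commutator, act_D h hβ hr _ hx, act_D h hβ hs _ hx, bracket]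
  exact congrArg₂ _ (closedOp_congr (fun y hy => act_D h hβ hs f hy) hx)
    (closedOp_congr (fun y hy => act_D h hβ hr f hy) hx)

/-- `mγ` is a nonzero imaginary number, whereas the solutions of `E z = 1` are real. -/
theorem E_γ_ne_one (h : 0 < p.α) (hβ : 0 < p.β) {m : ℤ} (hm : m ≠ 0) : p.E (m * p.γ) ≠ 1 := by
  rw [Ne, E_eq_one_iff h]
  rintro ⟨k, hk⟩
  have := congrArg Complex.im hk
  have e1 : (m * p.γ : ℂ) = ((m * p.β / 2 : ℝ) : ℂ) * Complex.I := by rw [γ]; push_cast; ring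
  have e2 : (k * Real.pi / p.α : ℂ) = ((k * Real.pi / p.α : ℝ) : ℂ) := by push_cast; ring
  rw [e1, e2, Complex.ofReal_im, Complex.im_ofReal_mul, Complex.I_im, mul_one] at this
  have hm' : (m : ℝ) ≠ 0 := by exact_mod_cast hm
  refine mul_ne_zero hm' hβ.ne' ?_
  linarith

/-- The coordinates of two different translates of a generic point are separated by the
cosine. -/
theorem Generic.cs_ne (h : 0 < p.α) (hβ : 0 < p.β) {x : Fin n → ℂ} (hx : p.Generic x)
    {κ l : Fin n → ℤ} {j k : Fin n} (hjk : j = k → κ j ≠ l k) :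
    p.cs (Koornwinder.shift p.β κ x j) - p.cs (Koornwinder.shift p.β l x k) ≠ 0 := by
  rw [cs_sub]
  refine div_ne_zero (mul_ne_zero ?_ ?_) (mul_ne_zero two_ne_zero (E_ne_zero _ _)) <;>
    rw [sub_ne_zero]
  · by_cases hj : j = k
    · subst hj
      have := hx.sq_ne j (κ j + l j)
      rw [sq, ← E_add] at this
      convert this using 2
      simp only [Koornwinder.shift, γ]; push_cast; ring
    · have := hx.add_ne j k hj (2 * (κ j + l k))
      convert this using 2
      simp only [Koornwinder.shift, γ]; push_cast; ring
  · by_cases hj : j = k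
    · subst hj
      have := E_γ_ne_one h hβ (m := 2 * (κ j - l j)) (by have := hjk rfl; omega)
      convert this using 2
      simp only [Koornwinder.shift, γ]; push_cast; ring
    · have := hx.sub_ne j k hj (2 * (κ j - l k))
      convert this using 2
      simp only [Koornwinder.shift, γ]; push_cast; ring

/-- Invariant Laurent polynomials separate the translates of a generic point. -/
theorem Generic.exists_separating (h : 0 < p.α) (hβ : 0 < p.β) {x : Fin n → ℂ} (hx : p.Generic x)
    (s : Finset (Fin n → ℤ)) (κ : Fin n → ℤ) : ∃ c : (Fin n → ℤ) →₀ ℂ, WeylInvariant (p.ev c) ∧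
      p.ev c (Koornwinder.shift p.β κ x) ≠ 0 ∧
      ∀ l ∈ s, l ≠ κ → p.ev c (Koornwinder.shift p.β l x) = 0 := by
  classical
  have hdiff : ∀ l : Fin n → ℤ, ∃ i : Option (Fin n), l ≠ κ → ∃ k, i = some k ∧ κ k ≠ l k := by
    intro l
    by_cases hl : l = κ
    · exact ⟨none, fun h => absurd hl h⟩
    · obtain ⟨k, hk⟩ := Function.ne_iff.1 hl
      exact ⟨some k, fun _ => ⟨k, rfl, hk.symm⟩⟩
  choose i hi using hdiff
  -- For each `l ≠ κ` a coordinate `k` with `κ k ≠ l k` is chosen, and `a l` is its cosine at the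
  -- translate by `l`. The product over all coordinates `j` of `cs (y j) - a l` is invariant,
  -- vanishes at that translate, and is nonzero at the translate by `κ` by `cs_ne`. The default `0`
  -- belongs to `l = κ`, which is erased from the product.
  let a : (Fin n → ℤ) → ℂ := fun l =>
    (i l).elim 0 fun k => p.cs (Koornwinder.shift p.β l x k)
  let F : (Fin n → ℂ) → ℂ := fun y => ∏ l ∈ s.erase κ, ∏ j, (p.cs (y j) - a l)
  have hF : p.IsLaurent F := by
    refine IsLaurent.prod fun l _ => IsLaurent.prod fun j _ => IsLaurent.sub ?_ (IsLaurent.const _)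
    exact (IsLaurent.cs (p := p) j 1 0).congr fun x _ => by simp
  have hW : WeylInvariant F := by
    refine ⟨fun π y => ?_, fun η hη y => ?_⟩
    · refine Finset.prod_congr rfl fun l _ => ?_
      exact Equiv.prod_comp π fun j => p.cs (y j) - a l
    · refine Finset.prod_congr rfl fun l _ => Finset.prod_congr rfl fun j _ => ?_
      rcases hη j with h | h <;> simp [h, cs_neg]
  obtain ⟨c, hc⟩ := isLaurent_iff.1 hF
  refine ⟨c, weylInvariant_ev_of_generic h hW hc, ?_, fun l hl hlκ => ?_⟩
  · rw [← hc _ (hx.shift κ)]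
    refine Finset.prod_ne_zero_iff.2 fun l hl => Finset.prod_ne_zero_iff.2 fun j _ => ?_
    obtain ⟨k, hik, hk⟩ := hi l (Finset.ne_of_mem_erase hl)
    simp only [a, hik, Option.elim_some]
    exact hx.cs_ne h hβ (by rintro rfl; exact hk)
  · rw [← hc _ (hx.shift l)]
    obtain ⟨k, hik, hk⟩ := hi l hlκ
    refine Finset.prod_eq_zero (Finset.mem_erase.2 ⟨hlκ, hl⟩)
      (Finset.prod_eq_zero (Finset.mem_univ k) ?_)
    simp only [a, hik, Option.elim_some, sub_self]

/-- Applied to an invariant polynomial that vanishes at all relevant translates of `x` except the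
one by `κ`, the commutator reduces to its coefficient at `κ` times a nonzero value. -/
theorem NatCouplings.commutator_eq_zero_of_generic (q : NatCouplings p) (h : 0 < p.α)
    (hβ : 0 < p.β) {r s : ℕ} (hr : 1 ≤ r) (hs : 1 ≤ s) {x : Fin n → ℂ} (hx : p.Generic x)
    (κ : Fin n → ℤ) : DiffOp.commutator p.β (p.D n r) (p.D n s) κ x = 0 := by
  set C := DiffOp.commutator p.β (p.D n r) (p.D n s) with hC
  by_cases hκ : κ ∈ C.support
  · obtain ⟨c, hc, h1, h0⟩ := hx.exists_separating h hβ C.support κ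
    have := q.bracket_eq_zero h hβ r s hc hx
    rw [← act_commutator_D h hβ hr hs _ hx, ← hC, DiffOp.act, Finsupp.sum,
      Finset.sum_eq_single κ (fun l hl hlκ => by rw [h0 l hl hlκ, mul_zero])
        (fun h => absurd hκ h)] at this
    exact (mul_eq_zero.1 this).resolve_right h1
  · rw [Finsupp.notMem_support_iff.1 hκ, Pi.zero_apply]

/-! ### Extension from generic to regular points -/

/-- The multi-indices with entries `-1, 0, 1`. -/
def unitBox (n : ℕ) : Finset (Fin n → ℤ) := Fintype.piFinset fun _ => Finset.Icc (-1) 1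

theorem mem_unitBox {κ : Fin n → ℤ} : κ ∈ unitBox n ↔ ∀ j, |κ j| ≤ 1 := by
  simp [unitBox, abs_le]

theorem signVec_mem_unitBox {J K : Finset (Fin n)} {ε : Fin n → ℤ} (hε : ε ∈ signs J) :
    signVec ε K ∈ unitBox n := by
  rw [mem_signs] at hε
  rw [mem_unitBox]
  intro j
  rw [signVec]
  split_ifs
  · by_cases hj : j ∈ J
    · rcases hε.1 j hj with h | h <;> simp [h]
    · simp [hε.2 j hj]
  · simp

theorem D_apply (r : ℕ) (κ : Fin n → ℤ) (x : Fin n → ℂ) : p.D n r κ x =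
    ∑ J : Finset (Fin n) with J.card = r, ∑ ε ∈ signs J,
    ∑ t ∈ Finset.range r, ∑ c ∈ chains (t + 1) J,
      ((((if signVec ε (c 1) = κ then 1 else 0) - (if 0 = κ then 1 else 0) : ℤ) * (-1) ^ t : ℤ) : ℂ) *
        p.chainCoeff ε c x := by
  simp only [D, Finsupp.finsetSum_apply, Finset.sum_apply, Finsupp.sub_apply, Pi.sub_apply,
    Finsupp.single_apply]
  refine Finset.sum_congr rfl fun J _ => Finset.sum_congr rfl fun ε _ =>
    Finset.sum_congr rfl fun t _ => Finset.sum_congr rfl fun c _ => ?_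
  split_ifs <;> simp

/-- Only the translations by sign vectors and the identity occur, so the coefficients of a product
at `x` involve the factors only at the translates for which `CommutatorRegularAt` asks regularity.
-/
theorem D_support_subset (r : ℕ) : (p.D n r).support ⊆ unitBox n := by
  intro κ hκ
  by_contra hbox
  refine Finsupp.mem_support_iff.1 hκ ?_
  funext x
  rw [D_apply, Pi.zero_apply]
  refine Finset.sum_eq_zero fun J _ => Finset.sum_eq_zero fun ε hε =>
    Finset.sum_eq_zero fun t _ => Finset.sum_eq_zero fun c _ => ?_
  rw [if_neg, if_neg]
  · simp
  · rintro rfl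
    exact hbox (by simp [mem_unitBox])
  · rintro rfl
    exact hbox (signVec_mem_unitBox hε)

/-- The elementary factors of the coefficients, along a family of parameters and points, belong to
a ring of functions. -/
structure FactorsMem {T : Type*} (S : Subring (T → ℂ)) (q : T → Params)
    (X : T → Fin n → ℂ) : Prop where
  vb_mem : ∀ j (ε : ℤ), (ε = 1 ∨ ε = -1) → (fun t => (q t).vb (ε * X t j)) ∈ S
  va_mem : ∀ j k, j ≠ k → ∀ ε ε' : ℤ, (ε = 1 ∨ ε = -1) → (ε' = 1 ∨ ε' = -1) →
    (fun t => (q t).va (ε * X t j + ε' * X t k)) ∈ S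
  va_γ_mem : ∀ j k, j ≠ k → ∀ ε ε' : ℤ, (ε = 1 ∨ ε = -1) → (ε' = 1 ∨ ε' = -1) →
    (fun t => (q t).va (ε * X t j + ε' * X t k + 2 * (q t).γ)) ∈ S

section

variable {T : Type*} {S : Subring (T → ℂ)} {q : T → Params} {X : T → Fin n → ℂ}

theorem sum_mem' {ι : Type*} {s : Finset ι} {φ : ι → T → ℂ} (hφ : ∀ i ∈ s, φ i ∈ S) :
    (fun t => ∑ i ∈ s, φ i t) ∈ S := by
  have := S.sum_mem hφ
  rwa [show ∑ i ∈ s, φ i = fun t => ∑ i ∈ s, φ i t from funext fun t => Finset.sum_apply _ _ _]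
    at this

theorem prod_mem' {ι : Type*} {s : Finset ι} {φ : ι → T → ℂ} (hφ : ∀ i ∈ s, φ i ∈ S) :
    (fun t => ∏ i ∈ s, φ i t) ∈ S := by
  have := S.prod_mem hφ
  rwa [show ∏ i ∈ s, φ i = fun t => ∏ i ∈ s, φ i t from funext fun t => Finset.prod_apply _ _ _]
    at this

theorem FactorsMem.V_mem (H : FactorsMem S q X) {J K : Finset (Fin n)} {ε : Fin n → ℤ}
    (hε : ∀ j ∈ J, ε j = 1 ∨ ε j = -1) (hJK : Disjoint J K) :
    (fun t => (q t).V ε J K (X t)) ∈ S := by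
  refine S.mul_mem (S.mul_mem (prod_mem' fun j hj => H.vb_mem j _ (hε j hj))
    (prod_mem' fun j hj => prod_mem' fun k hk => ?_))
    (prod_mem' fun j hj => prod_mem' fun k hk => ?_)
  · rw [Finset.mem_filter] at hk
    exact S.mul_mem (H.va_mem j k hk.2.ne _ _ (hε j hj) (hε k hk.1))
      (H.va_γ_mem j k hk.2.ne _ _ (hε j hj) (hε k hk.1))
  · have hjk : j ≠ k := fun h => Finset.disjoint_left.1 hJK hj (h ▸ hk)
    refine S.mul_mem ?_ ?_
    · simpa using H.va_mem j k hjk _ 1 (hε j hj) (Or.inl rfl)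
    · simpa [sub_eq_add_neg] using H.va_mem j k hjk _ (-1) (hε j hj) (Or.inr rfl)

theorem FactorsMem.D_mem (H : FactorsMem S q X) (r : ℕ) (κ : Fin n → ℤ) :
    (fun t => (q t).D n r κ (X t)) ∈ S := by
  simp only [D_apply]
  refine sum_mem' fun J _ => sum_mem' fun ε hε => sum_mem' fun t _ => sum_mem' fun c hc =>
    S.mul_mem (intCast_mem S _) (prod_mem' fun i _ => H.V_mem (fun j hj => ?_) ?_)
  · rw [mem_signs] at hε
    simp only [chains, Finset.mem_filter, Finset.mem_univ, true_and] at hc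
    refine hε.1 j ?_
    rw [← hc.2.2]
    exact hc.2.1.monotone (Fin.le_last _) (Finset.mem_sdiff.1 hj).1
  · rw [Finset.disjoint_left]
    exact fun j hj hj' => Finset.mem_compl.1 hj' (Finset.mem_sdiff.1 hj).1

/-- The coefficients of the commutator are obtained by ring operations from the elementary factors
at translates in the unit box. This is used for two rings: functions continuous at a point, with `x`
varying, and Laurent polynomials in an exponential, with a coupling constant varying. -/
theorem commutator_mem (H : ∀ κ ∈ unitBox n, FactorsMem S q fun t => shift (q t).β κ (X t))
    (r s : ℕ) (κ : Fin n → ℤ) :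
    (fun t => DiffOp.commutator (q t).β ((q t).D n r) ((q t).D n s) κ (X t)) ∈ S := by
  have H0 : FactorsMem S q X := by
    convert H 0 (by simp [mem_unitBox]) using 2
    funext j
    simp [shift]
  simp only [DiffOp.commutator, Finsupp.sub_apply, Pi.sub_apply,
    DiffOp.comp_apply _ (D_support_subset _)]
  exact S.sub_mem (sum_mem' fun l hl => S.mul_mem (H0.D_mem r l) ((H l hl).D_mem s _))
    (sum_mem' fun l hl => S.mul_mem (H0.D_mem s l) ((H l hl).D_mem r _))

end

/-- The ring of complex functions continuous at a point. -/
def continuousAtSubring {T : Type*} [TopologicalSpace T] (x : T) : Subring (T → ℂ) where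
  carrier := {φ | ContinuousAt φ x}
  mul_mem' h h' := ContinuousAt.mul h h'
  one_mem' := continuousAt_const
  add_mem' h h' := ContinuousAt.add h h'
  zero_mem' := continuousAt_const
  neg_mem' h := ContinuousAt.neg h

theorem mem_pm {ε : ℤ} (hε : ε = 1 ∨ ε = -1) : ε ∈ ({1, -1} : Finset ℤ) := by simpa using hε

theorem continuousAt_va {z : ℂ} (hz : Complex.sin (p.α * z) ≠ 0) : ContinuousAt p.va z := by
  unfold va
  exact ContinuousAt.div (by fun_prop) (by fun_prop) hz

theorem continuousAt_vb {z : ℂ} (h1 : Complex.sin (p.α * z) ≠ 0) (h2 : Complex.cos (p.α * z) ≠ 0)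
    (h3 : Complex.sin (p.α * (p.γ + z)) ≠ 0) (h4 : Complex.cos (p.α * (p.γ + z)) ≠ 0) :
    ContinuousAt p.vb z := by
  unfold vb
  refine ContinuousAt.mul (ContinuousAt.mul (ContinuousAt.mul ?_ ?_) ?_) ?_
  · exact ContinuousAt.div (by fun_prop) (by fun_prop) h1
  · exact ContinuousAt.div (by fun_prop) (by fun_prop) h2
  · exact ContinuousAt.div (by fun_prop) (by fun_prop) h3
  · exact ContinuousAt.div (by fun_prop) (by fun_prop) h4

theorem RegularAt.factorsMem {x : Fin n → ℂ} {κ : Fin n → ℤ}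
    (hx : p.RegularAt (shift p.β κ x)) :
    FactorsMem (continuousAtSubring x) (fun _ => p) fun y => shift p.β κ y := by
  have hs : ∀ j, Continuous fun y : Fin n → ℂ => shift p.β κ y j := by
    intro j; unfold shift; fun_prop
  refine ⟨fun j ε hε => ?_, fun j k hjk ε ε' hε hε' => ?_, fun j k hjk ε ε' hε hε' => ?_⟩
  · have h1 : Complex.sin (p.α * (ε * shift p.β κ x j)) ≠ 0 := by
      have := hx.sin_ne j
      rcases hε with rfl | rfl <;> simpa using this
    have h2 : Complex.cos (p.α * (ε * shift p.β κ x j)) ≠ 0 := by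
      have := hx.cos_ne j
      rcases hε with rfl | rfl <;> simpa using this
    exact ContinuousAt.comp (f := fun y : Fin n → ℂ => (ε : ℂ) * shift p.β κ y j)
      (continuousAt_vb h1 h2 (hx.sin_γ_ne j ε (mem_pm hε)) (hx.cos_γ_ne j ε (mem_pm hε)))
      (continuous_const.mul (hs j)).continuousAt
  · exact ContinuousAt.comp
      (f := fun y : Fin n → ℂ => (ε : ℂ) * shift p.β κ y j + ε' * shift p.β κ y k)
      (continuousAt_va (hx.sin_pair_ne j k hjk ε (mem_pm hε) ε' (mem_pm hε')))
      ((continuous_const.mul (hs j)).add (continuous_const.mul (hs k))).continuousAt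
  · exact ContinuousAt.comp
      (f := fun y : Fin n → ℂ => (ε : ℂ) * shift p.β κ y j + ε' * shift p.β κ y k + 2 * p.γ)
      (continuousAt_va (hx.sin_pair_γ_ne j k hjk ε (mem_pm hε) ε' (mem_pm hε')))
      (((continuous_const.mul (hs j)).add (continuous_const.mul (hs k))).add
        continuous_const).continuousAt

/-- At a regular point the coefficient is continuous, and it vanishes at the generic points, which
accumulate there. -/
theorem NatCouplings.commutator_eq_zero (q : NatCouplings p) (h : 0 < p.α)
    (hβ : 0 < p.β) {r s : ℕ} (hr : 1 ≤ r) (hs : 1 ≤ s) {x : Fin n → ℂ}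
    (hx : p.CommutatorRegularAt x) (κ : Fin n → ℤ) :
    DiffOp.commutator p.β (p.D n r) (p.D n s) κ x = 0 := by
  refine eq_zero_of_generic (φ := DiffOp.commutator p.β (p.D n r) (p.D n s) κ) h ?_
    fun y hy => q.commutator_eq_zero_of_generic h hβ hr hs hy κ
  exact commutator_mem (S := continuousAtSubring x) (q := fun _ => p) (X := fun y => y)
    (fun κ hκ => (hx κ (mem_unitBox.1 hκ)).factorsMem) r s κ

/-! ### Continuation from integral to real couplings -/

/-- The functions of a real variable that are Laurent polynomials in `exp(by)`. -/
def expSubring (b : ℝ) : Subring (ℝ → ℂ) where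
  carrier := {φ | ∃ (N : ℕ) (P : Polynomial ℂ), ∀ y : ℝ,
    φ y * (Real.exp (b * y) : ℂ) ^ N = P.eval (Real.exp (b * y) : ℂ)}
  mul_mem' := by
    rintro φ ψ ⟨N, P, hP⟩ ⟨M, Q, hQ⟩
    refine ⟨N + M, P * Q, fun y => ?_⟩
    rw [Polynomial.eval_mul, ← hP, ← hQ, Pi.mul_apply, pow_add]
    ring
  one_mem' := ⟨0, 1, fun y => by simp⟩
  add_mem' := by
    rintro φ ψ ⟨N, P, hP⟩ ⟨M, Q, hQ⟩
    refine ⟨N + M, P * Polynomial.X ^ M + Q * Polynomial.X ^ N, fun y => ?_⟩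
    simp only [Polynomial.eval_add, Polynomial.eval_mul, Polynomial.eval_pow, Polynomial.eval_X,
      ← hP, ← hQ, Pi.add_apply, pow_add]
    ring
  zero_mem' := ⟨0, 0, fun y => by simp⟩
  neg_mem' := by
    rintro φ ⟨N, P, hP⟩
    refine ⟨N, -P, fun y => ?_⟩
    rw [Polynomial.eval_neg, ← hP, Pi.neg_apply, neg_mul]

theorem const_mem_expSubring (b : ℝ) (a : ℂ) : (fun _ => a) ∈ expSubring b :=
  ⟨0, Polynomial.C a, fun y => by simp⟩

theorem exp_mem_expSubring (b : ℝ) : (fun y : ℝ => (Real.exp (b * y) : ℂ)) ∈ expSubring b :=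
  ⟨0, Polynomial.X, fun y => by simp⟩

theorem exp_neg_mem_expSubring (b : ℝ) :
    (fun y : ℝ => (Real.exp (-(b * y)) : ℂ)) ∈ expSubring b :=
  ⟨1, 1, fun y => by
    rw [pow_one, ← Complex.ofReal_mul, ← Real.exp_add]
    simp⟩

/-- A Laurent polynomial in `exp(by)` that vanishes at all positive integers vanishes. -/
theorem eq_zero_of_mem_expSubring {b : ℝ} (hb : b ≠ 0) {φ : ℝ → ℂ} (hφ : φ ∈ expSubring b)
    (h0 : ∀ m : ℕ, φ (m + 1 : ℕ) = 0) (y : ℝ) : φ y = 0 := by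
  obtain ⟨N, P, hP⟩ := hφ
  -- After the denominator is cleared, `P` has the infinitely many distinct roots `exp (b (m + 1))`.
  have hP0 : P = 0 := by
    refine Polynomial.eq_zero_of_infinite_isRoot P (Set.infinite_of_injective_forall_mem
      (f := fun m : ℕ => (Real.exp (b * (m + 1 : ℕ)) : ℂ)) (fun m k hmk => ?_) fun m => ?_)
    · have h1 := mul_left_cancel₀ hb (Real.exp_injective (Complex.ofReal_injective hmk))
      have h2 : m + 1 = k + 1 := by exact_mod_cast h1
      omega
    · change P.eval _ = 0
      rw [← hP, h0, zero_mul]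
  have h1 := hP y
  rw [hP0, Polynomial.eval_zero] at h1
  exact (mul_eq_zero.1 h1).resolve_right (pow_ne_zero _ (by
    exact_mod_cast Real.exp_ne_zero _))

/-- A coupling constant that is either constant or the variable itself. -/
def IsAffineCoupling (G : ℝ → ℝ) : Prop := (∀ y, G y = y) ∨ ∃ a, ∀ y, G y = a

/-- Since `i · iβy = -βy`, a coupling `y` enters the two exponentials of a sine or cosine only
through `exp (∓αβy)`. -/
theorem exp_coupling_mem {α β : ℝ} {G : ℝ → ℝ} (hG : IsAffineCoupling G) (z : ℂ) :
    (fun y => Complex.exp (α * (Complex.I * β * G y + z) * Complex.I)) ∈ expSubring (α * β) ∧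
    (fun y => Complex.exp (-(α * (Complex.I * β * G y + z)) * Complex.I)) ∈
      expSubring (α * β) := by
  rcases hG with hG | ⟨a, hG⟩
  · constructor
    · have := (expSubring (α * β)).mul_mem (exp_neg_mem_expSubring (α * β))
        (const_mem_expSubring _ (Complex.exp (α * z * Complex.I)))
      convert this using 1
      funext y
      rw [Pi.mul_apply, Complex.ofReal_exp, ← Complex.exp_add, hG]
      congr 1
      push_cast
      linear_combination (α * β * y : ℂ) * Complex.I_sq
    · have := (expSubring (α * β)).mul_mem (exp_mem_expSubring (α * β))
        (const_mem_expSubring _ (Complex.exp (-(α * z * Complex.I))))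
      convert this using 1
      funext y
      rw [Pi.mul_apply, Complex.ofReal_exp, ← Complex.exp_add, hG]
      congr 1
      push_cast
      linear_combination -(α * β * y : ℂ) * Complex.I_sq
  · simp only [hG]
    exact ⟨const_mem_expSubring _ _, const_mem_expSubring _ _⟩

theorem sin_coupling_mem {α β : ℝ} {G : ℝ → ℝ} (hG : IsAffineCoupling G) (z : ℂ) :
    (fun y => Complex.sin (α * (Complex.I * β * G y + z))) ∈ expSubring (α * β) := by
  obtain ⟨h1, h2⟩ := exp_coupling_mem (α := α) (β := β) hG z
  exact ((expSubring _).mul_mem ((expSubring _).mul_mem ((expSubring _).sub_mem h2 h1)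
    (const_mem_expSubring _ Complex.I)) (const_mem_expSubring _ (2⁻¹ : ℂ)))

theorem cos_coupling_mem {α β : ℝ} {G : ℝ → ℝ} (hG : IsAffineCoupling G) (z : ℂ) :
    (fun y => Complex.cos (α * (Complex.I * β * G y + z))) ∈ expSubring (α * β) := by
  obtain ⟨h1, h2⟩ := exp_coupling_mem (α := α) (β := β) hG z
  exact ((expSubring _).mul_mem ((expSubring _).add_mem h1 h2)
    (const_mem_expSubring _ (2⁻¹ : ℂ)))

/-- Families of parameters along which `α` and `β` are fixed and the coupling constants are fixed
or equal to the variable. -/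
structure AffineFamily (α β : ℝ) (q : ℝ → Params) : Prop where
  α_eq : ∀ y, (q y).α = α
  β_eq : ∀ y, (q y).β = β
  g : IsAffineCoupling fun y => (q y).g
  g₀ : IsAffineCoupling fun y => (q y).g₀
  g₁ : IsAffineCoupling fun y => (q y).g₁
  g₀' : IsAffineCoupling fun y => (q y).g₀'
  g₁' : IsAffineCoupling fun y => (q y).g₁'

/-- The coupling constants occur only in numerators; the denominators depend on `α`, `β` and the
point alone and are constants along the family. -/
theorem AffineFamily.factorsMem {α β : ℝ} {q : ℝ → Params} (hq : AffineFamily α β q)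
    (X : Fin n → ℂ) : FactorsMem (expSubring (α * β)) q fun _ => X := by
  have hγ : ∀ y, (q y).γ = Complex.I * β / 2 := fun y => by rw [γ, hq.β_eq]
  have hva : ∀ z, (fun y => (q y).va z) ∈ expSubring (α * β) := by
    intro z
    simp only [va, μ, hq.α_eq, hq.β_eq, div_eq_mul_inv]
    exact (expSubring _).mul_mem (sin_coupling_mem hq.g z) (const_mem_expSubring _ _)
  refine ⟨fun j ε _ => ?_, fun j k _ ε ε' _ _ => hva _, fun j k _ ε ε' _ _ => ?_⟩
  · simp only [vb, μ₀, μ₁, μ₀', μ₁', hγ, hq.α_eq, hq.β_eq, div_eq_mul_inv (Complex.sin _),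
      div_eq_mul_inv (Complex.cos _), add_assoc]
    exact (expSubring _).mul_mem ((expSubring _).mul_mem ((expSubring _).mul_mem
      ((expSubring _).mul_mem (sin_coupling_mem hq.g₀ _) (const_mem_expSubring _ _))
      ((expSubring _).mul_mem (cos_coupling_mem hq.g₁ _) (const_mem_expSubring _ _)))
      ((expSubring _).mul_mem (sin_coupling_mem hq.g₀' _) (const_mem_expSubring _ _)))
      ((expSubring _).mul_mem (cos_coupling_mem hq.g₁' _) (const_mem_expSubring _ _))
  · simp only [hγ]
    exact hva _

/-- The commutator vanishes along a family once it does at the positive integers. -/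
theorem AffineFamily.commutator_eq_zero {α β : ℝ} (hα : 0 < α) (hβ : 0 < β) {q : ℝ → Params}
    (hq : AffineFamily α β q) {r s : ℕ} {κ : Fin n → ℤ} {x : Fin n → ℂ}
    (h0 : ∀ m : ℕ, DiffOp.commutator (q (m + 1 : ℕ)).β ((q (m + 1 : ℕ)).D n r)
      ((q (m + 1 : ℕ)).D n s) κ x = 0) (y : ℝ) :
    DiffOp.commutator (q y).β ((q y).D n r) ((q y).D n s) κ x = 0 := by
  refine eq_zero_of_mem_expSubring (mul_pos hα hβ).ne' (commutator_mem (S := expSubring (α * β))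
    (q := q) (X := fun _ => x) (fun κ _ => ?_) r s κ) h0 y
  simp only [hq.β_eq]
  exact hq.factorsMem _

theorem CommutatorRegularAt.congr {p' : Params} (hα : p'.α = p.α) (hβ : p'.β = p.β)
    {x : Fin n → ℂ} (hx : p.CommutatorRegularAt x) : p'.CommutatorRegularAt x := by
  intro κ hκ
  have h := hx κ hκ
  have hγ : p'.γ = p.γ := by rw [γ, γ, hβ]
  rw [hβ]
  constructor
  · simpa only [hα] using h.sin_ne
  · simpa only [hα] using h.cos_ne
  · simpa only [hα, hγ] using h.sin_γ_ne
  · simpa only [hα, hγ] using h.cos_γ_ne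
  · simpa only [hα] using h.sin_pair_ne
  · simpa only [hα, hγ] using h.sin_pair_γ_ne

/-- A property of the parameters that holds along an affine family once it holds at the positive
integers holds for all coupling constants once it holds for positive integral ones. -/
theorem induction_couplings {α β : ℝ} {P : Params → Prop}
    (hP : ∀ q : ℝ → Params, AffineFamily α β q → (∀ m : ℕ, P (q (m + 1 : ℕ))) → ∀ y, P (q y))
    (h0 : ∀ a a₀ a₁ a₀' a₁' : ℕ, P ⟨α, β, (a + 1 : ℕ), (a₀ + 1 : ℕ), (a₁ + 1 : ℕ), (a₀' + 1 : ℕ),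
      (a₁' + 1 : ℕ)⟩) (g g₀ g₁ g₀' g₁' : ℝ) : P ⟨α, β, g, g₀, g₁, g₀', g₁'⟩ := by
  have hv : IsAffineCoupling fun y => y := Or.inl fun _ => rfl
  have hc : ∀ a : ℝ, IsAffineCoupling fun _ => a := fun a => Or.inr ⟨a, fun _ => rfl⟩
  -- The couplings are freed one at a time. While one varies over the reals, the earlier ones are
  -- already arbitrary and the later ones are still positive integers.
  have h1 (a₀ a₁ a₀' a₁' : ℕ) (g : ℝ) : P ⟨α, β, g, (a₀ + 1 : ℕ), (a₁ + 1 : ℕ), (a₀' + 1 : ℕ),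
      (a₁' + 1 : ℕ)⟩ :=
    hP (fun y => ⟨α, β, y, (a₀ + 1 : ℕ), (a₁ + 1 : ℕ), (a₀' + 1 : ℕ), (a₁' + 1 : ℕ)⟩)
      ⟨fun _ => rfl, fun _ => rfl, hv, hc _, hc _, hc _, hc _⟩ (fun a => h0 a a₀ a₁ a₀' a₁') g
  have h2 (a₁ a₀' a₁' : ℕ) (g₀ : ℝ) : P ⟨α, β, g, g₀, (a₁ + 1 : ℕ), (a₀' + 1 : ℕ),
      (a₁' + 1 : ℕ)⟩ :=
    hP (fun y => ⟨α, β, g, y, (a₁ + 1 : ℕ), (a₀' + 1 : ℕ), (a₁' + 1 : ℕ)⟩)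
      ⟨fun _ => rfl, fun _ => rfl, hc _, hv, hc _, hc _, hc _⟩ (fun a => h1 a a₁ a₀' a₁' g) g₀
  have h3 (a₀' a₁' : ℕ) (g₁ : ℝ) : P ⟨α, β, g, g₀, g₁, (a₀' + 1 : ℕ), (a₁' + 1 : ℕ)⟩ :=
    hP (fun y => ⟨α, β, g, g₀, y, (a₀' + 1 : ℕ), (a₁' + 1 : ℕ)⟩)
      ⟨fun _ => rfl, fun _ => rfl, hc _, hc _, hv, hc _, hc _⟩ (fun a => h2 a a₀' a₁' g₀) g₁
  have h4 (a₁' : ℕ) (g₀' : ℝ) : P ⟨α, β, g, g₀, g₁, g₀', (a₁' + 1 : ℕ)⟩ :=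
    hP (fun y => ⟨α, β, g, g₀, g₁, y, (a₁' + 1 : ℕ)⟩)
      ⟨fun _ => rfl, fun _ => rfl, hc _, hc _, hc _, hv, hc _⟩ (fun a => h3 a a₁' g₁) g₀'
  exact hP (fun y => ⟨α, β, g, g₀, g₁, g₀', y⟩)
    ⟨fun _ => rfl, fun _ => rfl, hc _, hc _, hc _, hc _, hv⟩ (fun a => h4 a g₀') g₁'

theorem commutator_eq_zero (h : 0 < p.α) (hβ : 0 < p.β) {r s : ℕ} (hr : 1 ≤ r) (hs : 1 ≤ s)
    {x : Fin n → ℂ} (hx : p.CommutatorRegularAt x) (κ : Fin n → ℤ) :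
    DiffOp.commutator p.β (p.D n r) (p.D n s) κ x = 0 := by
  have key : ∀ p' : Params, p'.α = p.α → p'.β = p.β → NatCouplings p' →
      DiffOp.commutator p'.β (p'.D n r) (p'.D n s) κ x = 0 := fun p' hα' hβ' q =>
    q.commutator_eq_zero (hα' ▸ h) (hβ' ▸ hβ) hr hs (hx.congr hα' hβ') κ
  refine induction_couplings (α := p.α) (β := p.β)
    (P := fun p => DiffOp.commutator p.β (p.D n r) (p.D n s) κ x = 0)
    (fun q hq h0 y => hq.commutator_eq_zero h hβ h0 y) (fun a a₀ a₁ a₀' a₁' => key _ rfl rfl ?_)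
    p.g p.g₀ p.g₁ p.g₀' p.g₁'
  -- The continuation runs over positive integers `m + 1`. For `g` this shift is part of
  -- `NatCouplings`, so its witness is `a`; the other couplings are represented directly and need
  -- the `+ 1`.
  exact ⟨a, a₀ + 1, a₁ + 1, a₀' + 1, a₁' + 1, rfl, rfl, rfl, rfl, rfl⟩

end Params

end Koornwinder

end

theorem mainTheorem2 (n : ℕ) (p : Koornwinder.Params) (hp : p.Admissible)
    (r s : ℕ) (hr : 1 ≤ r ∧ r ≤ n) (hs : 1 ≤ s ∧ s ≤ n)
    (x : Fin n → ℂ) (hx : p.CommutatorRegularAt x) :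
    (∀ κ : Fin n → ℤ,
      Koornwinder.DiffOp.commutator p.β (p.D n r) (p.D n s) κ x = 0) ∧
    (∀ f : (Fin n → ℂ) → ℂ,
      Koornwinder.DiffOp.act p.β (p.D n r) (Koornwinder.DiffOp.act p.β (p.D n s) f) x =
        Koornwinder.DiffOp.act p.β (p.D n s) (Koornwinder.DiffOp.act p.β (p.D n r) f) x) := by
  have key := fun κ => Koornwinder.Params.commutator_eq_zero hp.α_pos hp.β_pos hr.1 hs.1 hx κ
  refine ⟨key, fun f => sub_eq_zero.1 ?_⟩
  rw [← Koornwinder.DiffOp.act_commutator]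
  exact Finset.sum_eq_zero fun κ _ => by simp only [key κ, zero_mul]
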